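/- **Setting.** Let $T,\rho,L>0$, $0\le t\le T$, $w>0$, $S_0>0$, $K\in\mathbb N$, and let $\boldsymbol\pi$ belong to the simplex $\Delta_K=\{q\in[0,1]^K:\sum_j q^j=1\}$. On a filtered probability space satisfying the usual conditions, over the time interval $[t,T]$, let $Y$ be a càdlàg Markov chain with states $e_1,\dots,e_K$, a fixed generator $Q$ (no market impact: $Q$ does not depend on the investor's strategy) and initial law $P(Y_t=e_i)=\pi^i$. Let $N(ds,d\zeta)$ be a Poisson random measure relative to the filtration, with mark space $\mathcal Z\subseteq\mathbb R$ and finite intensity $\varsigma(d\zeta)ds$, independent of $Y$. Let $G:[0,T]\times\{e_1,\dots,e_K\}\times\mathcal Z\to(-1,\infty)$ be measurable, continuous in time, with $E\int_t^T\!\int_{\mathcal Z} G^2(s,Y_{s-},\zeta)\,\varsigma(d\zeta)ds<\infty$. The asset price solves $dS_s=S_{s-}\int G(s,Y_{s-},\zeta)N(ds,d\zeta)$ with $S_t=S_0$; let $R_s=\int_t^s\!\int G(u,Y_{u-},\zeta)N(du,d\zeta)$ be the return process, $\mu$ its jump measure, and $$\eta^P(s,e_i,A)=\varsigma\{\zeta: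 G(s,e_i,\zeta)\in A\setminus\{0\}\}.$$ The investor observes $S$ only: $\mathbb F^S$ is the filtration generated by $S$ on $[t,T]$, augmented to satisfy the usual conditions, and $\pi_s^i=P(Y_s=e_i\mid\mathcal F^S_s)$ is the (càdlàg, $\Delta_K$-valued) filter, with $\pi_{t-}:=\pi_t$. A strategy $h$ is *admissible* if it is $\mathbb F^S$-predictable, takes values in $[-L,L]$, and almost surely $\eta^P(s,e_i,\Theta)=0$ for all $s\in[t,T]$ and all $i$, where $\Theta=\{z: 1+h_uz\le 0\text{ for some }u\in[t,T]\}$. Its wealth process solves $dW_s=W_{s-}\big((1-h_s)\rho\,ds+h_s\int z\,\mu(ds,dz)\big)$, $W_t=w$. The value is $V(t,w,\boldsymbol\pi)=\sup_h E[\log W^{(h)}_T]\in[-\infty,\infty]$ over admissible $h$, where $E[X]=E[X^+]-E[X^-]$. For $s\in[t,T]$, $q\in\Delta_K$, $h\in[-L,L]$ put $m(s,q,h)=\sum_{j=1}^K q^j\int_{\mathbb R}\frac{z}{1+hz}\,\eta^P(s,e_j,dz)$. Call a Borel function $h^*$ a *log-optimal rule* if for all $s\in[t,T]$, $q\in\Delta_K$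 we have $h^*(s,q)\in[-L,L]$, the integrals with $q^j\neq0$ in $m(s,q,h^*(s,q))$ converge absolutely, and either $$\sum_{j=1}^K q^j\int_{\mathbb R}\frac{z}{1+h^*(s,q)z}\,\eta^P(s,e_j,dz)=\rho,$$ or $h^*(s,q)=L$ and $m(s,q,L)>\rho$, or $h^*(s,q)=-L$ and $m(s,q,-L)<\rho$. **Proposition.** 0. If $\eta^P(s,e_i,\{z:1+hz\le0\})=0$ for all $s\in[t,T]$, all $i$ and all $h\in[-L,L]$, then there is a log-optimal rule $h^*$ such that the strategy $h^*_s=h^*(s,\pi_{s-})$ satisfies the condition on $\Theta$ above. Now let $h^*$ be any log-optimal rule such that the strategy $h^*_s=h^*(s,\pi_{s-})$ satisfies the condition on $\Theta$ above. Then: 1. $h^*_s=h^*(s,\pi_{s-})$ is admissible, it has a wealth process, and it is optimal: $E[\log W^{(h^*)}_T]=V(t,w,\boldsymbol\pi)$. 2. The value function is finite and $$V(t,w,\boldsymbol\pi)=\log w+E\left[\int_t^T\Big((1-h^*_s)\rho+\sum_{i=1}^K\pi_s^i\int_{\mathbb R}\log(1+h^*_sz)\,\eta^P(s,e_i,dz)\Big)ds\right],$$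 where, for almost every $(s,\omega)$, the inner integrals with $\pi^i_s\ne0$ converge absolutely, and the integrand in $s$ and $\omega$ is integrable. -/

import Mathlib

open MeasureTheory ProbabilityTheory Filter Topology
open scoped ENNReal NNReal

noncomputable section

namespace LogUtility

/-! ### General notions -/

/-- Right-continuous paths with left limits. -/
def IsCadlag {ι β : Type*} [LinearOrder ι] [TopologicalSpace ι] [TopologicalSpace β]
    (f : ι → β) : Prop :=
  ∀ s, ContinuousWithinAt f (Set.Ici s) s ∧ ∃ l, Tendsto f (𝓝[<] s) (𝓝 l)

/-- The expectation `E[X⁺] - E[X⁻]` of a real random variable, with values in `[-∞, ∞]`. -/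
def extExpectation {Ω : Type*} [MeasurableSpace Ω] (P : Measure Ω) (X : Ω → ℝ) : EReal :=
  ((∫⁻ ω, ENNReal.ofReal (X ω) ∂P : ℝ≥0∞) : EReal)
    - ((∫⁻ ω, ENNReal.ofReal (-X ω) ∂P : ℝ≥0∞) : EReal)

/-- The filtration obtained by adding all `P`-null events to every `σ`-algebra of `F`. -/
def addNullSets {Ω ι : Type*} [Preorder ι] {mΩ : MeasurableSpace Ω} (P : Measure Ω)
    (F : Filtration ι mΩ) : Filtration ι mΩ where
  seq t := F t ⊔ MeasurableSpace.generateFrom {A | MeasurableSet[mΩ] A ∧ P A = 0}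
  mono' _ _ hst := sup_le_sup_right (F.mono hst) _
  le' t := sup_le (F.le t) (MeasurableSpace.generateFrom_le fun _ hA => hA.1)

/-- The usual conditions: right-continuity, and all null events belong to every `F t`. -/
structure UsualConditions {Ω ι : Type*} [PartialOrder ι] {mΩ : MeasurableSpace Ω}
    (P : Measure Ω) (F : Filtration ι mΩ) : Prop where
  rightCont : F.IsRightContinuous
  null_mem : ∀ t A, MeasurableSet A → P A = 0 → MeasurableSet[F t] A

/-- Lebesgue measure on the time interval `[a, b]`. -/
def timeMeasure (a b : ℝ) : Measure (Set.Icc a b) := (volume : Measure ℝ).comap Subtype.val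

/-- The `σ`-algebra generated by the values `N(A)` of a random measure on the measurable sets
`A ⊆ B`. -/
@[reducible]
def randomMeasureSigma {Ω E : Type*} [MeasurableSpace E] (N : Ω → Measure E) (B : Set E) :
    MeasurableSpace Ω :=
  ⨆ (A : Set E) (_ : MeasurableSet A) (_ : A ⊆ B),
    MeasurableSpace.comap (fun ω => N ω A) inferInstance

/-- `N` is a Poisson random measure on `ι × E` (time and mark) with mean measure `m`, relative to
the filtration `F`: it is integer valued, `N(A)` is Poisson with mean `m(A)`, the values on
disjoint sets are independent, the part up to time `s` is `F s`-measurable and the part after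
time `s` is independent of `F s`. -/
structure IsPoissonRandomMeasure {Ω ι E : Type*} [LinearOrder ι] [MeasurableSpace ι]
    [MeasurableSpace E] {mΩ : MeasurableSpace Ω} (P : Measure Ω) (F : Filtration ι mΩ)
    (m : Measure (ι × E)) (N : Ω → Measure (ι × E)) : Prop where
  counting : ∀ ω A, MeasurableSet A → ∃ n : ℕ∞, N ω A = (n : ℝ≥0∞)
  law : ∀ A, MeasurableSet A → m A ≠ ∞ →
    P.map (fun ω => N ω A) = (poissonMeasure (m A).toNNReal).map (fun n : ℕ => (n : ℝ≥0∞))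
  indep : ∀ (n : ℕ) (A : Fin n → Set (ι × E)), (∀ k, MeasurableSet (A k)) →
    Pairwise (fun k l => Disjoint (A k) (A l)) → iIndepFun (fun k ω => N ω (A k)) P
  adapted : ∀ s, randomMeasureSigma N (Set.Iic s ×ˢ Set.univ) ≤ F s
  indep_past : ∀ s, Indep (randomMeasureSigma N (Set.Ioi s ×ˢ Set.univ)) (F s) P

/-! ### The market coefficients -/

/-- Deterministic data of the market, without market impact: the generator `Q` of the chain does
not depend on the strategy. The states `e_1, …, e_K` are labelled by `Fin K`. -/
structure Market (K : ℕ) where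
  /-- time horizon -/
  T : ℝ
  T_pos : 0 < T
  /-- risk-free rate -/
  ρ : ℝ
  ρ_pos : 0 < ρ
  /-- bound on the fraction of wealth held in the risky asset -/
  L : ℝ
  L_pos : 0 < L
  /-- generator of the Markov chain -/
  Q : Matrix (Fin K) (Fin K) ℝ
  Q_nonneg : ∀ i j, i ≠ j → 0 ≤ Q i j
  Q_row_sum : ∀ i, ∑ j, Q i j = 0
  /-- mark space of the Poisson random measure -/
  Z : Set ℝ
  /-- intensity of the Poisson random measure -/
  ς : Measure Z
  ς_finite : IsFiniteMeasure ς
  /-- relative jump size of the asset price -/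
  G : ℝ → Fin K → Z → ℝ
  G_measurable : Measurable fun x : ℝ × Fin K × Z => G x.1 x.2.1 x.2.2
  G_continuous : ∀ i ζ, ContinuousOn (fun t => G t i ζ) (Set.Icc 0 T)
  G_gt : ∀ t ∈ Set.Icc 0 T, ∀ i ζ, 0 < 1 + G t i ζ

attribute [instance] Market.ς_finite

namespace Market

variable {K : ℕ} (M : Market K)

/-- The local jump characteristics `η(t, e_i, A) = ς {ζ | G(t, e_i, ζ) ∈ A \ {0}}`. -/
def η (t : ℝ) (i : Fin K) : Measure ℝ := (M.ς.map (M.G t i)).restrict {0}ᶜ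

/-- `∑_j q^j ∫ z / (1 + h z) η(t, e_j, dz)`. -/
def marginal (t : ℝ) (q : Fin K → ℝ) (h : ℝ) : ℝ :=
  ∑ j, q j * ∫ z, z / (1 + h * z) ∂(M.η t j)

/-- The value `h ∈ [-L, L]` solves the first-order condition `marginal = ρ`, or it is the endpoint
`L` (resp. `-L`) at which the marginal exceeds (resp. stays below) `ρ`. The integrals entering
`marginal` with non-zero weight are required to converge. -/
def IsLogRule (t : ℝ) (q : Fin K → ℝ) (h : ℝ) : Prop :=
  h ∈ Set.Icc (-M.L) M.L ∧
  (∀ j, q j ≠ 0 → Integrable (fun z => z / (1 + h * z)) (M.η t j)) ∧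
  (M.marginal t q h = M.ρ ∨ (h = M.L ∧ M.ρ < M.marginal t q h) ∨
    (h = -M.L ∧ M.marginal t q h < M.ρ))

/-- A market started at time `t₀` on a probability space: filtration, Poisson random measure,
Markov chain with initial distribution `p`, and asset price with initial value `S₀`. All processes
are indexed by `[t₀, T]`, whose least element is `⊥ = t₀`. -/
structure Model (t₀ : ℝ) [Fact (t₀ ≤ M.T)] (p : Fin K → ℝ) (S₀ : ℝ)
    {Ω : Type*} [mΩ : MeasurableSpace Ω] (P : Measure Ω) where
  F : Filtration (Set.Icc t₀ M.T) mΩ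
  usual : UsualConditions P F
  /-- Poisson random measure with intensity `dt ς(dζ)` -/
  N : Ω → Measure (Set.Icc t₀ M.T × M.Z)
  poisson : IsPoissonRandomMeasure P F ((timeMeasure t₀ M.T).prod M.ς) N
  /-- the Markov chain -/
  Y : Set.Icc t₀ M.T → Ω → Fin K
  Y_adapted : Adapted F Y
  Y_cadlag : ∀ ω, IsCadlag fun s => Y s ω
  Y_initial : ∀ i, P {ω | Y ⊥ ω = i} = ENNReal.ofReal (p i)
  Y_markov : ∀ (s u : Set.Icc t₀ M.T), s ≤ u → ∀ j,
    P[Set.indicator {ω | Y u ω = j} (fun _ => (1 : ℝ)) | F s] =ᵐ[P]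
      fun ω => (NormedSpace.exp (((u : ℝ) - (s : ℝ)) • M.Q)) (Y s ω) j
  /-- the Poisson random measure and the Markov chain are independent -/
  N_indep_Y : Indep (randomMeasureSigma N Set.univ)
    (⨆ s, MeasurableSpace.comap (Y s) inferInstance) P
  /-- square integrability of the jumps -/
  G_sq : ∫⁻ ω, ∫⁻ t, ∫⁻ ζ,
    ENNReal.ofReal (M.G t (Function.leftLim (fun s => Y s ω) t) ζ ^ 2) ∂M.ς ∂(timeMeasure t₀ M.T) ∂P < ∞
  /-- the asset price -/
  S : Set.Icc t₀ M.T → Ω → ℝ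
  S_adapted : StronglyAdapted F S
  S_cadlag : ∀ ω, IsCadlag fun s => S s ω
  /-- `dS_t = S_{t-} ∫ G(t, Y_{t-}, ζ) N(dt, dζ)` -/
  S_eq : ∀ᵐ ω ∂P, ∀ s, S s ω = S₀ + ∫ x in Set.Ioc ⊥ s ×ˢ Set.univ,
    Function.leftLim (fun r => S r ω) x.1 *
      M.G x.1 (Function.leftLim (fun r => Y r ω) x.1) x.2 ∂(N ω)

namespace Model

variable {M} {t₀ : ℝ} [Fact (t₀ ≤ M.T)] {p : Fin K → ℝ} {S₀ : ℝ}
  {Ω : Type*} [mΩ : MeasurableSpace Ω] {P : Measure Ω} (X : M.Model t₀ p S₀ P)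

/-- The return process `R_s = ∫_{(t₀, s]} ∫ G(u, Y_{u-}, ζ) N(du, dζ)`. -/
def R (s : Set.Icc t₀ M.T) (ω : Ω) : ℝ :=
  ∫ x in Set.Ioc ⊥ s ×ˢ Set.univ, M.G x.1 (Function.leftLim (fun r => X.Y r ω) x.1) x.2 ∂(X.N ω)

/-- The jump `ΔR_s`. -/
def jumpR (s : Set.Icc t₀ M.T) (ω : Ω) : ℝ :=
  X.R s ω - Function.leftLim (fun r => X.R r ω) s

/-- The jump measure `μ = ∑_{s : ΔR_s ≠ 0} δ_{(s, ΔR_s)}` of the return process. -/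
def μ (ω : Ω) : Measure (Set.Icc t₀ M.T × ℝ) :=
  Measure.sum fun s : {s : Set.Icc t₀ M.T // X.jumpR s ω ≠ 0} =>
    Measure.dirac (s.1, X.jumpR s.1 ω)

/-- The information of the investor: the filtration generated by the asset price, made to satisfy
the usual conditions. -/
def FS : Filtration (Set.Icc t₀ M.T) mΩ :=
  (addNullSets P
    (Filtration.natural (β := fun _ => ℝ) X.S
      fun s => (X.S_adapted s).mono (X.F.le s))).rightCont

/-- `π` is the filter: the càdlàg, simplex-valued, observable version of the conditional state
probabilities `π_s^i = P(Y_s = e_i | FS_s)`. -/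
structure IsFilter (π : Set.Icc t₀ M.T → Ω → Fin K → ℝ) : Prop where
  adapted : StronglyAdapted X.FS π
  cadlag : ∀ ω, IsCadlag fun s => π s ω
  mem_simplex : ∀ s ω, π s ω ∈ stdSimplex ℝ (Fin K)
  condExp : ∀ s i, (fun ω => π s ω i) =ᵐ[P]
    P[Set.indicator {ω | X.Y s ω = i} (fun _ => (1 : ℝ)) | X.FS s]

/-- Almost surely `η(t, e_i, Θ) = 0` for all `t` and `i`, where
`Θ = {z | 1 + h_s z ≤ 0 for some s}`. -/
def KeepsWealthPositive (_X : M.Model t₀ p S₀ P) (h : Set.Icc t₀ M.T → Ω → ℝ) : Prop :=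
  ∀ᵐ ω ∂P, ∀ (t : Set.Icc t₀ M.T) (i : Fin K),
    M.η t i {z | ∃ s, 1 + h s ω * z ≤ 0} = 0

/-- Strategies available to the partially informed investor. -/
structure IsAdmissible (h : Set.Icc t₀ M.T → Ω → ℝ) : Prop where
  predictable : IsStronglyPredictable X.FS h
  bounded : ∀ᵐ ω ∂P, ∀ s, h s ω ∈ Set.Icc (-M.L) M.L
  positive : X.KeepsWealthPositive h

/-- `W` is the wealth process of the strategy `h` with initial wealth `w`:
`dW_t = W_{t-} ((1 - h_t) ρ dt + h_t ∫ z μ(dt, dz))`, `W_{t₀} = w`. This is a pathwise equation; it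
determines `W` up to a null event. -/
structure IsWealth (w : ℝ) (h W : Set.Icc t₀ M.T → Ω → ℝ) : Prop where
  cadlag : ∀ ω, IsCadlag fun s => W s ω
  eq : ∀ᵐ ω ∂P, ∀ s, W s ω = w
    + (∫ u in Set.Ioc ⊥ s, Function.leftLim (fun r => W r ω) u * ((1 - h u ω) * M.ρ)
        ∂(timeMeasure t₀ M.T))
    + ∫ x in Set.Ioc ⊥ s ×ˢ Set.univ,
        Function.leftLim (fun r => W r ω) x.1 * (h x.1 ω * x.2) ∂(X.μ ω)

/-- Expected logarithmic utility of terminal wealth. -/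
def reward (_X : M.Model t₀ p S₀ P) (W : Set.Icc t₀ M.T → Ω → ℝ) : EReal :=
  extExpectation P fun ω => Real.log (W ⊤ ω)

/-- The value of the problem under partial information, started at time `t₀` with wealth `w` and
state distribution `p`. -/
def value (w : ℝ) : EReal :=
  ⨆ (h : Set.Icc t₀ M.T → Ω → ℝ) (_ : X.IsAdmissible h)
    (W : Set.Icc t₀ M.T → Ω → ℝ) (_ : X.IsWealth w h W), X.reward W

/-- The feedback strategy `h_s = hs(s, π_{s-})`, with `π_{t₀-} = π_{t₀}`. -/
def feedback (_X : M.Model t₀ p S₀ P) (π : Set.Icc t₀ M.T → Ω → Fin K → ℝ)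
    (hs : ℝ → (Fin K → ℝ) → ℝ) (s : Set.Icc t₀ M.T) (ω : Ω) : ℝ :=
  hs s (Function.leftLim (fun r => π r ω) s)

/-- `(1 - h_s) ρ + ∑_i π_s^i ∫ log(1 + h_s z) η(s, e_i, dz)`. -/
def growth (_X : M.Model t₀ p S₀ P) (π : Set.Icc t₀ M.T → Ω → Fin K → ℝ)
    (h : Set.Icc t₀ M.T → Ω → ℝ) (s : Set.Icc t₀ M.T) (ω : Ω) : ℝ :=
  (1 - h s ω) * M.ρ + ∑ i, π s ω i * ∫ z, Real.log (1 + h s ω * z) ∂(M.η s i)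

end Model

end Market

end LogUtility

end

noncomputable section

namespace LogUtility

/-! ### Càdlàg paths -/

section Paths

/-! Logarithmic utility turns wealth into an additive functional of the jumps. Almost surely `N`
consists of finitely many points at distinct times, so the wealth equation is a linear equation with
finitely many jumps. Its only solution is an exponential times a product of factors `1 + h ΔR`
(`linearSolution_eq`, `eq_linearSolution`). Admissibility makes every factor positive, and `log W_T`
equals `log w`, plus the time integral of `(1 - h) ρ`, plus the sum of `log (1 + h ΔR)` over the
Poisson points (`ae_log_wealth`).

The mean of such a sum is computed in two moves. The integrand is predictable for the large
filtration `F`, so the compensator formula `integral_compensator` replaces `N` by `ds ς(dζ)`. The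
integrand then still contains the hidden state `Y_{s-}`. It differs from `Y_s` only at countably
many times, and the law of `Y_s` given the investor's information is `π_s`, so averaging over the
state produces the integrals against `η` weighted by the filter (`IsFilter.integral_jumpSize`).

Optimality is concavity. For an admissible `h` and the rule `k`, the logarithm lies below its
tangent: `log (1 + h z) ≤ log (1 + k z) + (h - k) z / (1 + k z)`. In the mean, the tangent term and
the difference of the drifts add up to the integral of `(h - k) (m(s, π, k) - ρ)`, whose integrand
is nonpositive by the first-order condition (`IsLogRule.mul_sub_nonpos`). Hence the expected
log-wealth of the rule bounds every reward (`reward_le`).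

Integrability is derived, not assumed. Square integrability of the jumps gives a first moment of
`z`, and the first-order condition itself controls `z / (1 + k z)`: one of its signed parts is at
most `|z|`, and the mean then bounds the other (`IsLogRule.sum_lintegral_le`).

For existence, the marginal is decreasing and continuous in the position on `(-L, L)`. The largest
position at which it exceeds `ρ`, a supremum over rationals and therefore Borel, solves the
first-order condition. At `±L`, where the integrals might diverge, Fatou's lemma gives convergence
(`isLogRule_rule`). -/

lemma IsCadlag.tendsto_leftLim {ι β : Type*} [LinearOrder ι] [TopologicalSpace ι]
    [OrderTopology ι] [TopologicalSpace β] [T2Space β] {f : ι → β} (hf : IsCadlag f) (s : ι) :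
    Tendsto f (𝓝[<] s) (𝓝 (Function.leftLim f s)) := by
  obtain ⟨l, hl⟩ := (hf s).2
  rcases eq_or_neBot (𝓝[<] s) with h | h
  · simp [h]
  · rwa [leftLim_eq_of_tendsto hl]

lemma leftLim_bot {ι β : Type*} [LinearOrder ι] [OrderBot ι] [TopologicalSpace β] (f : ι → β) :
    Function.leftLim f ⊥ = f ⊥ :=
  leftLim_eq_of_isBot isBot_bot

lemma leftLim_mem_of_isClosed {ι β : Type*} [LinearOrder ι] [TopologicalSpace ι]
    [OrderTopology ι] [TopologicalSpace β] [T2Space β] {f : ι → β} (hf : IsCadlag f)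
    {C : Set β} (hC : IsClosed C) (hfC : ∀ s, f s ∈ C) (s : ι) : Function.leftLim f s ∈ C := by
  rcases eq_or_neBot (𝓝[<] s) with h | h
  · rw [leftLim_eq_of_eq_bot f h]; exact hfC s
  · exact hC.mem_of_tendsto (hf.tendsto_leftLim s) (Eventually.of_forall hfC)

/-- Jumps larger than a fixed `ε` are isolated from the right. Right-continuity at `x` keeps `f`,
and so also its left limits, within `ε / 3` of `f x` just after `x`, which leaves no room for a jump
above `ε`. A set of right-isolated points is countable, and `ε` runs through `1 / (n + 1)`. -/
lemma IsCadlag.countable_leftLim_ne {ι β : Type*} [LinearOrder ι] [TopologicalSpace ι]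
    [OrderTopology ι] [SecondCountableTopology ι] [TopologicalSpace β]
    [TopologicalSpace.MetrizableSpace β] {f : ι → β} (hf : IsCadlag f) :
    {s | Function.leftLim f s ≠ f s}.Countable := by
  let : MetricSpace β := TopologicalSpace.metrizableSpaceMetric β
  have hsub : {s | Function.leftLim f s ≠ f s} ⊆
      ⋃ n : ℕ, {s | 1 / ((n : ℝ) + 1) < dist (Function.leftLim f s) (f s)} := by
    intro s hs
    obtain ⟨n, hn⟩ := exists_nat_one_div_lt (dist_pos.2 hs)
    exact Set.mem_iUnion.2 ⟨n, hn⟩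
  refine (Set.countable_iUnion fun n => ?_).mono hsub
  set ε : ℝ := 1 / ((n : ℝ) + 1) with hε
  have hε0 : 0 < ε := by positivity
  set J := {s | ε < dist (Function.leftLim f s) (f s)} with hJ
  refine (countable_setOfPred_isolated_right_within (s := J)).mono ?_
  intro x hx
  refine ⟨hx, ?_⟩
  have h1 : ∀ᶠ u in 𝓝[>] x, dist (f u) (f x) < ε / 3 := by
    have := ((hf x).1.mono Set.Ioi_subset_Ici_self).tendsto
    exact this (Metric.ball_mem_nhds _ (by positivity))
  have h2 : ∀ᶠ u in 𝓝[>] x, u ∉ J := by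
    rcases eq_or_neBot (𝓝[>] x) with hb | hb
    · simp [hb]
    obtain ⟨y, hy⟩ : ∃ y, x < y := hb.nonempty_of_mem self_mem_nhdsWithin
    obtain ⟨y, hxy, hys⟩ := (mem_nhdsGT_iff_exists_Ioo_subset' hy).1 h1
    filter_upwards [Ioo_mem_nhdsGT hxy] with u hu huJ
    have hfu : dist (f u) (f x) < ε / 3 := hys hu
    have hlu : dist (Function.leftLim f u) (f x) ≤ ε / 3 := by
      rcases eq_or_neBot (𝓝[<] u) with hc | hc
      · rw [leftLim_eq_of_eq_bot f hc]; exact hfu.le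
      · have := (hf.tendsto_leftLim u).dist (tendsto_const_nhds (x := f x))
        refine le_of_tendsto this ?_
        filter_upwards [Ioo_mem_nhdsLT hu.1] with v hv
        exact le_of_lt (hys ⟨hv.1, hv.2.trans hu.2⟩)
    have := dist_triangle_right (Function.leftLim f u) (f u) (f x)
    have h3 : ε < dist (Function.leftLim f u) (f u) := huJ
    linarith
  rw [← Filter.empty_mem_iff_bot, Set.inter_comm, mem_nhdsWithin_iff_eventually]
  rw [eventually_nhdsWithin_iff] at h2
  filter_upwards [h2] with u hu huJ
  exact absurd huJ.2 (hu huJ.1)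

end Paths

/-! ### Grids on a compact interval -/

section Grid

variable {a b : ℝ} [hab : Fact (a ≤ b)]

/-- The largest multiple of `1 / (n + 1)` from the left endpoint that is strictly below `s`. -/
def lowerGrid (n : ℕ) (s : Set.Icc a b) : Set.Icc a b :=
  Set.projIcc a b hab.out (a + ((⌈(n + 1 : ℝ) * (s - a)⌉₊ - 1 : ℕ) : ℝ) / (n + 1))

/-- The smallest multiple of `1 / (n + 1)` from the left endpoint that is strictly above `s`, cut
off at the right endpoint. -/
def upperGrid (n : ℕ) (s : Set.Icc a b) : Set.Icc a b :=
  Set.projIcc a b hab.out (a + ((⌊(n + 1 : ℝ) * (s - a)⌋₊ : ℝ) + 1) / (n + 1))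

lemma countable_range_lowerGrid (n : ℕ) :
    (Set.range (lowerGrid n : Set.Icc a b → Set.Icc a b)).Countable :=
  (Set.countable_range fun k : ℕ => Set.projIcc a b hab.out (a + (k : ℝ) / (n + 1))).mono
    (by rintro _ ⟨s, rfl⟩; exact ⟨_, rfl⟩)

lemma countable_range_upperGrid (n : ℕ) :
    (Set.range (upperGrid n : Set.Icc a b → Set.Icc a b)).Countable :=
  (Set.countable_range fun k : ℕ => Set.projIcc a b hab.out (a + ((k : ℝ) + 1) / (n + 1))).mono
    (by rintro _ ⟨s, rfl⟩; exact ⟨_, rfl⟩)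

lemma measurable_lowerGrid (n : ℕ) : Measurable (lowerGrid n : Set.Icc a b → Set.Icc a b) := by
  unfold lowerGrid
  refine continuous_projIcc.measurable.comp ?_
  have h : Measurable fun s : Set.Icc a b => (⌈(n + 1 : ℝ) * (s - a)⌉₊ : ℕ) :=
    Nat.measurable_ceil.comp (by fun_prop)
  have h2 : Measurable fun s : Set.Icc a b => ((⌈(n + 1 : ℝ) * (s - a)⌉₊ - 1 : ℕ) : ℝ) :=
    (measurable_from_top (f := fun k : ℕ => ((k - 1 : ℕ) : ℝ))).comp h
  fun_prop

lemma measurable_upperGrid (n : ℕ) : Measurable (upperGrid n : Set.Icc a b → Set.Icc a b) := by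
  unfold upperGrid
  refine continuous_projIcc.measurable.comp ?_
  have h : Measurable fun s : Set.Icc a b => (⌊(n + 1 : ℝ) * (s - a)⌋₊ : ℕ) :=
    Nat.measurable_floor.comp (by fun_prop)
  have h2 : Measurable fun s : Set.Icc a b => ((⌊(n + 1 : ℝ) * (s - a)⌋₊ : ℕ) : ℝ) :=
    (measurable_from_top (f := fun k : ℕ => (k : ℝ))).comp h
  fun_prop

/-- The truncated subtraction `0 - 1 = 0` makes the left endpoint its own grid point. This agrees
with the convention that the left limit at `⊥` is the value there. -/
lemma lowerGrid_bot (n : ℕ) : lowerGrid n (⊥ : Set.Icc a b) = ⊥ := by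
  have : ((⊥ : Set.Icc a b) : ℝ) = a := rfl
  simp only [lowerGrid, this, sub_self, mul_zero, Nat.ceil_zero, Nat.zero_sub, Nat.cast_zero,
    zero_div, add_zero, Set.projIcc_left]
  rfl

lemma lowerGrid_bounds (n : ℕ) {s : Set.Icc a b} (hs : ⊥ < s) :
    (s : ℝ) - 1 / (n + 1) ≤ lowerGrid n s ∧ (lowerGrid n s : ℝ) < s := by
  have has : a < s := hs
  have hn : (0 : ℝ) < n + 1 := by positivity
  set x : ℝ := (n + 1 : ℝ) * (s - a) with hx
  have hx0 : 0 < x := mul_pos hn (by linarith)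
  have h1 : 1 ≤ ⌈x⌉₊ := Nat.one_le_iff_ne_zero.2 (by simpa using hx0)
  have h2 : ((⌈x⌉₊ - 1 : ℕ) : ℝ) = (⌈x⌉₊ : ℝ) - 1 := by push_cast [h1]; ring
  have h3 := Nat.ceil_lt_add_one hx0.le
  have h4 := Nat.le_ceil x
  have h5 : a + ((⌈x⌉₊ - 1 : ℕ) : ℝ) / (n + 1) < s := by
    rw [h2, ← lt_sub_iff_add_lt', div_lt_iff₀ hn]
    rw [hx] at h3 ⊢; nlinarith
  have h6 : (s : ℝ) - 1 / (n + 1) ≤ a + ((⌈x⌉₊ - 1 : ℕ) : ℝ) / (n + 1) := by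
    rw [h2, ← sub_le_iff_le_add', le_div_iff₀ hn]
    have : ((s : ℝ) - 1 / (n + 1) - a) * (n + 1) = x - 1 := by rw [hx]; field_simp; ring
    linarith
  have h7 : a ≤ a + ((⌈x⌉₊ - 1 : ℕ) : ℝ) / (n + 1) := by
    have : 0 ≤ ((⌈x⌉₊ - 1 : ℕ) : ℝ) / (n + 1) := by positivity
    linarith
  have h8 : (lowerGrid n s : ℝ) = a + ((⌈x⌉₊ - 1 : ℕ) : ℝ) / (n + 1) := by
    simp only [lowerGrid]
    rw [Set.projIcc_of_mem hab.out ⟨h7, h5.le.trans s.2.2⟩]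
  rw [h8]; exact ⟨h6, h5⟩

lemma upperGrid_bounds (n : ℕ) (s : Set.Icc a b) :
    s ≤ upperGrid n s ∧ (upperGrid n s : ℝ) ≤ s + 1 / (n + 1) := by
  have hn : (0 : ℝ) < n + 1 := by positivity
  set x : ℝ := (n + 1 : ℝ) * (s - a) with hx
  have hx0 : 0 ≤ x := mul_nonneg hn.le (by linarith [s.2.1])
  have h3 := Nat.lt_floor_add_one x
  have h4 := Nat.floor_le hx0
  have h5 : (s : ℝ) ≤ a + ((⌊x⌋₊ : ℝ) + 1) / (n + 1) := by
    rw [← sub_le_iff_le_add', le_div_iff₀ hn]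
    rw [hx] at h3 ⊢; nlinarith
  have h6 : a + ((⌊x⌋₊ : ℝ) + 1) / (n + 1) ≤ (s : ℝ) + 1 / (n + 1) := by
    have : (s : ℝ) + 1 / (n + 1) = a + (x + 1) / (n + 1) := by rw [hx]; field_simp; ring
    rw [this]; gcongr
  have h7 : (upperGrid n s : ℝ) = max a (min b (a + ((⌊x⌋₊ : ℝ) + 1) / (n + 1))) := by
    simp only [upperGrid, Set.coe_projIcc]; rfl
  constructor
  · rw [← Subtype.coe_le_coe, h7]
    exact le_max_of_le_right (le_min s.2.2 h5)
  · rw [h7]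
    refine max_le ?_ ((min_le_right _ _).trans h6)
    have : (0 : ℝ) ≤ 1 / (n + 1) := by positivity
    linarith [s.2.1]

lemma tendsto_lowerGrid {s : Set.Icc a b} (hs : ⊥ < s) :
    Tendsto (fun n => lowerGrid n s) atTop (𝓝[<] s) := by
  refine tendsto_nhdsWithin_iff.2 ⟨?_, Eventually.of_forall fun n => (lowerGrid_bounds n hs).2⟩
  rw [tendsto_subtype_rng]
  have h : Tendsto (fun n : ℕ => (s : ℝ) - 1 / (n + 1)) atTop (𝓝 (s - 0)) :=
    tendsto_const_nhds.sub tendsto_one_div_add_atTop_nhds_zero_nat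
  rw [sub_zero] at h
  exact tendsto_of_tendsto_of_tendsto_of_le_of_le h tendsto_const_nhds
    (fun n => (lowerGrid_bounds n hs).1) (fun n => (lowerGrid_bounds n hs).2.le)

lemma tendsto_upperGrid (s : Set.Icc a b) :
    Tendsto (fun n => upperGrid n s) atTop (𝓝[≥] s) := by
  refine tendsto_nhdsWithin_iff.2 ⟨?_, Eventually.of_forall fun n => (upperGrid_bounds n s).1⟩
  rw [tendsto_subtype_rng]
  have h : Tendsto (fun n : ℕ => (s : ℝ) + 1 / (n + 1)) atTop (𝓝 (s + 0)) :=
    tendsto_const_nhds.add tendsto_one_div_add_atTop_nhds_zero_nat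
  rw [add_zero] at h
  exact tendsto_of_tendsto_of_tendsto_of_le_of_le tendsto_const_nhds h
    (fun n => (upperGrid_bounds n s).1) (fun n => (upperGrid_bounds n s).2)

lemma tendsto_comp_lowerGrid {β : Type*} [TopologicalSpace β] [T2Space β]
    {f : Set.Icc a b → β} (hf : IsCadlag f) (s : Set.Icc a b) :
    Tendsto (fun n => f (lowerGrid n s)) atTop (𝓝 (Function.leftLim f s)) := by
  rcases eq_or_ne s ⊥ with rfl | hs
  · simp [lowerGrid_bot, leftLim_bot]
  · exact (hf.tendsto_leftLim s).comp (tendsto_lowerGrid (bot_lt_iff_ne_bot.2 hs))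

/-- Approximation from the right by `f ∘ upperGrid n`, which has countable range. Preimages are
countable unions of grid cells, whatever the target set is. -/
lemma IsCadlag.measurable {β : Type*} [TopologicalSpace β]
    [TopologicalSpace.PseudoMetrizableSpace β] [MeasurableSpace β] [BorelSpace β]
    {f : Set.Icc a b → β} (hf : IsCadlag f) : Measurable f := by
  refine measurable_of_tendsto_metrizable (f := fun n s => f (upperGrid n s)) (fun n => ?_)
    (tendsto_pi_nhds.2 fun s => (hf s).1.tendsto.comp (tendsto_upperGrid s))
  intro B _
  have : (fun s => f (upperGrid n s)) ⁻¹' B =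
      ⋃ t ∈ Set.range (upperGrid n : Set.Icc a b → _) ∩ f ⁻¹' B, upperGrid n ⁻¹' {t} := by
    ext s
    simp only [Set.mem_preimage, Set.mem_iUnion, Set.mem_inter_iff, Set.mem_range,
      Set.mem_singleton_iff, exists_prop]
    exact ⟨fun h => ⟨_, ⟨⟨s, rfl⟩, h⟩, rfl⟩, fun ⟨t, h, ht⟩ => ht ▸ h.2⟩
  rw [this]
  exact .biUnion ((countable_range_upperGrid n).mono Set.inter_subset_left)
    fun t _ => measurable_upperGrid n (measurableSet_singleton t)

lemma measurable_leftLim {β : Type*} [TopologicalSpace β] [T2Space β]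
    [TopologicalSpace.PseudoMetrizableSpace β] [MeasurableSpace β] [BorelSpace β]
    {f : Set.Icc a b → β} (hf : IsCadlag f) : Measurable (Function.leftLim f) :=
  measurable_of_tendsto_metrizable
    (fun n => hf.measurable.comp (measurable_lowerGrid n))
    (tendsto_pi_nhds.2 fun s => tendsto_comp_lowerGrid hf s)

end Grid

/-! ### Measurability of processes -/

section Processes

variable {a b : ℝ} [hab : Fact (a ≤ b)] {Ω : Type*} {mΩ : MeasurableSpace Ω}

lemma measurable_uncurry_of_cadlag {β : Type*} [TopologicalSpace β]
    [TopologicalSpace.PseudoMetrizableSpace β] [MeasurableSpace β] [BorelSpace β]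
    {X : Set.Icc a b → Ω → β} (hX : ∀ s, Measurable (X s))
    (hc : ∀ ω, IsCadlag fun s => X s ω) : Measurable (Function.uncurry X) := by
  refine measurable_of_tendsto_metrizable (f := fun n x => X (upperGrid n x.1) x.2) (fun n => ?_) ?_
  swap
  · refine tendsto_pi_nhds.2 fun x => ?_
    have h := (hc x.2 x.1).1.tendsto.comp (tendsto_upperGrid x.1)
    exact h
  intro B hB
  have : (fun x : Set.Icc a b × Ω => X (upperGrid n x.1) x.2) ⁻¹' B =
      ⋃ t ∈ Set.range (upperGrid n : Set.Icc a b → _), (upperGrid n ⁻¹' {t}) ×ˢ (X t ⁻¹' B) := by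
    ext s
    simp only [Set.mem_preimage, Set.mem_iUnion, Set.mem_prod, Set.mem_range,
      Set.mem_singleton_iff, exists_prop]
    exact ⟨fun h => ⟨_, ⟨s.1, rfl⟩, rfl, h⟩, fun ⟨t, _, ht, h⟩ => ht ▸ h⟩
  rw [this]
  exact .biUnion (countable_range_upperGrid n)
    fun t _ => (measurable_upperGrid n (measurableSet_singleton t)).prod (hX t hB)

lemma predictable_le_prod (F : Filtration (Set.Icc a b) mΩ) :
    F.predictable ≤ (inferInstance : MeasurableSpace (Set.Icc a b × Ω)) :=
  measurableSpace_le_predictable_of_measurableSet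
    (fun _ hA => (measurableSet_singleton _).prod (F.le _ _ hA))
    (fun _ _ hA => measurableSet_Ioi.prod (F.le _ _ hA))

lemma predictable_mono {F G : Filtration (Set.Icc a b) mΩ} (h : F ≤ G) :
    F.predictable ≤ G.predictable :=
  measurableSpace_le_predictable_of_measurableSet
    (fun _ hA => measurableSet_predictable_singleton_bot_prod (h _ _ hA))
    (fun _ _ hA => measurableSet_predictable_Ioi_prod (h _ _ hA))

/-- On the generators, `Ioi u ∩ Ioi t = Ioi (u ⊔ t)`, and `A` is still known at the later time `u ⊔
t`. Without the cut at `t` the event `A` would be used before it is observed. -/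
lemma measurableSet_predictable_inter_Ioi_prod (F : Filtration (Set.Icc a b) mΩ)
    {t : Set.Icc a b} {A : Set Ω} (hA : MeasurableSet[F t] A) {D : Set (Set.Icc a b)}
    (hD : MeasurableSet D) : MeasurableSet[F.predictable] ((D ∩ Set.Ioi t) ×ˢ A) := by
  have hT : MeasurableSet[F.predictable] (Set.Ioi t ×ˢ A) := measurableSet_predictable_Ioi_prod hA
  rw [BorelSpace.measurable_eq (α := Set.Icc a b), borel_eq_generateFrom_Ioi] at hD
  induction D, hD using MeasurableSpace.generateFrom_induction with
  | hC D hD _ =>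
    obtain ⟨u, rfl⟩ := hD
    rw [Set.Ioi_inter_Ioi]
    exact measurableSet_predictable_Ioi_prod (F.mono le_sup_right _ hA)
  | empty => simp
  | compl D _ ih =>
    have : (Dᶜ ∩ Set.Ioi t) ×ˢ A = Set.Ioi t ×ˢ A \ (D ∩ Set.Ioi t) ×ˢ A := by
      ext x; simp; tauto
    rw [this]; exact hT.diff ih
  | iUnion D _ ih =>
    rw [Set.iUnion_inter, Set.iUnion_prod_const]
    exact .iUnion ih

/-- The approximation reads `X` at `lowerGrid n s`, which is strictly earlier than `s` unless `s =
⊥`. Each grid value `t` therefore enters only at times after `t`, and the slice at `⊥` is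
predictable by itself. -/
lemma measurable_predictable_leftLim {β : Type*} [TopologicalSpace β] [T2Space β]
    [TopologicalSpace.PseudoMetrizableSpace β] [MeasurableSpace β] [BorelSpace β]
    {F : Filtration (Set.Icc a b) mΩ}
    {X : Set.Icc a b → Ω → β} (hX : ∀ s, Measurable[F s] (X s))
    (hc : ∀ ω, IsCadlag fun s => X s ω) :
    Measurable[F.predictable]
      fun x : Set.Icc a b × Ω => Function.leftLim (fun r => X r x.2) x.1 := by
  refine @measurable_of_tendsto_metrizable _ _ F.predictable _ _ _ _
    (fun n x => X (lowerGrid n x.1) x.2) _ (fun n => ?_)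
    (tendsto_pi_nhds.2 fun x => tendsto_comp_lowerGrid (hc x.2) x.1)
  intro B hB
  have : (fun x : Set.Icc a b × Ω => X (lowerGrid n x.1) x.2) ⁻¹' B =
      {⊥} ×ˢ (X ⊥ ⁻¹' B) ∪ ⋃ t ∈ Set.range (lowerGrid n : Set.Icc a b → _),
        ((lowerGrid n ⁻¹' {t}) ∩ Set.Ioi t) ×ˢ (X t ⁻¹' B) := by
    ext ⟨s, ω⟩
    simp only [Set.mem_preimage, Set.mem_union, Set.mem_prod, Set.mem_singleton_iff,
      Set.mem_iUnion, Set.mem_inter_iff, Set.mem_Ioi, exists_prop, Set.mem_range]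
    constructor
    · intro h
      rcases eq_or_ne s ⊥ with rfl | hs
      · left; rw [lowerGrid_bot] at h; exact ⟨rfl, h⟩
      · right
        exact ⟨_, ⟨s, rfl⟩, ⟨rfl, (lowerGrid_bounds n (bot_lt_iff_ne_bot.2 hs)).2⟩, h⟩
    · rintro (⟨rfl, h⟩ | ⟨t, _, ⟨rfl, _⟩, h⟩)
      · rwa [lowerGrid_bot]
      · exact h
  rw [this]
  exact MeasurableSet.union (measurableSet_predictable_singleton_bot_prod (hX ⊥ hB))
    (.biUnion (countable_range_lowerGrid n) fun t _ =>
      measurableSet_predictable_inter_Ioi_prod F (hX t hB)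
        (measurable_lowerGrid n (measurableSet_singleton t)))

end Processes

/-! ### Poisson random measures -/

section PoissonLaw

lemma lintegral_natCast_poissonMeasure (r : ℝ≥0) :
    ∫⁻ n : ℕ, (n : ℝ≥0∞) ∂(poissonMeasure r) = r := by
  rw [lintegral_countable']
  have h1 : ∀ n : ℕ, (n : ℝ≥0∞) * poissonMeasure r {n} =
      ENNReal.ofReal (n * (Real.exp (-r) * r ^ n / n.factorial)) := by
    intro n
    rw [poissonMeasure_singleton, ENNReal.ofReal_mul (by positivity), ENNReal.ofReal_natCast]
  simp_rw [h1]
  have h2 : HasSum (fun n : ℕ => (n : ℝ) * (Real.exp (-r) * r ^ n / n.factorial)) r := by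
    rw [← hasSum_nat_add_iff' 1]
    have := (hasSum_one_poissonMeasure r).mul_left (r : ℝ)
    convert! this using 1
    · ext n
      rw [Nat.factorial_succ]
      push_cast
      have : (n : ℝ) + 1 ≠ 0 := by positivity
      have h3 : (n.factorial : ℝ) ≠ 0 := by positivity
      field_simp
      ring
    · simp
  rw [← ENNReal.ofReal_tsum_of_nonneg (fun n => by positivity) h2.summable, h2.tsum_eq]
  simp

/-- The probability is `1 - exp (-r) (1 + r) ≤ 1 - (1 - r) (1 + r) = r ^ 2`. The quadratic order is
what makes the sum over small time slabs vanish in `ae_simple`. -/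
lemma poissonMeasure_two_le (r : ℝ≥0) : poissonMeasure r {n | 2 ≤ n} ≤ (r : ℝ≥0∞) ^ 2 := by
  have h0 : {n : ℕ | 2 ≤ n} = ({0} ∪ {1})ᶜ := by
    ext n; simp; omega
  have h1 : (poissonMeasure r).real {n | 2 ≤ n} ≤ (r : ℝ) ^ 2 := by
    rw [h0, probReal_compl_eq_one_sub (by measurability),
      measureReal_union (by simp) (by measurability), poissonMeasure_real_singleton,
      poissonMeasure_real_singleton]
    simp only [pow_zero, mul_one, Nat.factorial_zero, Nat.cast_one, div_one, pow_one,
      Nat.factorial_one]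
    have h2 := Real.add_one_le_exp (-(r : ℝ))
    have h3 : (0 : ℝ) ≤ r := r.2
    nlinarith
  rw [← ENNReal.ofReal_toReal (measure_ne_top (poissonMeasure r) {n | 2 ≤ n})]
  refine (ENNReal.ofReal_le_ofReal h1).trans ?_
  rw [ENNReal.ofReal_pow (NNReal.coe_nonneg r), ENNReal.ofReal_coe_nnreal]

end PoissonLaw

/-! ### Lebesgue measure on a compact time interval -/

section TimeMeasure

variable {a b : ℝ}

lemma measurableEmbedding_Icc_val : MeasurableEmbedding (Subtype.val : Set.Icc a b → ℝ) :=
  MeasurableEmbedding.subtype_coe measurableSet_Icc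

lemma timeMeasure_apply (D : Set (Set.Icc a b)) :
    timeMeasure a b D = volume (Subtype.val '' D) :=
  measurableEmbedding_Icc_val.comap_apply _ _

instance : IsFiniteMeasure (timeMeasure a b) := by
  refine ⟨?_⟩
  rw [timeMeasure_apply]
  refine (measure_mono (t := Set.Icc a b) ?_).trans_lt (by simp)
  rintro _ ⟨x, _, rfl⟩; exact x.2

instance : NullSingletonClass (timeMeasure a b) where
  measure_singleton x := by simp [timeMeasure_apply]

end TimeMeasure

/-! ### Atoms of integer-valued measures -/

section Counting

/-- A finite integer-valued measure is a finite sum of point masses. -/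
lemma exists_finset_of_counting {E : Type*} [MetricSpace E] [SecondCountableTopology E]
    [MeasurableSpace E] [BorelSpace E] (ν : Measure E) [IsFiniteMeasure ν]
    (hν : ∀ A, MeasurableSet A → ∃ n : ℕ∞, ν A = (n : ℝ≥0∞)) :
    ∃ A : Finset E, (∀ x ∈ A, ν {x} ≠ 0) ∧ ν = ∑ x ∈ A, ν {x} • Measure.dirac x := by
  have hone : ∀ A, MeasurableSet A → ν A ≠ 0 → 1 ≤ ν A := by
    intro A hA h0
    obtain ⟨n, hn⟩ := hν A hA
    rw [hn] at h0 ⊢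
    have : n ≠ 0 := by rintro rfl; simp at h0
    exact_mod_cast Order.one_le_iff_ne_zero.2 this
  set S : Set E := {x | ν {x} ≠ 0} with hS
  have hSf : S.Finite := by
    have := Measure.finite_const_le_meas_of_disjoint_iUnion (μ := ν) (ε := 1) one_pos
      (As := fun x : E => {x}) (fun x => measurableSet_singleton x)
      (fun x y hxy => by simpa using hxy) (measure_ne_top _ _)
    refine this.subset fun x hx => hone _ (measurableSet_singleton x) hx
  -- Small balls around a non-atom have mass tending to `0`. An integer below `1` is `0`, so some
  -- ball is null, and in a second countable space a locally null set is null.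
  have hnull : ν Sᶜ = 0 := by
    refine measure_null_of_locally_null _ fun x hx => ?_
    have hx0 : ν {x} = 0 := by simpa [hS] using hx
    have ht : Tendsto (fun n : ℕ => ν (Metric.ball x (1 / ((n : ℝ) + 1)))) atTop
        (𝓝 (ν (⋂ n : ℕ, Metric.ball x (1 / ((n : ℝ) + 1))))) := by
      refine tendsto_measure_iInter_atTop (fun n => Metric.isOpen_ball.measurableSet.nullMeasurableSet)
        (fun m n hmn => Metric.ball_subset_ball ?_) ⟨0, measure_ne_top _ _⟩
      gcongr
    have hi : ⋂ n : ℕ, Metric.ball x (1 / ((n : ℝ) + 1)) = {x} := by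
      ext y
      simp only [Set.mem_iInter, Metric.mem_ball, Set.mem_singleton_iff]
      constructor
      · intro h
        by_contra hne
        obtain ⟨n, hn⟩ := exists_nat_one_div_lt (dist_pos.2 hne)
        exact absurd (h n) (not_lt.2 hn.le)
      · rintro rfl n; rw [dist_self]; positivity
    rw [hi, hx0] at ht
    obtain ⟨n, hn⟩ := (ht.eventually (gt_mem_nhds (zero_lt_one' ℝ≥0∞))).exists
    refine ⟨Metric.ball x (1 / ((n : ℝ) + 1)),
      mem_nhdsWithin_of_mem_nhds (Metric.ball_mem_nhds _ (by positivity)), ?_⟩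
    by_contra h
    exact absurd (hone _ Metric.isOpen_ball.measurableSet h) (not_le.2 hn)
  refine ⟨hSf.toFinset, fun x hx => by simpa [hS] using hx, ?_⟩
  ext B hB
  have h1 : ν B = ν (B ∩ S) := by
    have := measure_inter_add_sdiff (μ := ν) B hSf.measurableSet
    rw [← this, measure_mono_null (fun x hx => hx.2 : B \ S ⊆ Sᶜ) hnull, add_zero]
  rw [h1]
  have h2 : B ∩ S = ⋃ x ∈ hSf.toFinset, B ∩ {x} := by
    ext y
    simp only [Set.mem_inter_iff, Set.Finite.mem_toFinset, Set.mem_iUnion, Set.mem_singleton_iff,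
      exists_prop]
    exact ⟨fun h => ⟨y, h.2, h.1, rfl⟩, fun ⟨x, hx, hy, hyx⟩ => ⟨hy, hyx ▸ hx⟩⟩
  rw [h2, measure_biUnion_finset]
  · simp only [Measure.coe_finsetSum, Finset.sum_apply, Measure.smul_apply, smul_eq_mul]
    refine Finset.sum_congr rfl fun x _ => ?_
    rw [Measure.dirac_apply' _ hB]
    by_cases hx : x ∈ B
    · simp [hx]
    · simp [hx]
  · intro x _ y _ hxy
    exact Set.disjoint_left.2 fun z hz hz' => hxy (hz.2.symm.trans hz'.2)
  · exact fun x _ => hB.inter (measurableSet_singleton x)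

end Counting

/-! ### Random measures as s-finite kernels -/

section Kernel

/-- Pointwise finiteness gives no uniform bound on the masses, so the kernel is normalised to mass
at most one and the mass is restored as a density. A Poisson random measure is only almost surely
finite with unbounded mass, and Fubini for `P ⊗ₘ finiteKernel N` needs s-finiteness. -/
lemma isSFiniteKernel_of_isFiniteMeasure {α β : Type*} {mα : MeasurableSpace α}
    {mβ : MeasurableSpace β} (κ : Kernel α β) (h : ∀ x, IsFiniteMeasure (κ x)) :
    IsSFiniteKernel κ := by
  have hu : Measurable fun x => κ x Set.univ := κ.measurable_coe MeasurableSet.univ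
  let κ₁ : Kernel α β :=
    { toFun := fun x => (κ x Set.univ)⁻¹ • κ x
      measurable' := by
        refine Measure.measurable_of_measurable_coe _ fun B hB => ?_
        simp only [Measure.smul_apply, smul_eq_mul]
        exact hu.inv.mul (κ.measurable_coe hB) }
  have hκ₁ : ∀ x, κ₁ x = (κ x Set.univ)⁻¹ • κ x := fun x => rfl
  have hf : IsFiniteKernel κ₁ := by
    refine ⟨1, ENNReal.one_lt_top, fun x => ?_⟩
    rw [hκ₁, Measure.smul_apply, smul_eq_mul]
    exact ENNReal.inv_mul_le_one _
  have heq : κ = Kernel.withDensity κ₁ fun x _ => κ x Set.univ := by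
    ext x B hB
    rw [Kernel.withDensity_apply' _ (by fun_prop), hκ₁]
    simp only [lintegral_const, MeasurableSet.univ, Measure.restrict_apply, Set.univ_inter,
      Measure.smul_apply, smul_eq_mul]
    rcases eq_or_ne (κ x Set.univ) 0 with h0 | h0
    · rw [h0, zero_mul]; exact measure_mono_null (Set.subset_univ B) h0
    · rw [← mul_assoc, ENNReal.mul_inv_cancel h0 (measure_ne_top _ _), one_mul]
  rw [heq]
  exact Kernel.IsSFiniteKernel.withDensity _ fun x _ => measure_ne_top _ _

/-- The kernel that equals `N` where `N` is a finite measure, and vanishes elsewhere. -/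
def finiteKernel {Ω E : Type*} {mΩ : MeasurableSpace Ω} [MeasurableSpace E] (N : Ω → Measure E)
    (hN : Measurable N) : Kernel Ω E where
  toFun ω := open Classical in if N ω Set.univ < ∞ then N ω else 0
  measurable' := by
    classical
    refine Measurable.ite (measurableSet_lt ?_ measurable_const) hN measurable_const
    exact (Measure.measurable_coe MeasurableSet.univ).comp hN

instance {Ω E : Type*} {mΩ : MeasurableSpace Ω} [MeasurableSpace E] (N : Ω → Measure E)
    (hN : Measurable N) : IsSFiniteKernel (finiteKernel N hN) := by
  refine isSFiniteKernel_of_isFiniteMeasure _ fun ω => ?_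
  change IsFiniteMeasure (open Classical in if N ω Set.univ < ∞ then N ω else 0)
  split_ifs with h
  · exact ⟨h⟩
  · infer_instance

end Kernel

namespace IsPoissonRandomMeasure

variable {a b : ℝ} [hab : Fact (a ≤ b)] {Ω E : Type*} {mΩ : MeasurableSpace Ω} {P : Measure Ω}
  [IsProbabilityMeasure P] [MeasurableSpace E] {F : Filtration (Set.Icc a b) mΩ}
  {ς : Measure E} [IsFiniteMeasure ς] {N : Ω → Measure (Set.Icc a b × E)}

omit [IsProbabilityMeasure P] [IsFiniteMeasure ς] in
lemma measurable_apply (hN : IsPoissonRandomMeasure P F ((timeMeasure a b).prod ς) N)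
    {B : Set (Set.Icc a b × E)} (hB : MeasurableSet B) : Measurable fun ω => N ω B := by
  have h1 : MeasurableSpace.comap (fun ω => N ω B) inferInstance ≤ mΩ := by
    refine le_trans ?_ ((hN.adapted ⊤).trans (F.le ⊤))
    exact le_iSup₂_of_le B hB (le_iSup_of_le (fun x _ => ⟨Set.mem_Iic.2 le_top, Set.mem_univ _⟩) le_rfl)
  exact measurable_iff_comap_le.2 h1

omit [IsProbabilityMeasure P] [IsFiniteMeasure ς] in
lemma measurable (hN : IsPoissonRandomMeasure P F ((timeMeasure a b).prod ς) N) : Measurable N :=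
  Measure.measurable_of_measurable_coe _ fun _ hB => hN.measurable_apply hB

omit [IsProbabilityMeasure P] in
lemma lintegral_apply (hN : IsPoissonRandomMeasure P F ((timeMeasure a b).prod ς) N)
    {B : Set (Set.Icc a b × E)} (hB : MeasurableSet B) :
    ∫⁻ ω, N ω B ∂P = (timeMeasure a b).prod ς B := by
  have hm : (timeMeasure a b).prod ς B ≠ ∞ := measure_ne_top _ _
  have h1 : ∫⁻ ω, N ω B ∂P = ∫⁻ x, x ∂(P.map fun ω => N ω B) :=
    (lintegral_map (f := fun x => x) measurable_id (hN.measurable_apply hB)).symm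
  rw [h1, hN.law B hB hm, lintegral_map (f := fun x => x) measurable_id (by fun_prop)]
  rw [lintegral_natCast_poissonMeasure, ENNReal.coe_toNNReal hm]

omit [IsProbabilityMeasure P] in
lemma measure_two_le (hN : IsPoissonRandomMeasure P F ((timeMeasure a b).prod ς) N)
    {B : Set (Set.Icc a b × E)} (hB : MeasurableSet B) :
    P {ω | 2 ≤ N ω B} ≤ ((timeMeasure a b).prod ς B) ^ 2 := by
  have hm : (timeMeasure a b).prod ς B ≠ ∞ := measure_ne_top _ _
  have h1 : P {ω | 2 ≤ N ω B} = (P.map fun ω => N ω B) (Set.Ici 2) := by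
    rw [Measure.map_apply (hN.measurable_apply hB) measurableSet_Ici]; rfl
  rw [h1, hN.law B hB hm, Measure.map_apply (by fun_prop) measurableSet_Ici]
  refine le_trans (le_of_eq ?_) ((poissonMeasure_two_le _).trans
    (le_of_eq (by rw [ENNReal.coe_toNNReal hm])))
  congr 1
  ext n
  simp only [Set.mem_preimage, Set.mem_Ici, Set.mem_ofPred_eq]
  exact_mod_cast Iff.rfl

omit [IsProbabilityMeasure P] in
lemma ae_lt_top (hN : IsPoissonRandomMeasure P F ((timeMeasure a b).prod ς) N) :
    ∀ᵐ ω ∂P, N ω Set.univ < ∞ :=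
  MeasureTheory.ae_lt_top (hN.measurable_apply MeasurableSet.univ)
    (by rw [hN.lintegral_apply MeasurableSet.univ]; exact measure_ne_top _ _)

omit [IsProbabilityMeasure P] in
lemma ae_finiteKernel_eq (hN : IsPoissonRandomMeasure P F ((timeMeasure a b).prod ς) N) :
    ∀ᵐ ω ∂P, finiteKernel N hN.measurable ω = N ω := by
  filter_upwards [hN.ae_lt_top] with ω hω
  exact if_pos hω

omit [IsProbabilityMeasure P] in
lemma ae_bot (hN : IsPoissonRandomMeasure P F ((timeMeasure a b).prod ς) N) :
    ∀ᵐ ω ∂P, N ω ({⊥} ×ˢ Set.univ) = 0 := by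
  have hB : MeasurableSet ({⊥} ×ˢ Set.univ : Set (Set.Icc a b × E)) :=
    (measurableSet_singleton _).prod .univ
  refine (lintegral_eq_zero_iff (hN.measurable_apply hB)).1 ?_
  rw [hN.lintegral_apply hB, Measure.prod_prod]
  simp

/-- These sets are the cells of the partition of `(a, b]` into `n + 1` equal intervals. The division
by `b - a` has a junk value only if `a = b`, when the time interval is a null point. -/
lemma timeMeasure_slab_le (n k : ℕ) :
    timeMeasure a b {s | (⌈((s : ℝ) - a) * (n + 1) / (b - a)⌉₊ : ℕ) = k + 1} ≤
      ENNReal.ofReal ((b - a) / (n + 1)) := by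
  rw [timeMeasure_apply]
  have hn : (0 : ℝ) < n + 1 := by positivity
  rcases hab.out.eq_or_lt with h | h
  · refine le_of_eq_of_le (measure_mono_null (t := {a}) ?_ (by simp)) zero_le
    rintro _ ⟨x, _, rfl⟩
    exact le_antisymm (h ▸ x.2.2) x.2.1
  have hba : 0 < b - a := by linarith
  refine (measure_mono (t := Set.Ioc (a + k * ((b - a) / (n + 1)))
    (a + (k + 1) * ((b - a) / (n + 1)))) ?_).trans ?_
  · rintro _ ⟨x, hx, rfl⟩
    have hx' : (⌈((x : ℝ) - a) * (n + 1) / (b - a)⌉₊ : ℕ) = k + 1 := hx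
    rw [Nat.ceil_eq_iff (by omega)] at hx'
    obtain ⟨h1, h2⟩ := hx'
    simp only [Nat.add_sub_cancel] at h1
    push_cast at h2
    rw [lt_div_iff₀ hba] at h1
    rw [div_le_iff₀ hba] at h2
    constructor
    · rw [← lt_sub_iff_add_lt', ← mul_div_assoc, div_lt_iff₀ hn]; linarith
    · rw [← sub_le_iff_le_add', ← mul_div_assoc, le_div_iff₀ hn]; linarith
  · rw [Real.volume_Ioc]
    refine ENNReal.ofReal_le_ofReal (le_of_eq (by ring))

omit [IsProbabilityMeasure P] in
/-- Almost surely no two points of a Poisson random measure occur at the same time. -/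
lemma ae_simple (hN : IsPoissonRandomMeasure P F ((timeMeasure a b).prod ς) N) :
    ∀ᵐ ω ∂P, ∀ u : Set.Icc a b, ⊥ < u → N ω ({u} ×ˢ Set.univ) < 2 := by
  set c : ℝ≥0∞ := ENNReal.ofReal (b - a) * ς Set.univ with hc
  have hcf : c ^ 2 ≠ ∞ := ENNReal.pow_ne_top (ENNReal.mul_ne_top ENNReal.ofReal_ne_top (measure_ne_top _ _))
  -- Two points at a common time lie in a common slab. Each of the `n + 1` slabs has mean at most `c
  -- / (n + 1)`, hence carries two points with probability at most `(c / (n + 1)) ^ 2`. The sum is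
  -- `c ^ 2 / (n + 1)`, and it bounds the outer measure of the event, whose measurability plays no
  -- role.
  have hbound : ∀ n : ℕ, P {ω | ¬ ∀ u : Set.Icc a b, ⊥ < u → N ω ({u} ×ˢ Set.univ) < 2} ≤
      c ^ 2 * ((n + 1 : ℕ) : ℝ≥0∞)⁻¹ := by
    intro n
    have hn : (0 : ℝ) < n + 1 := by positivity
    let D : ℕ → Set (Set.Icc a b) := fun k =>
      {s | (⌈((s : ℝ) - a) * (n + 1) / (b - a)⌉₊ : ℕ) = k + 1}
    have hD : ∀ k, MeasurableSet (D k) := by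
      intro k
      have : Measurable fun s : Set.Icc a b => (⌈((s : ℝ) - a) * (n + 1) / (b - a)⌉₊ : ℕ) :=
        Nat.measurable_ceil.comp (by fun_prop)
      exact this (measurableSet_singleton (k + 1))
    have hsub : {ω | ¬ ∀ u : Set.Icc a b, ⊥ < u → N ω ({u} ×ˢ Set.univ) < 2} ⊆
        ⋃ k ∈ Finset.range (n + 1), {ω | 2 ≤ N ω (D k ×ˢ Set.univ)} := by
      intro ω hω
      simp only [Set.mem_ofPred_eq, not_forall, not_lt] at hω
      obtain ⟨u, hu, h2⟩ := hω
      have hau : a < u := hu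
      have hub : (u : ℝ) ≤ b := u.2.2
      have hba : 0 < b - a := by linarith
      set y : ℝ := ((u : ℝ) - a) * (n + 1) / (b - a) with hy
      have hy0 : 0 < y := div_pos (mul_pos (by linarith) hn) hba
      have hy1 : y ≤ (n + 1 : ℕ) := by
        rw [hy, div_le_iff₀ hba]; push_cast; nlinarith
      have hc1 : ⌈y⌉₊ ≤ n + 1 := Nat.ceil_le.2 hy1
      have hc0 : 0 < ⌈y⌉₊ := Nat.ceil_pos.2 hy0
      refine Set.mem_biUnion (x := ⌈y⌉₊ - 1) (by rw [Finset.coe_range, Set.mem_Iio]; omega) ?_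
      refine h2.trans (measure_mono ?_)
      refine Set.prod_mono (Set.singleton_subset_iff.2 ?_) le_rfl
      change ⌈y⌉₊ = _
      omega
    refine (measure_mono hsub).trans ((measure_biUnion_finset_le _ _).trans ?_)
    have hk : ∀ k, P {ω | 2 ≤ N ω (D k ×ˢ Set.univ)} ≤
        c ^ 2 * (((n + 1 : ℕ) : ℝ≥0∞)⁻¹) ^ 2 := by
      intro k
      refine (hN.measure_two_le ((hD k).prod .univ)).trans ?_
      rw [Measure.prod_prod, ← mul_pow]
      have h1 := timeMeasure_slab_le (a := a) (b := b) n k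
      rw [ENNReal.ofReal_div_of_pos hn, div_eq_mul_inv] at h1
      have h2 : ENNReal.ofReal ((n : ℝ) + 1) = ((n + 1 : ℕ) : ℝ≥0∞) := by
        rw [← ENNReal.ofReal_natCast]; push_cast; rfl
      rw [h2] at h1
      gcongr ?_ ^ 2
      calc timeMeasure a b (D k) * ς Set.univ ≤ _ := mul_le_mul_left h1 _
        _ = _ := by rw [hc]; ring
    refine (Finset.sum_le_sum fun k _ => hk k).trans ?_
    rw [Finset.sum_const, Finset.card_range, nsmul_eq_mul]
    have h4 : ((n + 1 : ℕ) : ℝ≥0∞) * ((n + 1 : ℕ) : ℝ≥0∞)⁻¹ = 1 :=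
      ENNReal.mul_inv_cancel (by simp) (ENNReal.natCast_ne_top _)
    refine le_of_eq ?_
    calc ((n + 1 : ℕ) : ℝ≥0∞) * (c ^ 2 * ((n + 1 : ℕ) : ℝ≥0∞)⁻¹ ^ 2)
        = c ^ 2 * ((n + 1 : ℕ) : ℝ≥0∞)⁻¹ * (((n + 1 : ℕ) : ℝ≥0∞) * ((n + 1 : ℕ) : ℝ≥0∞)⁻¹) := by
          ring
      _ = _ := by rw [h4, mul_one]
  have hlim : Tendsto (fun n : ℕ => c ^ 2 * ((n + 1 : ℕ) : ℝ≥0∞)⁻¹) atTop (𝓝 (c ^ 2 * 0)) :=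
    ENNReal.Tendsto.const_mul
      (ENNReal.tendsto_inv_nat_nhds_zero.comp (tendsto_add_atTop_nat 1)) (Or.inr hcf)
  rw [mul_zero] at hlim
  exact le_antisymm (ge_of_tendsto' hlim hbound) zero_le

omit [IsProbabilityMeasure P] in
/-- Almost surely a Poisson random measure with finite mean is a finite sum of point masses at
distinct times. -/
lemma ae_exists_finset {E : Type*} [MetricSpace E] [SecondCountableTopology E]
    [MeasurableSpace E] [BorelSpace E] {ς : Measure E} [IsFiniteMeasure ς]
    {N : Ω → Measure (Set.Icc a b × E)}
    (hN : IsPoissonRandomMeasure P F ((timeMeasure a b).prod ς) N) :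
    ∀ᵐ ω ∂P, ∃ A : Finset (Set.Icc a b × E), Set.InjOn Prod.fst (A : Set (Set.Icc a b × E)) ∧
      (∀ x ∈ A, ⊥ < x.1) ∧ N ω = ∑ x ∈ A, Measure.dirac x := by
  filter_upwards [hN.ae_lt_top, hN.ae_bot, hN.ae_simple] with ω h1 h2 h3
  have : IsFiniteMeasure (N ω) := ⟨h1⟩
  obtain ⟨A, hA, hNA⟩ := exists_finset_of_counting (N ω) (hN.counting ω)
  have hpos : ∀ x ∈ A, ⊥ < x.1 := by
    intro x hx
    rw [bot_lt_iff_ne_bot]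
    intro hb
    exact hA x hx (measure_mono_null (by rintro _ rfl; exact ⟨hb, Set.mem_univ _⟩) h2)
  have hge : ∀ x ∈ A, 1 ≤ N ω {x} := by
    intro x hx
    obtain ⟨n, hn⟩ := hN.counting ω {x} (measurableSet_singleton x)
    have h0 := hA x hx
    rw [hn] at h0 ⊢
    have : n ≠ 0 := by rintro rfl; simp at h0
    exact_mod_cast Order.one_le_iff_ne_zero.2 this
  have hone : ∀ x ∈ A, N ω {x} = 1 := by
    intro x hx
    have hlt : N ω {x} < 2 := (measure_mono (by
      rintro _ rfl; exact ⟨rfl, Set.mem_univ _⟩)).trans_lt (h3 x.1 (hpos x hx))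
    obtain ⟨n, hn⟩ := hN.counting ω {x} (measurableSet_singleton x)
    have hg := hge x hx
    rw [hn] at hlt hg ⊢
    have h5 : n < 2 := by exact_mod_cast hlt
    have h6 : 1 ≤ n := by exact_mod_cast hg
    have : n = 1 := le_antisymm (by
      have : n < 1 + 1 := by rw [one_add_one_eq_two]; exact h5
      exact Order.le_of_lt_add_one this) h6
    simp [this]
  refine ⟨A, ?_, hpos, ?_⟩
  · intro x hx y hy hxy
    by_contra hne
    have h4 := h3 x.1 (hpos x hx)
    have h5 : N ω ({x} ∪ {y}) ≤ N ω ({x.1} ×ˢ Set.univ) := by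
      refine measure_mono ?_
      rintro z (rfl | rfl)
      · exact ⟨rfl, Set.mem_univ _⟩
      · exact ⟨hxy.symm, Set.mem_univ _⟩
    rw [measure_union (by simpa using hne) (measurableSet_singleton y), hone x hx, hone y hy,
      one_add_one_eq_two] at h5
    exact absurd h4 (not_lt.2 h5)
  · conv_lhs => rw [hNA]
    exact Finset.sum_congr rfl fun x hx => by rw [hone x hx, one_smul]

end IsPoissonRandomMeasure

/-! ### The compensator formula -/

namespace IsPoissonRandomMeasure

variable {a b : ℝ} [hab : Fact (a ≤ b)] {Ω E : Type*} {mΩ : MeasurableSpace Ω} {P : Measure Ω}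
  [IsProbabilityMeasure P] [MeasurableSpace E] {F : Filtration (Set.Icc a b) mΩ}
  {ς : Measure E} [IsFiniteMeasure ς] {N : Ω → Measure (Set.Icc a b × E)}

/-- The measure `P(dω) N(ω, ds, dζ)` on time, chance and marks. -/
def jointMeasure (hN : IsPoissonRandomMeasure P F ((timeMeasure a b).prod ς) N) :
    Measure ((Set.Icc a b × Ω) × E) :=
  (P ⊗ₘ finiteKernel N hN.measurable).map fun y => ((y.2.1, y.1), y.2.2)

lemma lintegral_jointMeasure (hN : IsPoissonRandomMeasure P F ((timeMeasure a b).prod ς) N)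
    {H : (Set.Icc a b × Ω) × E → ℝ≥0∞} (hH : Measurable H) :
    ∫⁻ y, H y ∂hN.jointMeasure = ∫⁻ ω, ∫⁻ x, H ((x.1, ω), x.2) ∂(N ω) ∂P := by
  rw [jointMeasure, lintegral_map hH (by fun_prop), Measure.lintegral_compProd (by fun_prop)]
  refine lintegral_congr_ae ?_
  filter_upwards [hN.ae_finiteKernel_eq] with ω hω
  rw [hω]

lemma jointMeasure_prod (hN : IsPoissonRandomMeasure P F ((timeMeasure a b).prod ς) N)
    {A : Set Ω} (hA : MeasurableSet A) {D : Set (Set.Icc a b)} (hD : MeasurableSet D)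
    {B : Set E} (hB : MeasurableSet B) :
    hN.jointMeasure ((D ×ˢ A) ×ˢ B) = ∫⁻ ω, N ω (D ×ˢ B) * A.indicator 1 ω ∂P := by
  rw [← lintegral_indicator_one ((hD.prod hA).prod hB), lintegral_jointMeasure hN
    (measurable_one.indicator ((hD.prod hA).prod hB))]
  refine lintegral_congr fun ω => ?_
  by_cases hω : ω ∈ A
  · rw [Set.indicator_of_mem hω, Pi.one_apply, mul_one, ← lintegral_indicator_one (hD.prod hB)]
    refine lintegral_congr fun x => ?_
    have : ((x.1, ω), x.2) ∈ (D ×ˢ A) ×ˢ B ↔ x ∈ D ×ˢ B := by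
      simp only [Set.mem_prod, hω, and_true]
    by_cases hx : x ∈ D ×ˢ B
    · rw [Set.indicator_of_mem hx, Set.indicator_of_mem (this.2 hx)]; rfl
    · rw [Set.indicator_of_notMem hx, Set.indicator_of_notMem (fun h => hx (this.1 h))]
  · rw [Set.indicator_of_notMem hω, mul_zero]
    simp [Set.indicator, hω]

instance (hN : IsPoissonRandomMeasure P F ((timeMeasure a b).prod ς) N) :
    IsFiniteMeasure hN.jointMeasure := by
  refine ⟨?_⟩
  have h := hN.jointMeasure_prod (A := Set.univ) .univ (D := Set.univ) .univ (B := Set.univ) .univ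
  simp only [Set.univ_prod_univ, Set.indicator_univ, Pi.one_apply, mul_one] at h
  rw [h, hN.lintegral_apply .univ]
  exact measure_lt_top _ _

/-- On a generator `Ioi i ×ˢ A` with `A` in `F i`, the points after time `i` are independent of `A`,
so the mean factorises into the mean measure and `P A`. The generators at `⊥` are null for both
measures, and a π-λ argument does the rest. -/
lemma jointMeasure_predictable_prod
    (hN : IsPoissonRandomMeasure P F ((timeMeasure a b).prod ς) N)
    {D : Set (Set.Icc a b × Ω)} (hD : MeasurableSet[F.predictable] D)
    {B : Set E} (hB : MeasurableSet B) :
    hN.jointMeasure (D ×ˢ B) = (((timeMeasure a b).prod P).prod ς) (D ×ˢ B) := by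
  have hle := predictable_le_prod F
  have hIoi : ∀ (i : Set.Icc a b) (A : Set Ω), MeasurableSet[F i] A →
      hN.jointMeasure ((Set.Ioi i ×ˢ A) ×ˢ B) =
        (((timeMeasure a b).prod P).prod ς) ((Set.Ioi i ×ˢ A) ×ˢ B) := by
    intro i A hA
    have hA' := F.le i A hA
    rw [hN.jointMeasure_prod hA' measurableSet_Ioi hB]
    have hsig : randomMeasureSigma N (Set.Ioi i ×ˢ Set.univ) ≤ mΩ :=
      iSup_le fun B => iSup_le fun hB => iSup_le fun _ =>
        measurable_iff_comap_le.1 (hN.measurable_apply hB)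
    have hm : Measurable[randomMeasureSigma N (Set.Ioi i ×ˢ Set.univ)]
        fun ω => N ω (Set.Ioi i ×ˢ B) := by
      rw [measurable_iff_comap_le]
      exact le_iSup₂_of_le (Set.Ioi i ×ˢ B) (measurableSet_Ioi.prod hB)
        (le_iSup_of_le (Set.prod_mono le_rfl (Set.subset_univ B)) le_rfl)
    have hA1 : Measurable[F i] (A.indicator (1 : Ω → ℝ≥0∞)) :=
      by
      refine Measurable.indicator ?_ hA
      exact measurable_const
    rw [lintegral_mul_eq_lintegral_mul_lintegral_of_independent_measurableSpace hsig (F.le i)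
      (hN.indep_past i) hm hA1, hN.lintegral_apply (measurableSet_Ioi.prod hB),
      lintegral_indicator_one hA', Measure.prod_prod, Measure.prod_prod, Measure.prod_prod]
    ring
  have hbot : ∀ A : Set Ω, MeasurableSet[F ⊥] A →
      hN.jointMeasure (({⊥} ×ˢ A) ×ˢ B) =
        (((timeMeasure a b).prod P).prod ς) (({⊥} ×ˢ A) ×ˢ B) := by
    intro A hA
    have hA' := F.le ⊥ A hA
    rw [hN.jointMeasure_prod hA' (measurableSet_singleton _) hB, Measure.prod_prod,
      Measure.prod_prod, measure_singleton, zero_mul, zero_mul]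
    refine le_antisymm ((lintegral_mono (g := fun ω => N ω ({⊥} ×ˢ B)) fun ω => ?_).trans
      (le_of_eq ?_)) zero_le
    · exact (mul_le_mul_right (Set.indicator_le_self' (by simp) ω) _).trans (by simp)
    · rw [hN.lintegral_apply ((measurableSet_singleton _).prod hB), Measure.prod_prod]
      simp
  have hpi : IsPiSystem ({s | ∃ A, MeasurableSet[F ⊥] A ∧ s = {⊥} ×ˢ A} ∪
      {s | ∃ i A, MeasurableSet[F i] A ∧ s = Set.Ioi i ×ˢ A} : Set (Set (Set.Icc a b × Ω))) := by
    rintro _ (⟨A, hA, rfl⟩ | ⟨i, A, hA, rfl⟩) _ (⟨A', hA', rfl⟩ | ⟨j, A', hA', rfl⟩) hne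
    · refine Or.inl ⟨A ∩ A', hA.inter hA', ?_⟩
      rw [Set.prod_inter_prod, Set.inter_self]
    · obtain ⟨x, hx, hy⟩ := hne
      exact absurd hx.1 (ne_of_gt (bot_le.trans_lt hy.1))
    · obtain ⟨x, hx, hy⟩ := hne
      exact absurd hy.1 (ne_of_gt (bot_le.trans_lt hx.1))
    · refine Or.inr ⟨i ⊔ j, A ∩ A', (F.mono le_sup_left _ hA).inter (F.mono le_sup_right _ hA'), ?_⟩
      rw [Set.prod_inter_prod, Set.Ioi_inter_Ioi]
  induction D, hD using MeasurableSpace.induction_on_inter (m := F.predictable) rfl hpi with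
  | empty => simp
  | basic D hD =>
    rcases hD with ⟨A, hA, rfl⟩ | ⟨i, A, hA, rfl⟩
    · exact hbot A hA
    · exact hIoi i A hA
  | compl D hD ih =>
    -- The whole space is not a generator, but it is the disjoint union of two of them. Its finite
    -- mass is needed to pass to complements.
    have huniv : hN.jointMeasure (Set.univ ×ˢ B) =
        (((timeMeasure a b).prod P).prod ς) (Set.univ ×ˢ B) := by
      have hu : (Set.univ : Set (Set.Icc a b × Ω)) = {⊥} ×ˢ Set.univ ∪ Set.Ioi ⊥ ×ˢ Set.univ := by
        ext ⟨s, ω⟩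
        simp only [Set.mem_univ, Set.mem_union, Set.mem_prod, Set.mem_singleton_iff, and_true,
          Set.mem_Ioi, true_iff]
        exact (eq_or_ne s ⊥).imp id bot_lt_iff_ne_bot.2
      have hd : Disjoint (({⊥} ×ˢ Set.univ : Set (Set.Icc a b × Ω)) ×ˢ B)
          ((Set.Ioi ⊥ ×ˢ Set.univ) ×ˢ B) :=
        Set.disjoint_left.2 fun x hx hy => absurd hx.1.1 (ne_of_gt hy.1.1)
      have hm : MeasurableSet ((Set.Ioi ⊥ ×ˢ Set.univ : Set (Set.Icc a b × Ω)) ×ˢ B) :=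
        (measurableSet_Ioi.prod .univ).prod hB
      rw [hu, Set.union_prod, measure_union hd hm, measure_union hd hm, hbot _ .univ, hIoi _ _ .univ]
    have hc : Dᶜ ×ˢ B = (Set.univ ×ˢ B) \ (D ×ˢ B) := by
      ext x; simp; tauto
    have hDm : MeasurableSet (D ×ˢ B) := (hle D hD).prod hB
    rw [hc, measure_sdiff (Set.prod_mono (Set.subset_univ _) le_rfl) hDm.nullMeasurableSet
      (measure_ne_top _ _), measure_sdiff (Set.prod_mono (Set.subset_univ _) le_rfl)
      hDm.nullMeasurableSet (measure_ne_top _ _), huniv, ih]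
  | iUnion f hd hf ih =>
    have hd' : Pairwise fun i j => Disjoint (f i ×ˢ B) (f j ×ˢ B) := fun i j hij =>
      Set.disjoint_left.2 fun x hx hy => Set.disjoint_left.1 (hd hij) hx.1 hy.1
    have hm : ∀ i, MeasurableSet (f i ×ˢ B) := fun i => (hle _ (hf i)).prod hB
    rw [Set.iUnion_prod_const, measure_iUnion hd' hm, measure_iUnion hd' hm]
    exact tsum_congr ih

lemma predictable_prod_le (F : Filtration (Set.Icc a b) mΩ) :
    @Prod.instMeasurableSpace _ _ F.predictable ‹MeasurableSpace E› ≤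
      (inferInstance : MeasurableSpace ((Set.Icc a b × Ω) × E)) :=
  sup_le_sup (MeasurableSpace.comap_mono (predictable_le_prod F)) le_rfl

/-- The compensator of a Poisson random measure: on predictable integrands, `P(dω) N(ω, ds, dζ)`
agrees with `ds P(dω) ς(dζ)`. -/
theorem trim_jointMeasure (hN : IsPoissonRandomMeasure P F ((timeMeasure a b).prod ς) N) :
    hN.jointMeasure.trim (predictable_prod_le F) =
      (((timeMeasure a b).prod P).prod ς).trim (predictable_prod_le F) := by
  have : IsFiniteMeasure (hN.jointMeasure.trim (predictable_prod_le F)) := isFiniteMeasure_trim _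
  refine @Measure.ext_prod _ _ F.predictable _ _ _ _ fun {D B} hD hB => ?_
  have hm : MeasurableSet[@Prod.instMeasurableSpace _ _ F.predictable ‹MeasurableSpace E›]
    (D ×ˢ B) := @MeasurableSet.prod _ _ F.predictable _ _ _ hD hB
  rw [trim_measurableSet_eq _ hm, trim_measurableSet_eq _ hm]
  exact hN.jointMeasure_predictable_prod hD hB

/-- By the compensator formula the expected number of Poisson points in a predictable set is its
measure, so a null set almost surely receives no point. -/
lemma ae_measure_eq_zero (hN : IsPoissonRandomMeasure P F ((timeMeasure a b).prod ς) N)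
    {D : Set ((Set.Icc a b × Ω) × E)}
    (hD : MeasurableSet[@Prod.instMeasurableSpace _ _ F.predictable ‹MeasurableSpace E›] D)
    (h0 : (((timeMeasure a b).prod P).prod ς) D = 0) :
    ∀ᵐ ω ∂P, N ω {x | ((x.1, ω), x.2) ∈ D} = 0 := by
  have hmap : Measurable fun y : Ω × Set.Icc a b × E => ((y.2.1, y.1), y.2.2) := by fun_prop
  have h1 : hN.jointMeasure D = 0 := by
    rw [← trim_measurableSet_eq (predictable_prod_le F) hD, hN.trim_jointMeasure,
      trim_measurableSet_eq _ hD, h0]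
  rw [jointMeasure, Measure.map_apply hmap (predictable_prod_le F D hD)] at h1
  have h2 := Measure.ae_ae_of_ae_compProd (measure_eq_zero_iff_ae_notMem.1 h1)
  filter_upwards [h2, hN.ae_finiteKernel_eq] with ω hω hk
  rw [hk] at hω
  exact measure_eq_zero_iff_ae_notMem.2 hω

/-- An integrable predictable function has an integrable stochastic integral, and both have the
same mean. -/
theorem integral_compensator (hN : IsPoissonRandomMeasure P F ((timeMeasure a b).prod ς) N)
    {H : (Set.Icc a b × Ω) × E → ℝ}
    (hH : Measurable[@Prod.instMeasurableSpace _ _ F.predictable ‹MeasurableSpace E›] H)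
    (hint : Integrable H (((timeMeasure a b).prod P).prod ς)) :
    Integrable (fun ω => ∫ x, H ((x.1, ω), x.2) ∂(N ω)) P ∧
      ∫ ω, ∫ x, H ((x.1, ω), x.2) ∂(N ω) ∂P = ∫ y, H y ∂(((timeMeasure a b).prod P).prod ς) := by
  have hHs := @Measurable.stronglyMeasurable _ _ (_) _ _ _ _ _ _ hH
  -- The two measures agree only on the predictable `σ`-algebra, so integrability has to be
  -- transferred between their trims.
  have hint2 : Integrable H hN.jointMeasure := by
    refine integrable_of_integrable_trim (predictable_prod_le F) ?_
    rw [hN.trim_jointMeasure]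
    exact hint.trim _ hHs
  have hmap : Measurable fun y : Ω × Set.Icc a b × E => ((y.2.1, y.1), y.2.2) := by fun_prop
  have hHm : Measurable H := hH.mono (predictable_prod_le F) le_rfl
  have hint3 : Integrable (fun y : Ω × Set.Icc a b × E => H ((y.2.1, y.1), y.2.2))
      (P ⊗ₘ finiteKernel N hN.measurable) :=
    (integrable_map_measure hHm.aestronglyMeasurable hmap.aemeasurable).1 hint2
  have hae : (fun ω => ∫ x, H ((x.1, ω), x.2) ∂(finiteKernel N hN.measurable ω)) =ᵐ[P]
      fun ω => ∫ x, H ((x.1, ω), x.2) ∂(N ω) := by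
    filter_upwards [hN.ae_finiteKernel_eq] with ω hω
    rw [hω]
  refine ⟨hint3.integral_compProd.congr hae, ?_⟩
  rw [← integral_congr_ae hae, ← Measure.integral_compProd hint3]
  rw [integral_trim (predictable_prod_le F) hHs, ← hN.trim_jointMeasure,
    ← integral_trim (predictable_prod_le F) hHs, jointMeasure,
    integral_map hmap.aemeasurable hHm.aestronglyMeasurable]

end IsPoissonRandomMeasure

/-! ### A linear equation with finitely many jumps -/

section StepFunctions

variable {ι : Type*} [LinearOrder ι] [TopologicalSpace ι] [OrderTopology ι]

lemma eventually_filter_le_nhdsGE (J : Finset ι) (s : ι) :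
    ∀ᶠ r in 𝓝[≥] s, J.filter (· ≤ r) = J.filter (· ≤ s) := by
  have h : ∀ᶠ r in 𝓝[≥] s, ∀ u ∈ J, (u ≤ r ↔ u ≤ s) := by
    refine (Finset.eventually_all J).2 fun u _ => ?_
    rcases le_or_gt u s with h | h
    · filter_upwards [self_mem_nhdsWithin] with r hr
      exact ⟨fun _ => h, fun _ => h.trans hr⟩
    · filter_upwards [mem_nhdsWithin_of_mem_nhds (Iio_mem_nhds h)] with r hr
      exact ⟨fun h' => absurd hr (not_lt.2 h'), fun h' => absurd h (not_lt.2 h')⟩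
  filter_upwards [h] with r hr
  exact Finset.filter_congr hr

lemma eventually_filter_le_nhdsLT (J : Finset ι) (s : ι) :
    ∀ᶠ r in 𝓝[<] s, J.filter (· ≤ r) = J.filter (· < s) := by
  have h : ∀ᶠ r in 𝓝[<] s, ∀ u ∈ J, (u ≤ r ↔ u < s) := by
    refine (Finset.eventually_all J).2 fun u _ => ?_
    rcases lt_or_ge u s with h | h
    · filter_upwards [mem_nhdsWithin_of_mem_nhds (Ioi_mem_nhds h)] with r hr
      exact ⟨fun _ => h, fun _ => le_of_lt hr⟩
    · filter_upwards [self_mem_nhdsWithin] with r hr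
      exact ⟨fun h' => h'.trans_lt hr, fun h' => absurd h' (not_lt.2 h)⟩
  filter_upwards [h] with r hr
  exact Finset.filter_congr hr

/-- A function of the finitely many times up to `s` is càdlàg. -/
lemma isCadlag_comp_filter {β : Type*} [TopologicalSpace β] (J : Finset ι) (Φ : Finset ι → β) :
    IsCadlag fun s => Φ (J.filter (· ≤ s)) := by
  intro s
  refine ⟨?_, Φ (J.filter (· < s)), ?_⟩
  · refine tendsto_const_nhds.congr' ?_
    filter_upwards [eventually_filter_le_nhdsGE J s] with r hr
    rw [hr]
  · refine tendsto_const_nhds.congr' ?_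
    filter_upwards [eventually_filter_le_nhdsLT J s] with r hr
    rw [hr]

lemma leftLim_comp_filter {β : Type*} [TopologicalSpace β] [T2Space β] [OrderBot ι]
    [DenselyOrdered ι] (J : Finset ι) (hJ : ∀ u ∈ J, ⊥ < u) (Φ : Finset ι → β) (s : ι) :
    Function.leftLim (fun s => Φ (J.filter (· ≤ s))) s = Φ (J.filter (· < s)) := by
  rcases eq_or_ne s ⊥ with rfl | hs
  · rw [leftLim_bot]
    congr 1
    exact Finset.filter_congr fun u hu => ⟨fun h => absurd (hJ u hu) (not_lt.2 h), le_of_lt⟩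
  · have := nhdsLT_neBot_of_exists_lt ⟨⊥, bot_lt_iff_ne_bot.2 hs⟩
    refine leftLim_eq_of_tendsto (tendsto_const_nhds.congr' ?_)
    filter_upwards [eventually_filter_le_nhdsLT J s] with r hr
    rw [hr]

lemma leftLim_map₂ {β γ δ : Type*} [TopologicalSpace β] [T2Space β] [TopologicalSpace γ] [T2Space γ]
    [TopologicalSpace δ] [T2Space δ] {f : ι → β} {g : ι → γ} (hf : IsCadlag f) (hg : IsCadlag g)
    {φ : β × γ → δ} (hφ : Continuous φ) (s : ι) :
    Function.leftLim (fun r => φ (f r, g r)) s =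
      φ (Function.leftLim f s, Function.leftLim g s) := by
  rcases eq_or_neBot (𝓝[<] s) with h | h
  · simp only [leftLim_eq_of_eq_bot _ h]
  · exact leftLim_eq_of_tendsto ((hφ.tendsto _).comp
      ((hf.tendsto_leftLim s).prodMk_nhds (hg.tendsto_leftLim s)))

omit [OrderTopology ι] in
lemma IsCadlag.map₂ {β γ δ : Type*} [TopologicalSpace β] [TopologicalSpace γ]
    [TopologicalSpace δ] {f : ι → β} {g : ι → γ} (hf : IsCadlag f) (hg : IsCadlag g)
    {φ : β × γ → δ} (hφ : Continuous φ) : IsCadlag fun r => φ (f r, g r) := by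
  intro s
  refine ⟨hφ.continuousAt.comp_continuousWithinAt ((hf s).1.prodMk (hg s).1), ?_⟩
  obtain ⟨l, hl⟩ := (hf s).2
  obtain ⟨m, hm⟩ := (hg s).2
  exact ⟨φ (l, m), (hφ.tendsto _).comp (hl.prodMk_nhds hm)⟩

omit [OrderTopology ι] in
lemma isCadlag_of_continuous {β : Type*} [TopologicalSpace β] {f : ι → β} (hf : Continuous f) :
    IsCadlag f :=
  fun s => ⟨hf.continuousWithinAt, f s, (hf.tendsto s).mono_left nhdsWithin_le_nhds⟩

lemma leftLim_of_continuous {β : Type*} [TopologicalSpace β] [T2Space β] {f : ι → β}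
    (hf : Continuous f) (s : ι) : Function.leftLim f s = f s := by
  rcases eq_or_neBot (𝓝[<] s) with h | h
  · exact leftLim_eq_of_eq_bot _ h
  · exact leftLim_eq_of_tendsto ((hf.tendsto s).mono_left nhdsWithin_le_nhds)

/-- Near each point the path is bounded on the right by right-continuity and on the left by the left
limit. Compactness leaves finitely many such neighbourhoods. -/
lemma IsCadlag.exists_bound [CompactSpace ι] {f : ι → ℝ} (hf : IsCadlag f) :
    ∃ C, ∀ s, |f s| ≤ C := by
  have h := isCompact_univ.induction_on (X := ι) (p := fun S => ∃ C, ∀ s ∈ S, |f s| ≤ C)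
    ⟨0, by simp⟩ (fun S T hST ⟨C, hC⟩ => ⟨C, fun s hs => hC s (hST hs)⟩)
    (fun S T ⟨C, hC⟩ ⟨C', hC'⟩ => ⟨max C C', fun s hs => hs.elim
      (fun h => (hC s h).trans (le_max_left _ _)) (fun h => (hC' s h).trans (le_max_right _ _))⟩)
    (fun s _ => by
      have h1 : ∀ᶠ r in 𝓝[≥] s, |f r| ≤ |f s| + 1 := by
        have := (hf s).1.abs
        filter_upwards [this.eventually (gt_mem_nhds (lt_add_one |f s|))] with r hr using hr.le
      have h2 : ∀ᶠ r in 𝓝[<] s, |f r| ≤ |Function.leftLim f s| + 1 := by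
        have := (hf.tendsto_leftLim s).abs
        filter_upwards [this.eventually (gt_mem_nhds (lt_add_one _))] with r hr using hr.le
      refine ⟨{r | |f r| ≤ max (|f s| + 1) (|Function.leftLim f s| + 1)}, ?_, _, fun r hr => hr⟩
      rw [nhdsWithin_univ, ← nhdsLT_sup_nhdsGE]
      refine Filter.mem_sup.2 ⟨?_, ?_⟩
      · filter_upwards [h2] with r hr using hr.trans (le_max_right _ _)
      · filter_upwards [h1] with r hr using hr.trans (le_max_left _ _))
  obtain ⟨C, hC⟩ := h
  exact ⟨C, fun s => hC s (Set.mem_univ s)⟩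

end StepFunctions

/-! ### Primitives of bounded functions and their exponentials -/

section TimeIntegral

variable {a b : ℝ} [hab : Fact (a ≤ b)]

omit hab in
lemma integrable_timeMeasure_of_bound {f : Set.Icc a b → ℝ} (hf : Measurable f) {C : ℝ}
    (hC : ∀ s, |f s| ≤ C) : Integrable f (timeMeasure a b) :=
  Integrable.of_bound hf.aestronglyMeasurable C (Eventually.of_forall hC)

lemma setIntegral_timeMeasure_Ioc (f : Set.Icc a b → ℝ) {v s : Set.Icc a b} (hvs : v ≤ s) :
    ∫ u in Set.Ioc v s, f u ∂(timeMeasure a b) =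
      ∫ x in (v : ℝ)..s, f (Set.projIcc a b hab.out x) := by
  have hvs' : (v : ℝ) ≤ s := hvs
  rw [intervalIntegral.integral_of_le hvs']
  have h1 : (timeMeasure a b).map Subtype.val = (volume : Measure ℝ).restrict (Set.Icc a b) := by
    rw [timeMeasure, measurableEmbedding_Icc_val.map_comap, Subtype.range_coe]
  have h2 := measurableEmbedding_Icc_val.setIntegral_map (μ := timeMeasure a b)
    (fun x => f (Set.projIcc a b hab.out x)) (Set.Ioc (v : ℝ) s)
  have h3 : Set.Ioc (v : ℝ) s ⊆ Set.Icc a b :=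
    fun _ hx => ⟨v.2.1.trans hx.1.le, hx.2.trans s.2.2⟩
  rw [h1, Measure.restrict_restrict measurableSet_Ioc, Set.inter_eq_left.2 h3] at h2
  rw [h2]
  simp only [Set.projIcc_val]
  rfl

/-- The integral of `f` from the left endpoint to `s`. -/
def primitive (f : Set.Icc a b → ℝ) (s : Set.Icc a b) : ℝ :=
  ∫ u in Set.Ioc ⊥ s, f u ∂(timeMeasure a b)

lemma primitive_bot (f : Set.Icc a b → ℝ) : primitive f ⊥ = 0 := by simp [primitive]

lemma primitive_eq (f : Set.Icc a b → ℝ) (s : Set.Icc a b) :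
    primitive f s = ∫ x in a..(s : ℝ), f (Set.projIcc a b hab.out x) :=
  setIntegral_timeMeasure_Ioc f bot_le

lemma intervalIntegrable_comp_projIcc {f : Set.Icc a b → ℝ} (hf : Measurable f) {C : ℝ}
    (hC : ∀ s, |f s| ≤ C) (x y : ℝ) :
    IntervalIntegrable (fun x => f (Set.projIcc a b hab.out x)) volume x y := by
  rw [intervalIntegrable_iff]
  have : IsFiniteMeasure ((volume : Measure ℝ).restrict (Set.uIoc x y)) :=
    ⟨by rw [Measure.restrict_apply_univ, Set.uIoc]; simp⟩
  exact Integrable.of_bound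
    (hf.comp continuous_projIcc.measurable).aestronglyMeasurable C (Eventually.of_forall fun _ => hC _)

lemma continuous_primitive {f : Set.Icc a b → ℝ} (hf : Measurable f) {C : ℝ}
    (hC : ∀ s, |f s| ≤ C) : Continuous (primitive f) := by
  have : primitive f = fun s : Set.Icc a b =>
      ∫ x in a..(s : ℝ), f (Set.projIcc a b hab.out x) := funext (primitive_eq f)
  rw [this]
  exact (intervalIntegral.continuous_primitive
    (fun x y => intervalIntegrable_comp_projIcc hf hC x y) a).comp continuous_subtype_val

/-- The exponential of an absolutely continuous function solves the linear equation. -/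
lemma integral_exp_primitive_mul {f : Set.Icc a b → ℝ} (hf : Measurable f) {C : ℝ}
    (hC : ∀ s, |f s| ≤ C) {v s : Set.Icc a b} (hvs : v ≤ s) :
    ∫ u in Set.Ioc v s, Real.exp (primitive f u) * f u ∂(timeMeasure a b) =
      Real.exp (primitive f s) - Real.exp (primitive f v) := by
  have hvs' : (v : ℝ) ≤ s := hvs
  set g : ℝ → ℝ := fun x => f (Set.projIcc a b hab.out x) with hg
  set F : ℝ → ℝ := fun x => ∫ t in a..x, g t with hF
  have hgi : ∀ x y, IntervalIntegrable g volume x y := intervalIntegrable_comp_projIcc hf hC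
  have hC0 : 0 ≤ C := (abs_nonneg _).trans (hC v)
  -- As `f` is only bounded and measurable, `F` is differentiable merely almost everywhere, and the
  -- fundamental theorem needs absolute continuity. `F` is Lipschitz, and the exponential is
  -- Lipschitz on the half-line containing the compact range of `F`.
  have hFlip : LipschitzWith C.toNNReal F := by
    refine LipschitzWith.of_dist_le_mul fun x y => ?_
    rw [Real.coe_toNNReal _ hC0, Real.dist_eq, Real.dist_eq, hF]
    simp only
    rw [intervalIntegral.integral_interval_sub_left (hgi _ _) (hgi _ _)]
    have := intervalIntegral.norm_integral_le_of_norm_le_const (a := y) (b := x) (f := g) (C := C)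
      fun t _ => hC _
    rwa [Real.norm_eq_abs] at this
  have hac : AbsolutelyContinuousOnInterval (fun x => Real.exp (F x)) v s := by
    have hb : ∃ M, ∀ x ∈ Set.uIcc (v : ℝ) s, F x ≤ M := by
      obtain ⟨M, hM⟩ := (isCompact_uIcc.image hFlip.continuous).bddAbove
      exact ⟨M, fun x hx => hM ⟨x, hx, rfl⟩⟩
    obtain ⟨M, hM⟩ := hb
    have hexp : LipschitzOnWith (Real.exp M).toNNReal Real.exp (Set.Iic M) := by
      refine Convex.lipschitzOnWith_of_nnnorm_deriv_le
        (fun x _ => Real.differentiable_exp x) (fun x hx => ?_) (convex_Iic M)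
      rw [Real.deriv_exp, ← NNReal.coe_le_coe, coe_nnnorm, Real.coe_toNNReal _ (Real.exp_pos M).le,
        Real.norm_eq_abs, abs_of_pos (Real.exp_pos x)]
      exact Real.exp_le_exp.2 hx
    exact (hexp.comp hFlip.lipschitzOnWith fun x hx => hM x hx).absolutelyContinuousOnInterval
  have hder : ∀ᵐ x : ℝ, x ∈ Set.uIoc (v : ℝ) s →
      deriv (fun x => Real.exp (F x)) x = Real.exp (F x) * g x := by
    filter_upwards [(hgi a b).ae_hasDerivAt_integral] with x hx hxs
    rw [Set.uIoc_of_le hvs'] at hxs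
    have hxab : x ∈ Set.uIcc a b := by
      rw [Set.uIcc_of_le hab.out]
      exact ⟨v.2.1.trans hxs.1.le, hxs.2.trans s.2.2⟩
    exact (hx hxab a Set.left_mem_uIcc).exp.deriv
  have h := hac.integral_deriv_eq_sub
  rw [intervalIntegral.integral_congr_ae hder] at h
  rw [primitive_eq, primitive_eq, ← h, setIntegral_timeMeasure_Ioc _ hvs]
  refine intervalIntegral.integral_congr fun x hx => ?_
  rw [Set.uIcc_of_le hvs'] at hx
  have hx' : x ∈ Set.Icc a b := ⟨v.2.1.trans hx.1, hx.2.trans s.2.2⟩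
  simp only [primitive_eq, hg, hF]
  rw [Set.projIcc_of_mem _ hx']

end TimeIntegral

/-! ### Existence and uniqueness for the linear jump equation -/

section LinearEquation

variable {a b : ℝ} [hab : Fact (a ≤ b)]

/-- The stochastic exponential with absolutely continuous part `f` and jumps `c` at the times in
`J`, started at `w`. -/
def linearSolution (w : ℝ) (f : Set.Icc a b → ℝ) (J : Finset (Set.Icc a b)) (c : Set.Icc a b → ℝ)
    (s : Set.Icc a b) : ℝ :=
  w * Real.exp (primitive f s) * ∏ u ∈ J with u ≤ s, (1 + c u)

variable {w : ℝ} {f : Set.Icc a b → ℝ} {J : Finset (Set.Icc a b)} {c : Set.Icc a b → ℝ}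

lemma isCadlag_linearSolution (hf : Measurable f) {C : ℝ} (hC : ∀ s, |f s| ≤ C) :
    IsCadlag (linearSolution w f J c) := by
  refine (isCadlag_of_continuous (f := fun s => w * Real.exp (primitive f s)) ?_).map₂
    (isCadlag_comp_filter J fun S => ∏ u ∈ S, (1 + c u)) continuous_mul
  have := continuous_primitive hf hC
  fun_prop

lemma leftLim_linearSolution (hf : Measurable f) {C : ℝ} (hC : ∀ s, |f s| ≤ C)
    (hJ : ∀ u ∈ J, ⊥ < u) (s : Set.Icc a b) :
    Function.leftLim (linearSolution w f J c) s =
      w * Real.exp (primitive f s) * ∏ u ∈ J with u < s, (1 + c u) := by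
  have hcont : Continuous fun s => w * Real.exp (primitive f s) := by
    have := continuous_primitive hf hC
    fun_prop
  have := leftLim_map₂ (isCadlag_of_continuous hcont)
    (isCadlag_comp_filter J fun S => ∏ u ∈ S, (1 + c u)) continuous_mul s
  refine this.trans ?_
  rw [leftLim_of_continuous hcont, leftLim_comp_filter J hJ fun S => ∏ u ∈ S, (1 + c u)]

/-- Telescoping in time order: each new factor adds `c u` times the product of the earlier ones.
Since `p` is closed downwards, the factors before `u` in the filtered set are all those of `J`
before `u`. -/
lemma prod_filter_eq_one_add_sum {ι : Type*} [LinearOrder ι] (J : Finset ι) (c : ι → ℝ)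
    (p : ι → Prop) [DecidablePred p] (hp : ∀ u v, u < v → p v → p u) :
    ∏ u ∈ J with p u, (1 + c u) =
      1 + ∑ u ∈ J with p u, c u * ∏ v ∈ J with v < u, (1 + c v) := by
  rw [Finset.prod_one_add_ordered]
  congr 1
  refine Finset.sum_congr rfl fun u hu => ?_
  congr 2
  rw [Finset.filter_filter]
  exact Finset.filter_congr fun v _ => ⟨fun h => h.2, fun h =>
    ⟨hp v u h (Finset.mem_filter.1 hu).2, h⟩⟩

/-- Existence for the linear equation. -/
lemma linearSolution_eq (hf : Measurable f) {C : ℝ} (hC : ∀ s, |f s| ≤ C)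
    (hJ : ∀ u ∈ J, ⊥ < u) (s : Set.Icc a b) :
    linearSolution w f J c s = w
      + (∫ u in Set.Ioc ⊥ s, Function.leftLim (linearSolution w f J c) u * f u ∂(timeMeasure a b))
      + ∑ u ∈ J with u ≤ s, Function.leftLim (linearSolution w f J c) u * c u := by
  set e : Set.Icc a b → ℝ := fun s => Real.exp (primitive f s) with he
  set k : Set.Icc a b → ℝ := fun u => c u * ∏ v ∈ J with v < u, (1 + c v) with hk
  have hecont : Continuous e := by
    have := continuous_primitive hf hC
    fun_prop
  have hl : ∀ u, Function.leftLim (linearSolution w f J c) u =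
      w * e u * (1 + ∑ v ∈ J with v < u, k v) := fun u => by
    rw [leftLim_linearSolution hf hC hJ,
      prod_filter_eq_one_add_sum J c (· < u) fun _ _ h h' => h.trans h']
  have hs : linearSolution w f J c s = w * e s * (1 + ∑ v ∈ J with v ≤ s, k v) := by
    rw [linearSolution, prod_filter_eq_one_add_sum J c (· ≤ s) fun _ _ h h' => h.le.trans h']
  obtain ⟨D, hD⟩ := (isCadlag_of_continuous hecont).exists_bound
  have hint : Integrable (fun u => e u * f u) (timeMeasure a b) := by
    refine integrable_timeMeasure_of_bound (hecont.measurable.mul hf) (C := D * C) fun s => ?_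
    rw [abs_mul]
    exact mul_le_mul (hD s) (hC s) (abs_nonneg _) ((abs_nonneg _).trans (hD s))
  -- With the product expanded, the equation is checked separately for each coefficient `k v`. After
  -- time `v` the integral contributes `e s - e v`, the jump at `v` itself contributes `e v`, and
  -- together they give `e s`.
  have hpt : ∀ u, Function.leftLim (linearSolution w f J c) u * f u =
      w * (e u * f u) + ∑ v ∈ J, w * k v * (Set.Ioi v).indicator (fun u => e u * f u) u := by
    intro u
    rw [hl, Finset.sum_filter, mul_add, add_mul, mul_one, mul_assoc, Finset.mul_sum, Finset.sum_mul]
    congr 1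
    refine Finset.sum_congr rfl fun v _ => ?_
    by_cases h : v < u
    · rw [if_pos h, Set.indicator_of_mem (Set.mem_Ioi.2 h)]; ring
    · rw [if_neg h, Set.indicator_of_notMem (by simpa using h)]; ring
  have hI : ∀ v : Set.Icc a b, ∫ u in Set.Ioc ⊥ s, (Set.Ioi v).indicator (fun u => e u * f u) u
      ∂(timeMeasure a b) = if v ≤ s then e s - e v else 0 := by
    intro v
    rw [setIntegral_indicator measurableSet_Ioi]
    split_ifs with h
    · rw [show Set.Ioc ⊥ s ∩ Set.Ioi v = Set.Ioc v s by
        ext u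
        simp only [Set.mem_inter_iff, Set.mem_Ioc, Set.mem_Ioi]
        exact ⟨fun h => ⟨h.2, h.1.2⟩, fun h => ⟨⟨bot_le.trans_lt h.1, h.2⟩, h.1⟩⟩]
      exact integral_exp_primitive_mul hf hC h
    · rw [show Set.Ioc ⊥ s ∩ Set.Ioi v = ∅ by
        ext u
        simp only [Set.mem_inter_iff, Set.mem_Ioc, Set.mem_Ioi, Set.mem_empty_iff_false, iff_false]
        exact fun h' => h (h'.2.le.trans h'.1.2)]
      simp
  have hint1 : ∫ u in Set.Ioc ⊥ s, Function.leftLim (linearSolution w f J c) u * f u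
      ∂(timeMeasure a b) = w * (e s - 1) + ∑ v ∈ J with v ≤ s, w * k v * (e s - e v) := by
    simp_rw [hpt]
    rw [integral_add (hint.const_mul w).integrableOn (integrable_finsetSum _ fun v _ =>
      (((hint.indicator measurableSet_Ioi).const_mul _).integrableOn)), integral_const_mul,
      integral_finsetSum _ fun v _ => ((hint.indicator measurableSet_Ioi).const_mul _).integrableOn]
    congr 1
    · rw [he, integral_exp_primitive_mul hf hC bot_le, primitive_bot, Real.exp_zero]
    · rw [Finset.sum_filter]
      refine Finset.sum_congr rfl fun v _ => ?_
      rw [integral_const_mul, hI]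
      split_ifs <;> ring
  have hsum : ∑ u ∈ J with u ≤ s, Function.leftLim (linearSolution w f J c) u * c u =
      ∑ u ∈ J with u ≤ s, w * k u * e u := by
    refine Finset.sum_congr rfl fun u _ => ?_
    rw [leftLim_linearSolution hf hC hJ, hk, he]
    ring
  rw [hint1, hsum, hs, add_assoc, add_assoc, ← Finset.sum_add_distrib]
  simp_rw [← mul_add, sub_add_cancel]
  rw [← Finset.sum_mul, ← Finset.mul_sum]
  ring

/-- Uniqueness for the homogeneous linear equation. -/
lemma eq_zero_of_linear_eq {C : ℝ} (hC : ∀ s, |f s| ≤ C)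
    (hJ : ∀ u ∈ J, ⊥ < u) {D : Set.Icc a b → ℝ} (hD : IsCadlag D)
    (heq : ∀ s, D s = (∫ u in Set.Ioc ⊥ s, Function.leftLim D u * f u ∂(timeMeasure a b))
      + ∑ u ∈ J with u ≤ s, Function.leftLim D u * c u) (s : Set.Icc a b) : D s = 0 := by
  by_contra hne
  have hC0 : 0 ≤ C := (abs_nonneg _).trans (hC s)
  set B : Set (Set.Icc a b) := {s | D s ≠ 0} with hB
  -- `τ` is the first point of the closure of the set where `D ≠ 0`. Then `D` vanishes before `τ`,
  -- its left limits vanish up to and including `τ`, and so does the jump term at `τ`. It remains to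
  -- show that `D` vanishes near `τ` on the right.
  obtain ⟨τ, hτB, hτ⟩ := isClosed_closure.isCompact.exists_isLeast
    (show (closure B).Nonempty from ⟨s, subset_closure hne⟩)
  have hlt : ∀ r < τ, D r = 0 := by
    intro r hr
    by_contra h
    exact absurd (hτ (subset_closure h)) (not_le.2 hr)
  have hbot : D ⊥ = 0 := by
    rw [heq]
    have : J.filter (· ≤ (⊥ : Set.Icc a b)) = ∅ :=
      Finset.filter_eq_empty_iff.2 fun u hu h => absurd (hJ u hu) (not_lt.2 h)
    rw [this]; simp
  have hleft : ∀ u ≤ τ, Function.leftLim D u = 0 := by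
    intro u hu
    rcases eq_or_ne u ⊥ with rfl | hub
    · rw [leftLim_bot, hbot]
    · have := nhdsLT_neBot_of_exists_lt ⟨⊥, bot_lt_iff_ne_bot.2 hub⟩
      refine leftLim_eq_of_tendsto (tendsto_const_nhds.congr' ?_)
      filter_upwards [self_mem_nhdsWithin] with r hr
      exact (hlt r (lt_of_lt_of_le hr hu)).symm
  have hsumτ : ∑ u ∈ J with u ≤ τ, Function.leftLim D u * c u = 0 :=
    Finset.sum_eq_zero fun u hu => by rw [hleft u (Finset.mem_filter.1 hu).2, zero_mul]
  obtain ⟨M, hM⟩ := hD.exists_bound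
  have hM0 : 0 ≤ M := (abs_nonneg _).trans (hM s)
  -- Chosen so that `C * δ ≤ 1 / 2`, which makes the integral equation a contraction on an interval
  -- of length `δ`.
  set δ : ℝ := 1 / (2 * (C + 1)) with hδ
  have hδ0 : 0 < δ := by positivity
  have hev : ∀ᶠ r in 𝓝[≥] τ, J.filter (· ≤ r) = J.filter (· ≤ τ) ∧ (r : ℝ) < τ + δ := by
    refine (eventually_filter_le_nhdsGE J τ).and ?_
    have : Tendsto (fun r : Set.Icc a b => (r : ℝ)) (𝓝[≥] τ) (𝓝 τ) :=
      (continuous_subtype_val.tendsto τ).mono_left nhdsWithin_le_nhds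
    exact this.eventually (gt_mem_nhds (by linarith))
  -- The neighbourhood has to contain every time between `τ` and its points, because the integral
  -- runs over all of them. If `τ` is the right endpoint, `{τ}` is such a neighbourhood.
  obtain ⟨U, hU, hUsub⟩ : ∃ U ∈ 𝓝[≥] τ, ∀ s ∈ U, ∀ r ∈ Set.Icc τ s,
      J.filter (· ≤ r) = J.filter (· ≤ τ) ∧ (r : ℝ) < τ + δ := by
    by_cases hmax : ∃ y, τ < y
    · obtain ⟨y, hy⟩ := hmax
      obtain ⟨z, hz, hzs⟩ := (mem_nhdsGE_iff_exists_Ico_subset' hy).1 hev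
      exact ⟨Set.Ico τ z, Ico_mem_nhdsGE hz, fun s hs r hr => hzs ⟨hr.1, hr.2.trans_lt hs.2⟩⟩
    · push Not at hmax
      refine ⟨{τ}, ?_, fun s hs r hr => ?_⟩
      · have : Set.Ici τ = {τ} := by
          ext y; exact ⟨fun h => le_antisymm (hmax y) h, fun h => by rw [h]; exact Set.self_mem_Ici⟩
        rw [← this]; exact self_mem_nhdsWithin
      · have h1 : s = τ := hs
        have : r = τ := le_antisymm (h1 ▸ hr.2) hr.1
        rw [this]; exact ⟨rfl, by linarith⟩
  -- No jump occurs in `U` after `τ`, so inserting a bound for `D` into the integral equation halves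
  -- it.
  have hstep : ∀ n : ℕ, ∀ s ∈ U, τ ≤ s → ∀ r ∈ Set.Icc τ s, |D r| ≤ M * (1 / 2) ^ n := by
    intro n
    induction n with
    | zero => intro s _ _ r _; simpa using hM r
    | succ n ih =>
      intro s hs hτs r hr
      obtain ⟨hJr, hrδ⟩ := hUsub s hs r hr
      rw [heq r, hJr, hsumτ, add_zero]
      have hbd : ∀ u ∈ Set.Ioc τ r, |Function.leftLim D u| ≤ M * (1 / 2) ^ n := by
        intro u hu
        have := nhdsLT_neBot_of_exists_lt ⟨τ, hu.1⟩
        refine le_of_tendsto (hD.tendsto_leftLim u).abs ?_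
        filter_upwards [Ioo_mem_nhdsLT hu.1] with v hv
        exact ih s hs hτs v ⟨hv.1.le, hv.2.le.trans (hu.2.trans hr.2)⟩
      have hsplit : ∫ u in Set.Ioc ⊥ r, Function.leftLim D u * f u ∂(timeMeasure a b) =
          ∫ u in Set.Ioc τ r, Function.leftLim D u * f u ∂(timeMeasure a b) := by
        refine setIntegral_eq_of_subset_of_forall_sdiff_eq_zero measurableSet_Ioc
          (Set.Ioc_subset_Ioc_left bot_le) fun u hu => ?_
        have : u ≤ τ := by
          by_contra h
          exact hu.2 ⟨not_le.1 h, hu.1.2⟩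
        rw [hleft u this, zero_mul]
      rw [hsplit]
      have hle : ∀ u ∈ Set.Ioc τ r, ‖Function.leftLim D u * f u‖ ≤ M * (1 / 2) ^ n * C := by
        intro u hu
        rw [norm_mul]
        exact mul_le_mul (hbd u hu) (hC u) (norm_nonneg _) (by positivity)
      have h1 := norm_setIntegral_le_of_norm_le_const (μ := timeMeasure a b)
        (measure_lt_top _ (Set.Ioc τ r)) hle
      rw [Real.norm_eq_abs] at h1
      have h2 : (timeMeasure a b).real (Set.Ioc τ r) ≤ δ := by
        rw [measureReal_def, timeMeasure_apply]
        refine ENNReal.toReal_le_of_le_ofReal hδ0.le ((measure_mono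
          (t := Set.Ioc (τ : ℝ) r) ?_).trans ?_)
        · rintro _ ⟨x, hx, rfl⟩; exact ⟨hx.1, hx.2⟩
        · rw [Real.volume_Ioc]; exact ENNReal.ofReal_le_ofReal (by linarith)
      refine h1.trans ((mul_le_mul_of_nonneg_left h2 (by positivity)).trans ?_)
      have h3 : C * δ ≤ 1 / 2 := by
        rw [hδ, mul_one_div, div_le_div_iff₀ (by positivity) (by norm_num)]; linarith
      rw [pow_succ, mul_assoc, ← mul_assoc M]
      exact mul_le_mul_of_nonneg_left h3 (by positivity)
  have hUzero : ∀ r ∈ U, τ ≤ r → D r = 0 := by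
    intro r hr hτr
    have hlim : Tendsto (fun n : ℕ => M * (1 / 2 : ℝ) ^ n) atTop (𝓝 (M * 0)) :=
      (tendsto_pow_atTop_nhds_zero_of_lt_one (by norm_num) (by norm_num)).const_mul M
    rw [mul_zero] at hlim
    have := ge_of_tendsto' hlim fun n => hstep n r hr hτr r ⟨hτr, le_rfl⟩
    exact abs_nonpos_iff.1 this
  have hnb : ∀ᶠ r in 𝓝 τ, D r = 0 := by
    rw [← nhdsLT_sup_nhdsGE]
    refine Filter.eventually_sup.2 ⟨?_, ?_⟩
    · filter_upwards [self_mem_nhdsWithin] with r hr using hlt r hr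
    · filter_upwards [hU, self_mem_nhdsWithin] with r hr hτr using hUzero r hr hτr
  obtain ⟨r, hr, hrB⟩ := mem_closure_iff_nhds.1 hτB _ hnb
  exact hrB hr

/-- Uniqueness for the linear equation. -/
lemma eq_linearSolution (hf : Measurable f) {C : ℝ} (hC : ∀ s, |f s| ≤ C)
    (hJ : ∀ u ∈ J, ⊥ < u) {W : Set.Icc a b → ℝ} (hW : IsCadlag W)
    (heq : ∀ s, W s = w
      + (∫ u in Set.Ioc ⊥ s, Function.leftLim W u * f u ∂(timeMeasure a b))
      + ∑ u ∈ J with u ≤ s, Function.leftLim W u * c u) (s : Set.Icc a b) :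
    W s = linearSolution w f J c s := by
  set V := linearSolution w f J c with hVdef
  have hV : IsCadlag V := isCadlag_linearSolution hf hC
  have hleft : ∀ u, Function.leftLim (fun r => W r - V r) u =
      Function.leftLim W u - Function.leftLim V u := leftLim_map₂ hW hV continuous_sub
  have hint : ∀ {X : Set.Icc a b → ℝ}, IsCadlag X →
      Integrable (fun u => Function.leftLim X u * f u) (timeMeasure a b) := by
    intro X hX
    obtain ⟨M, hM⟩ := hX.exists_bound
    have hM' : ∀ u, |Function.leftLim X u| ≤ M := fun u =>
      leftLim_mem_of_isClosed hX (C := {x | |x| ≤ M})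
        (isClosed_le continuous_abs continuous_const) hM u
    refine integrable_timeMeasure_of_bound ((measurable_leftLim hX).mul hf) (C := M * C) fun s => ?_
    rw [abs_mul]
    exact mul_le_mul (hM' s) (hC s) (abs_nonneg _) ((abs_nonneg _).trans (hM' s))
  have h := eq_zero_of_linear_eq (c := c) hC hJ (D := fun r => W r - V r)
    (hW.map₂ hV continuous_sub) (fun s => ?_) s
  · exact sub_eq_zero.1 h
  · simp only [hleft, sub_mul]
    rw [integral_sub (hint hW).integrableOn (hint hV).integrableOn, Finset.sum_sub_distrib, heq s,
      hVdef, linearSolution_eq hf hC hJ s, ← hVdef]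
    ring

end LinearEquation

/-! ### Jumps and wealth -/

lemma setIntegral_sum_dirac {α : Type*} [MeasurableSpace α] [MeasurableSingletonClass α]
    (A : Finset α) {S : Set α} [DecidablePred (· ∈ S)] (hS : MeasurableSet S) (φ : α → ℝ) :
    ∫ x in S, φ x ∂(∑ x ∈ A, Measure.dirac x) = ∑ x ∈ A with x ∈ S, φ x := by
  rw [← integral_indicator hS, integral_finsetSum_measure fun x _ => integrable_dirac (by simp),
    Finset.sum_filter]
  refine Finset.sum_congr rfl fun x _ => ?_
  rw [integral_dirac, Set.indicator_apply]

lemma rightCont_le_of_isRightContinuous {Ω ι : Type*} [LinearOrder ι] {mΩ : MeasurableSpace Ω}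
    {F G : Filtration ι mΩ} (h : F ≤ G) (hG : G.IsRightContinuous) : F.rightCont ≤ G := by
  refine le_trans (fun i => ?_) hG.RC
  let : TopologicalSpace ι := Preorder.topology ι
  have : OrderTopology ι := ⟨rfl⟩
  rw [Filtration.rightCont_apply, Filtration.rightCont_apply]
  split_ifs
  · exact iInf₂_mono fun j _ => h j
  · exact h i

lemma measurable_predictable_time {a b : ℝ} [Fact (a ≤ b)] {Ω : Type*} {mΩ : MeasurableSpace Ω}
    (F : Filtration (Set.Icc a b) mΩ) :
    Measurable[F.predictable] fun x : Set.Icc a b × Ω => (x.1 : ℝ) := by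
  have h := measurable_predictable_leftLim (F := F) (X := fun s (_ : Ω) => (s : ℝ))
    (fun s => measurable_const) (fun _ => isCadlag_of_continuous continuous_subtype_val)
  simpa only [leftLim_of_continuous continuous_subtype_val] using h

namespace Market.Model

variable {K : ℕ} {M : Market K} {t₀ : ℝ} [Fact (t₀ ≤ M.T)] {p : Fin K → ℝ} {S₀ : ℝ}
  {Ω : Type*} [mΩ : MeasurableSpace Ω] {P : Measure Ω} (X : M.Model t₀ p S₀ P)

/-- `S` is adapted to `F`, and `F` already satisfies the usual conditions, so completing the
observed filtration does not leave it. Observable strategies are thus predictable for the filtration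
relative to which `N` is Poisson. -/
lemma FS_le : X.FS ≤ X.F := by
  refine rightCont_le_of_isRightContinuous (fun s => sup_le ?_ ?_) X.usual.rightCont
  · exact iSup₂_le fun j hj => (measurable_iff_comap_le.1 (X.S_adapted j).measurable).trans
      (X.F.mono hj)
  · exact MeasurableSpace.generateFrom_le fun A hA => X.usual.null_mem s A hA.1 hA.2

/-- The jump `G(u, Y_{u-}, ζ)` of the return process at a point `(u, ζ)` of the Poisson random
measure. -/
def jumpSize (ω : Ω) (x : Set.Icc t₀ M.T × M.Z) : ℝ :=
  M.G x.1 (Function.leftLim (fun r => X.Y r ω) x.1) x.2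

lemma measurable_jumpSize : Measurable[@Prod.instMeasurableSpace _ _ X.F.predictable _]
    fun y : (Set.Icc t₀ M.T × Ω) × M.Z => X.jumpSize y.1.2 (y.1.1, y.2) := by
  have hY : Measurable[X.F.predictable]
      fun x : Set.Icc t₀ M.T × Ω => Function.leftLim (fun r => X.Y r x.2) x.1 :=
    measurable_predictable_leftLim X.Y_adapted X.Y_cadlag
  have ht := measurable_predictable_time X.F
  let : MeasurableSpace (Set.Icc t₀ M.T × Ω) := X.F.predictable
  exact M.G_measurable.comp ((ht.comp measurable_fst).prodMk
    ((hY.comp measurable_fst).prodMk measurable_snd))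

/-! ### The return process on an event with finitely many Poisson points -/

section Path

variable {X} {ω : Ω} {A : Finset (Set.Icc t₀ M.T × M.Z)}

/-- The sum of the jumps at time `u` of the points in `A`. -/
def jumpAt (X : M.Model t₀ p S₀ P) (ω : Ω) (A : Finset (Set.Icc t₀ M.T × M.Z))
    (u : Set.Icc t₀ M.T) : ℝ :=
  ∑ x ∈ A with x.1 = u, X.jumpSize ω x

lemma jumpAt_fst (hinj : Set.InjOn Prod.fst (A : Set (Set.Icc t₀ M.T × M.Z)))
    {x : Set.Icc t₀ M.T × M.Z} (hx : x ∈ A) : jumpAt X ω A x.1 = X.jumpSize ω x := by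
  have : A.filter (fun y => y.1 = x.1) = {x} := by
    ext y
    simp only [Finset.mem_filter, Finset.mem_singleton]
    exact ⟨fun h => hinj h.1 hx h.2, by rintro rfl; exact ⟨hx, rfl⟩⟩
  rw [jumpAt, this, Finset.sum_singleton]

lemma jumpAt_of_notMem {u : Set.Icc t₀ M.T} (hu : u ∉ A.image Prod.fst) :
    jumpAt X ω A u = 0 := by
  rw [jumpAt, Finset.filter_eq_empty_iff.2, Finset.sum_empty]
  exact fun x hx hxu => hu (Finset.mem_image.2 ⟨x, hx, hxu⟩)

lemma sum_image_fst (hinj : Set.InjOn Prod.fst (A : Set (Set.Icc t₀ M.T × M.Z)))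
    (φ : Set.Icc t₀ M.T → ℝ → ℝ) (s : Set.Icc t₀ M.T) :
    ∑ u ∈ A.image Prod.fst with u ≤ s, φ u (jumpAt X ω A u) =
      ∑ x ∈ A with x.1 ≤ s, φ x.1 (X.jumpSize ω x) := by
  rw [Finset.filter_image, Finset.sum_image fun x hx y hy h =>
    hinj (Finset.mem_filter.1 hx).1 (Finset.mem_filter.1 hy).1 h]
  exact Finset.sum_congr rfl fun x hx => by rw [jumpAt_fst hinj (Finset.mem_filter.1 hx).1]

variable (hinj : Set.InjOn Prod.fst (A : Set (Set.Icc t₀ M.T × M.Z))) (hpos : ∀ x ∈ A, ⊥ < x.1)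
  (hN : X.N ω = ∑ x ∈ A, Measure.dirac x)

include hinj hpos hN

lemma R_eq (s : Set.Icc t₀ M.T) :
    X.R s ω = ∑ u ∈ A.image Prod.fst with u ≤ s, jumpAt X ω A u := by
  classical
  rw [sum_image_fst hinj (fun _ z => z) s, R, hN,
    setIntegral_sum_dirac A (measurableSet_Ioc.prod .univ)]
  refine Finset.sum_congr (Finset.filter_congr fun x hx => ?_) fun x _ => rfl
  simp [hpos x hx]

lemma jumpR_eq (s : Set.Icc t₀ M.T) : X.jumpR s ω = jumpAt X ω A s := by
  have hJ : ∀ u ∈ A.image Prod.fst, (⊥ : Set.Icc t₀ M.T) < u := by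
    intro u hu
    obtain ⟨x, hx, rfl⟩ := Finset.mem_image.1 hu
    exact hpos x hx
  have hfun : (fun r => X.R r ω) = fun r => (fun S : Finset (Set.Icc t₀ M.T) =>
      ∑ u ∈ S, jumpAt X ω A u) ((A.image Prod.fst).filter (· ≤ r)) :=
    funext (R_eq hinj hpos hN)
  rw [jumpR, hfun, leftLim_comp_filter _ hJ fun S : Finset (Set.Icc t₀ M.T) =>
      ∑ u ∈ S, jumpAt X ω A u, R_eq hinj hpos hN]
  by_cases hs : s ∈ A.image Prod.fst
  · have : (A.image Prod.fst).filter (· ≤ s) = insert s ((A.image Prod.fst).filter (· < s)) := by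
      ext u
      simp only [Finset.mem_filter, Finset.mem_insert]
      constructor
      · rintro ⟨h1, h2⟩
        exact h2.eq_or_lt.imp id fun h => ⟨h1, h⟩
      · rintro (rfl | ⟨h1, h2⟩)
        · exact ⟨hs, le_rfl⟩
        · exact ⟨h1, h2.le⟩
    rw [this, Finset.sum_insert (by simp)]
    ring
  · rw [jumpAt_of_notMem hs, sub_eq_zero]
    congr 1
    refine Finset.filter_congr fun u hu => ⟨fun h => lt_of_le_of_ne h ?_, le_of_lt⟩
    rintro rfl
    exact hs hu

lemma μ_eq : X.μ ω = ∑ y ∈ ((A.image Prod.fst).filter fun u => jumpAt X ω A u ≠ 0).image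
    (fun u => (u, jumpAt X ω A u)), Measure.dirac y := by
  rw [Finset.sum_image fun u _ v _ h => congrArg Prod.fst h]
  ext B hB
  rw [μ, Measure.sum_apply _ hB]
  have hset : ∀ s, s ∈ {s | X.jumpR s ω ≠ 0} ↔ jumpAt X ω A s ≠ 0 := fun s => by
    rw [← jumpR_eq hinj hpos hN]; rfl
  refine (tsum_subtype {s | X.jumpR s ω ≠ 0}
    (fun s => (Measure.dirac (s, X.jumpR s ω) : Measure (Set.Icc t₀ M.T × ℝ)) B)).trans ?_
  rw [tsum_eq_sum (s := (A.image Prod.fst).filter fun u => jumpAt X ω A u ≠ 0)]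
  · rw [Measure.finsetSum_apply]
    refine Finset.sum_congr rfl fun u hu => ?_
    rw [Set.indicator_of_mem ((hset u).2 (Finset.mem_filter.1 hu).2), jumpR_eq hinj hpos hN]
  · intro u hu
    refine Set.indicator_of_notMem (fun h => hu ?_) _
    refine Finset.mem_filter.2 ⟨?_, (hset u).1 h⟩
    by_contra hu'
    exact (hset u).1 h (jumpAt_of_notMem hu')

/-- The jump measure does not see Poisson points with jump size zero. Integrands vanishing at `0`
allow the sum over all Poisson times, the same index set as for integrals against `N`. -/
lemma setIntegral_μ (s : Set.Icc t₀ M.T) (φ : Set.Icc t₀ M.T → ℝ → ℝ) (hφ : ∀ u, φ u 0 = 0) :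
    ∫ x in Set.Ioc ⊥ s ×ˢ Set.univ, φ x.1 x.2 ∂(X.μ ω) =
      ∑ u ∈ A.image Prod.fst with u ≤ s, φ u (jumpAt X ω A u) := by
  classical
  rw [μ_eq hinj hpos hN, setIntegral_sum_dirac _ (measurableSet_Ioc.prod .univ),
    Finset.sum_filter, Finset.sum_image fun u _ v _ h => congrArg Prod.fst h, Finset.sum_filter,
    Finset.sum_filter]
  refine Finset.sum_congr rfl fun u hu => ?_
  obtain ⟨x, hx, rfl⟩ := Finset.mem_image.1 hu
  have := hpos x hx
  by_cases h0 : jumpAt X ω A x.1 = 0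
  · simp [h0, hφ]
  · simp [h0, this]

omit hpos in
lemma integral_N (φ : Set.Icc t₀ M.T → ℝ → ℝ) :
    ∫ x, φ x.1 (X.jumpSize ω x) ∂(X.N ω) =
      ∑ u ∈ A.image Prod.fst, φ u (jumpAt X ω A u) := by
  classical
  have h := sum_image_fst (X := X) (ω := ω) hinj φ ⊤
  simp only [le_top, Finset.filter_true] at h
  rw [h, hN, ← setIntegral_univ, setIntegral_sum_dirac _ .univ]
  simp

end Path

variable [IsProbabilityMeasure P]

/-- Positions that keep the wealth positive have only jumps above `-1` at the points of the
Poisson random measure. -/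
lemma ae_one_add_mul_jumpSize_pos {h : Set.Icc t₀ M.T → Ω → ℝ}
    (hh : IsStronglyPredictable X.FS h) (hpos : X.KeepsWealthPositive h) :
    ∀ᵐ ω ∂P, X.N ω {x | 1 + h x.1 ω * X.jumpSize ω x ≤ 0} = 0 := by
  have hN := X.poisson
  have hhF : Measurable[X.F.predictable] (Function.uncurry h) :=
    (hh.mono (predictable_mono X.FS_le)).measurable
  set D : Set ((Set.Icc t₀ M.T × Ω) × M.Z) :=
    {y | 1 + h y.1.1 y.1.2 * X.jumpSize y.1.2 (y.1.1, y.2) ≤ 0} with hD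
  have hDm : MeasurableSet[@Prod.instMeasurableSpace _ _ X.F.predictable _] D := by
    let : MeasurableSpace (Set.Icc t₀ M.T × Ω) := X.F.predictable
    have h1 : Measurable fun y : (Set.Icc t₀ M.T × Ω) × M.Z => h y.1.1 y.1.2 :=
      hhF.comp measurable_fst
    exact measurableSet_le (measurable_const.add (h1.mul X.measurable_jumpSize)) measurable_const
  have hDm' : MeasurableSet D := IsPoissonRandomMeasure.predictable_prod_le X.F D hDm
  have hzero : (((timeMeasure t₀ M.T).prod P).prod M.ς) D = 0 := by
    rw [Measure.measure_prod_null hDm']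
    filter_upwards [Measure.quasiMeasurePreserving_snd.ae (μa := (timeMeasure t₀ M.T).prod P) hpos]
      with x hx
    -- The positivity condition holds for all states and times at once, hence also for the random
    -- state just before the jump.
    set i := Function.leftLim (fun r => X.Y r x.2) x.1 with hi
    have h1 := hx x.1 i
    have hG : Measurable (M.G x.1 i) :=
      M.G_measurable.comp (measurable_const.prodMk (measurable_const.prodMk measurable_id))
    have hS : MeasurableSet {z : ℝ | 1 + h x.1 x.2 * z ≤ 0} :=
      measurableSet_le (by fun_prop) measurable_const
    have h2 : M.η x.1 i {z | 1 + h x.1 x.2 * z ≤ 0} = 0 :=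
      measure_mono_null (fun z (hz : _ ≤ _) => (⟨x.1, hz⟩ : ∃ s, 1 + h s x.2 * z ≤ 0)) h1
    have h0 : {z : ℝ | 1 + h x.1 x.2 * z ≤ 0} ⊆ {0}ᶜ := by
      intro z (hz : 1 + h x.1 x.2 * z ≤ 0) (hz0 : z = 0)
      rw [hz0, mul_zero] at hz
      linarith
    rw [Market.η, Measure.restrict_apply hS, Set.inter_eq_left.2 h0, Measure.map_apply hG hS] at h2
    exact h2
  exact hN.ae_measure_eq_zero hDm hzero

/-- On the event `ω` the return process has finitely many jumps, at each of which the strategy `h`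
keeps wealth positive. -/
def HasFinitelyManyJumps (h : Set.Icc t₀ M.T → Ω → ℝ) (ω : Ω) : Prop :=
  ∃ (J : Finset (Set.Icc t₀ M.T)) (r : Set.Icc t₀ M.T → ℝ),
      (∀ u ∈ J, ⊥ < u) ∧ (∀ u ∈ J, 0 < 1 + h u ω * r u) ∧
      (∀ (s : Set.Icc t₀ M.T) (φ : Set.Icc t₀ M.T → ℝ → ℝ), (∀ u, φ u 0 = 0) →
        ∫ x in Set.Ioc ⊥ s ×ˢ Set.univ, φ x.1 x.2 ∂(X.μ ω) = ∑ u ∈ J with u ≤ s, φ u (r u)) ∧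
      (∀ φ : Set.Icc t₀ M.T → ℝ → ℝ,
        ∫ x, φ x.1 (X.jumpSize ω x) ∂(X.N ω) = ∑ u ∈ J, φ u (r u))

/-- Almost surely the wealth equation of an admissible strategy is a linear equation with finitely
many jumps. -/
lemma ae_wealth_structure {h : Set.Icc t₀ M.T → Ω → ℝ} (hh : X.IsAdmissible h) :
    ∀ᵐ ω ∂P, X.HasFinitelyManyJumps h ω := by
  filter_upwards [X.poisson.ae_exists_finset,
    X.ae_one_add_mul_jumpSize_pos hh.predictable hh.positive] with ω ⟨A, hinj, hpos, hN⟩ h0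
  refine ⟨A.image Prod.fst, jumpAt X ω A, ?_, ?_, fun s φ hφ => setIntegral_μ hinj hpos hN s φ hφ,
    fun φ => integral_N hinj hN φ⟩
  · intro u hu
    obtain ⟨x, hx, rfl⟩ := Finset.mem_image.1 hu
    exact hpos x hx
  · intro u hu
    obtain ⟨x, hx, rfl⟩ := Finset.mem_image.1 hu
    rw [jumpAt_fst hinj hx]
    by_contra hneg
    have hmem : x ∈ {x | 1 + h x.1 ω * X.jumpSize ω x ≤ 0} := not_lt.1 hneg
    have h1 : X.N ω {x} = 0 := measure_mono_null (Set.singleton_subset_iff.2 hmem) h0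
    rw [hN, Measure.finsetSum_apply] at h1
    have h2 := Finset.sum_eq_zero_iff.1 h1 x hx
    simp at h2

omit [IsProbabilityMeasure P] in
lemma measurable_strategy {h : Set.Icc t₀ M.T → Ω → ℝ}
    (hh : IsStronglyPredictable X.FS h) : Measurable (Function.uncurry h) :=
  hh.measurable.mono (predictable_le_prod X.FS) le_rfl

/-- The logarithm of terminal wealth. -/
lemma ae_log_wealth {w : ℝ} (hw : 0 < w) {h W : Set.Icc t₀ M.T → Ω → ℝ}
    (hh : X.IsAdmissible h) (hW : X.IsWealth w h W) :
    ∀ᵐ ω ∂P, Real.log (W ⊤ ω) = Real.log w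
      + ∫ s, (1 - h s ω) * M.ρ ∂(timeMeasure t₀ M.T)
      + ∫ x, Real.log (1 + h x.1 ω * X.jumpSize ω x) ∂(X.N ω) := by
  filter_upwards [X.ae_wealth_structure hh, hW.eq, hh.bounded] with ω ⟨J, r, hJ, hr, hμ, hN⟩ hWω hb
  have hm : Measurable fun s => h s ω :=
    (X.measurable_strategy hh.predictable).comp (measurable_id.prodMk measurable_const)
  have hbd : ∀ s, |(1 - h s ω) * M.ρ| ≤ (1 + M.L) * M.ρ := fun s => by
    rw [abs_mul, abs_of_pos M.ρ_pos]
    refine mul_le_mul_of_nonneg_right (abs_le.2 ⟨?_, ?_⟩) M.ρ_pos.le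
    · linarith [(hb s).2]
    · linarith [(hb s).1]
  have heq := eq_linearSolution (w := w) (f := fun s => (1 - h s ω) * M.ρ) (J := J)
    (c := fun u => h u ω * r u) (by fun_prop) hbd hJ (hW.cadlag ω) (fun s => by
      rw [hWω s, hμ s (fun u z => Function.leftLim (fun r => W r ω) u * (h u ω * z)) (by simp)]) ⊤
  rw [heq, linearSolution, hN fun u z => Real.log (1 + h u ω * z)]
  simp only [le_top, Finset.filter_true]
  rw [Real.log_mul (by positivity) (Finset.prod_ne_zero_iff.2 fun u hu => (hr u hu).ne'),
    Real.log_mul hw.ne' (Real.exp_pos _).ne', Real.log_exp,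
    Real.log_prod fun u hu => (hr u hu).ne', primitive]
  congr 2
  -- The primitive integrates over `Ioc ⊥ ⊤` and the claim over all times; they differ by the null
  -- point `⊥`.
  have h0 : ∀ᵐ s : Set.Icc t₀ M.T ∂(timeMeasure t₀ M.T), s ≠ ⊥ := by
    rw [ae_iff]; simp
  rw [Measure.restrict_eq_self_of_ae_mem]
  filter_upwards [h0] with s hs
  exact ⟨bot_lt_iff_ne_bot.2 hs, le_top⟩

/-- Admissible strategies have a wealth process. -/
lemma exists_isWealth (w : ℝ) {h : Set.Icc t₀ M.T → Ω → ℝ} (hh : X.IsAdmissible h) :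
    ∃ W, X.IsWealth w h W := by
  classical
  have hae := (X.ae_wealth_structure hh).and hh.bounded
  have hm : ∀ ω, Measurable fun s => h s ω := fun ω =>
    (X.measurable_strategy hh.predictable).comp (measurable_id.prodMk measurable_const)
  -- Paths must be càdlàg for every `ω`, whereas the equation is solvable only on the good event.
  -- Elsewhere the zero path is used. The paths can be chosen separately because wealth is defined
  -- pathwise.
  have key : ∀ ω, ∃ V : Set.Icc t₀ M.T → ℝ, IsCadlag V ∧
      ((X.HasFinitelyManyJumps h ω ∧
        ∀ s, h s ω ∈ Set.Icc (-M.L) M.L) → ∀ s, V s = w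
      + (∫ u in Set.Ioc ⊥ s, Function.leftLim V u * ((1 - h u ω) * M.ρ)
        ∂(timeMeasure t₀ M.T))
      + ∫ x in Set.Ioc ⊥ s ×ˢ Set.univ,
        Function.leftLim V x.1 * (h x.1 ω * x.2) ∂(X.μ ω)) := by
    intro ω
    by_cases hω : X.HasFinitelyManyJumps h ω ∧
        ∀ s, h s ω ∈ Set.Icc (-M.L) M.L
    · obtain ⟨⟨J, r, hJ, -, hμ, -⟩, hb⟩ := hω
      have hbd : ∀ s, |(1 - h s ω) * M.ρ| ≤ (1 + M.L) * M.ρ := fun s => by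
        rw [abs_mul, abs_of_pos M.ρ_pos]
        refine mul_le_mul_of_nonneg_right (abs_le.2 ⟨?_, ?_⟩) M.ρ_pos.le
        · linarith [(hb s).2]
        · linarith [(hb s).1]
      have hfm : Measurable fun s => (1 - h s ω) * M.ρ := by
        have := hm ω
        fun_prop
      refine ⟨linearSolution w (fun s => (1 - h s ω) * M.ρ) J fun u => h u ω * r u,
        isCadlag_linearSolution hfm hbd, fun _ s => ?_⟩
      rw [hμ s (fun u z => Function.leftLim (linearSolution w (fun s => (1 - h s ω) * M.ρ) J
        fun u => h u ω * r u) u * (h u ω * z)) (by simp)]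
      exact linearSolution_eq hfm hbd hJ s
    · exact ⟨fun _ => 0, isCadlag_of_continuous continuous_const, fun h => absurd h hω⟩
  choose V hV using key
  refine ⟨fun s ω => V ω s, fun ω => (hV ω).1, ?_⟩
  filter_upwards [hae] with ω hω
  exact (hV ω).2 hω

end Market.Model

/-! ### Projection onto the information of the investor -/

/-- Almost everywhere in time and chance, a càdlàg process agrees with its left limit. -/
lemma ae_leftLim_eq {a b : ℝ} [Fact (a ≤ b)] {Ω β : Type*} {mΩ : MeasurableSpace Ω}
    {P : Measure Ω} [SFinite P] [TopologicalSpace β] [TopologicalSpace.MetrizableSpace β]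
    [MeasurableSpace β] [BorelSpace β] [MeasurableEq β] {X : Set.Icc a b → Ω → β}
    (hX : ∀ s, Measurable (X s)) (hc : ∀ ω, IsCadlag fun s => X s ω) :
    ∀ᵐ x ∂((timeMeasure a b).prod P), Function.leftLim (fun s => X s x.2) x.1 = X x.1 x.2 := by
  have hpred : Measurable fun x : Set.Icc a b × Ω => Function.leftLim (fun s => X s x.2) x.1 :=
    (measurable_predictable_leftLim (F := ⊤) (fun s => hX s) hc).mono (predictable_le_prod _) le_rfl
  have hset : MeasurableSet {x : Set.Icc a b × Ω |
      Function.leftLim (fun s => X s x.2) x.1 = X x.1 x.2} :=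
    measurableSet_eq_fun hpred (measurable_uncurry_of_cadlag hX hc)
  -- Each single path jumps at countably many times, which form a Lebesgue null set. Exchanging the
  -- order of time and chance makes this applicable.
  rw [Measure.ae_prod_iff_ae_ae hset, Measure.ae_ae_comm hset]
  exact Eventually.of_forall fun ω => (hc ω).countable_leftLim_ne.ae_notMem _ |>.mono
    fun s hs => not_not.1 hs

lemma measurable_section_of_predictable {a b : ℝ} [Fact (a ≤ b)] {Ω β : Type*}
    {mΩ : MeasurableSpace Ω} [MeasurableSpace β] {F : Filtration (Set.Icc a b) mΩ}
    {φ : Set.Icc a b × Ω → β} (hφ : Measurable[F.predictable] φ) (s : Set.Icc a b) :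
    Measurable[F s] fun ω => φ (s, ω) := by
  have h1 := measurable_inclusion_predictable (𝓕 := F) (i := s)
  let : MeasurableSpace (Set.Icc a b × Ω) := F.predictable
  let : MeasurableSpace Ω := F s
  have h2 : Measurable fun ω : Ω => ((⟨s, Set.self_mem_Iic⟩ : Set.Iic s), ω) := by fun_prop
  exact hφ.comp (h1.comp h2)

namespace Market

variable {K : ℕ} {M : Market K}

lemma measurable_G (t : ℝ) (i : Fin K) : Measurable (M.G t i) :=
  M.G_measurable.comp (measurable_const.prodMk (measurable_const.prodMk measurable_id))

lemma lintegral_η (t : ℝ) (i : Fin K) {f : ℝ → ℝ≥0∞} (hf : Measurable f) (h0 : f 0 = 0) :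
    ∫⁻ z, f z ∂(M.η t i) = ∫⁻ ζ, f (M.G t i ζ) ∂M.ς := by
  have h1 : ({0}ᶜ : Set ℝ).indicator f = f :=
    Set.indicator_eq_self.2 fun z hz (h : z = 0) => hz (by rw [h, h0])
  rw [η, ← lintegral_indicator (measurableSet_singleton 0).compl, h1, lintegral_map hf (measurable_G t i)]

lemma integral_η (t : ℝ) (i : Fin K) {f : ℝ → ℝ} (hf : Measurable f) (h0 : f 0 = 0) :
    ∫ z, f z ∂(M.η t i) = ∫ ζ, f (M.G t i ζ) ∂M.ς := by
  rw [η, setIntegral_eq_integral_of_forall_compl_eq_zero, integral_map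
    (measurable_G t i).aemeasurable hf.aestronglyMeasurable]
  intro z hz
  rw [not_not.1 hz, h0]

namespace Model

variable {t₀ : ℝ} [Fact (t₀ ≤ M.T)] {p : Fin K → ℝ} {S₀ : ℝ}
  {Ω : Type*} [mΩ : MeasurableSpace Ω] {P : Measure Ω} [IsProbabilityMeasure P]
  {X : M.Model t₀ p S₀ P} {π : Set.Icc t₀ M.T → Ω → Fin K → ℝ}

omit [IsProbabilityMeasure P] in
lemma measurable_Y (X : M.Model t₀ p S₀ P) (s : Set.Icc t₀ M.T) : Measurable (X.Y s) :=
  (X.Y_adapted s).mono (X.F.le s) le_rfl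

omit [IsProbabilityMeasure P] in
lemma IsFilter.measurable (hπ : X.IsFilter π) (s : Set.Icc t₀ M.T) : Measurable (π s) :=
  (hπ.adapted s).measurable.mono (X.FS.le s) le_rfl

/-- By the definition of conditional probability, `P` restricted to `{Y_s = e_i}` and `P` with
density `π_s^i` agree on `FS s`. Equal trimmed measures have equal integrals of all nonnegative
observable functions, with no integrability needed. -/
lemma IsFilter.setLIntegral_state (hπ : X.IsFilter π) (s : Set.Icc t₀ M.T) (i : Fin K)
    {φ : Ω → ℝ≥0∞} (hφ : Measurable[X.FS s] φ) :
    ∫⁻ ω in {ω | X.Y s ω = i}, φ ω ∂P = ∫⁻ ω, ENNReal.ofReal (π s ω i) * φ ω ∂P := by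
  have hle := X.FS.le s
  have hE : MeasurableSet {ω | X.Y s ω = i} := X.measurable_Y s (measurableSet_singleton i)
  have hπm : Measurable fun ω => π s ω i := (measurable_pi_apply i).comp (hπ.measurable s)
  have hbd : Integrable (fun ω => π s ω i) P := by
    refine Integrable.of_bound hπm.aestronglyMeasurable 1 (Eventually.of_forall fun ω => ?_)
    rw [Real.norm_eq_abs, abs_of_nonneg ((hπ.mem_simplex s ω).1 i)]
    exact (Finset.single_le_sum (fun j _ => (hπ.mem_simplex s ω).1 j) (Finset.mem_univ i)).trans
      (hπ.mem_simplex s ω).2.le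
  have htrim : (P.restrict {ω | X.Y s ω = i}).trim hle =
      (P.withDensity fun ω => ENNReal.ofReal (π s ω i)).trim hle := by
    refine @Measure.ext _ (X.FS s) _ _ fun A hA => ?_
    have hA' := hle A hA
    rw [trim_measurableSet_eq hle hA, trim_measurableSet_eq hle hA, Measure.restrict_apply hA',
      withDensity_apply _ hA', ← ofReal_integral_eq_lintegral_ofReal hbd.integrableOn
        (Eventually.of_forall fun ω => (hπ.mem_simplex s ω).1 i)]
    have h1 : ∫ ω in A, π s ω i ∂P =
        ∫ ω in A, Set.indicator {ω | X.Y s ω = i} (fun _ => (1 : ℝ)) ω ∂P := by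
      rw [setIntegral_congr_ae hA' ((hπ.condExp s i).mono fun ω h _ => h)]
      exact setIntegral_condExp hle ((integrable_const 1).indicator hE) hA
    rw [h1, setIntegral_indicator hE, setIntegral_const, smul_eq_mul, mul_one, measureReal_def,
      ENNReal.ofReal_toReal (measure_ne_top _ _)]
  rw [← lintegral_trim hle hφ, htrim, lintegral_trim hle hφ,
    lintegral_withDensity_eq_lintegral_mul _ hπm.ennreal_ofReal (hφ.mono hle le_rfl)]
  rfl

/-- A quantity that depends on the left limit of the chain and on observable data has the same
mean as its projection by means of the filter. -/
lemma IsFilter.lintegral_leftLim_state (hπ : X.IsFilter π)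
    {φ : Fin K → Set.Icc t₀ M.T × Ω → ℝ≥0∞} (hφ : ∀ i, Measurable[X.FS.predictable] (φ i)) :
    ∫⁻ x, φ (Function.leftLim (fun r => X.Y r x.2) x.1) x ∂((timeMeasure t₀ M.T).prod P) =
      ∫⁻ x, ∑ i, ENNReal.ofReal (π x.1 x.2 i) * φ i x ∂((timeMeasure t₀ M.T).prod P) := by
  have hφm : ∀ i, Measurable (φ i) := fun i => (hφ i).mono (predictable_le_prod _) le_rfl
  have hY := measurable_uncurry_of_cadlag X.measurable_Y X.Y_cadlag
  have hπm := measurable_uncurry_of_cadlag hπ.measurable hπ.cadlag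
  have h1 : ∫⁻ x, φ (Function.leftLim (fun r => X.Y r x.2) x.1) x ∂((timeMeasure t₀ M.T).prod P) =
      ∫⁻ x, ∑ i, {x : Set.Icc t₀ M.T × Ω | X.Y x.1 x.2 = i}.indicator (φ i) x
        ∂((timeMeasure t₀ M.T).prod P) := by
    refine lintegral_congr_ae ?_
    -- The filter describes `Y_s` and the jump size involves `Y_{s-}`; they agree for almost every
    -- time.
    filter_upwards [ae_leftLim_eq (P := P) X.measurable_Y X.Y_cadlag] with x hx
    rw [hx, Finset.sum_eq_single (X.Y x.1 x.2)]
    · rw [Set.indicator_of_mem]; rfl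
    · intro j _ hj
      exact Set.indicator_of_notMem (fun h => hj h.symm) _
    · simp
  have hset : ∀ i, MeasurableSet {x : Set.Icc t₀ M.T × Ω | X.Y x.1 x.2 = i} := fun i =>
    hY (measurableSet_singleton i)
  have hπi : ∀ i, Measurable fun x : Set.Icc t₀ M.T × Ω => ENNReal.ofReal (π x.1 x.2 i) := fun i =>
    ((measurable_pi_apply i).comp hπm).ennreal_ofReal
  rw [h1, lintegral_finsetSum _ fun i _ => (hφm i).indicator (hset i),
    lintegral_finsetSum (f := fun i x => ENNReal.ofReal (π x.1 x.2 i) * φ i x) _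
      fun i _ => (hπi i).mul (hφm i)]
  refine Finset.sum_congr rfl fun i _ => ?_
  rw [lintegral_prod _ ((hφm i).indicator (hset i)).aemeasurable,
    lintegral_prod (fun x => ENNReal.ofReal (π x.1 x.2 i) * φ i x)
      ((hπi i).mul (hφm i)).aemeasurable]
  refine lintegral_congr fun s => ?_
  have h2 := hπ.setLIntegral_state s i (measurable_section_of_predictable (hφ i) s)
  have h3 : MeasurableSet {ω | X.Y s ω = i} := X.measurable_Y s (measurableSet_singleton i)
  rw [← h2, ← lintegral_indicator h3]
  rfl

omit [IsProbabilityMeasure P] in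
lemma measurable_mark (i : Fin K) :
    Measurable[@Prod.instMeasurableSpace _ _ X.FS.predictable _,
      @Prod.instMeasurableSpace _ _ X.FS.predictable _]
    fun y : (Set.Icc t₀ M.T × Ω) × M.Z => (y.1, M.G y.1.1 i y.2) := by
  have ht := measurable_predictable_time X.FS
  let : MeasurableSpace (Set.Icc t₀ M.T × Ω) := X.FS.predictable
  exact measurable_fst.prodMk (M.G_measurable.comp ((ht.comp measurable_fst).prodMk
    (measurable_const.prodMk measurable_snd)))

omit [IsProbabilityMeasure P] in
lemma measurable_jump_mark : Measurable fun y : (Set.Icc t₀ M.T × Ω) × M.Z =>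
    (y.1, X.jumpSize y.1.2 (y.1.1, y.2)) :=
  measurable_fst.prodMk
    (X.measurable_jumpSize.mono (IsPoissonRandomMeasure.predictable_prod_le X.F) le_rfl)

/-- The mean of an observable function of the jumps, expressed by means of the filter. -/
lemma IsFilter.lintegral_jumpSize (hπ : X.IsFilter π)
    {Ψ : (Set.Icc t₀ M.T × Ω) × ℝ → ℝ≥0∞}
    (hΨ : Measurable[@Prod.instMeasurableSpace _ _ X.FS.predictable _] Ψ)
    (h0 : ∀ x, Ψ (x, 0) = 0) :
    ∫⁻ y, Ψ (y.1, X.jumpSize y.1.2 (y.1.1, y.2)) ∂(((timeMeasure t₀ M.T).prod P).prod M.ς) =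
      ∫⁻ x, ∑ i, ENNReal.ofReal (π x.1 x.2 i) * ∫⁻ z, Ψ (x, z) ∂(M.η x.1 i)
        ∂((timeMeasure t₀ M.T).prod P) := by
  have hΨm : Measurable Ψ := hΨ.mono (sup_le_sup
    (MeasurableSpace.comap_mono (predictable_le_prod X.FS)) le_rfl) le_rfl
  have hη : ∀ (x : Set.Icc t₀ M.T × Ω) (i : Fin K), ∫⁻ z, Ψ (x, z) ∂(M.η x.1 i) =
      ∫⁻ ζ, Ψ (x, M.G x.1 i ζ) ∂M.ς := fun x i =>
    lintegral_η (f := fun z => Ψ (x, z)) _ i (hΨm.comp measurable_prodMk_left) (h0 x)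
  simp_rw [hη]
  rw [← hπ.lintegral_leftLim_state (φ := fun i x => ∫⁻ ζ, Ψ (x, M.G x.1 i ζ) ∂M.ς) ?_,
    lintegral_prod (fun y => Ψ (y.1, X.jumpSize y.1.2 (y.1.1, y.2)))
      (hΨm.comp measurable_jump_mark).aemeasurable]
  · rfl
  · intro i
    have h := measurable_mark (X := X) i
    let : MeasurableSpace (Set.Icc t₀ M.T × Ω) := X.FS.predictable
    exact (hΨ.comp h).lintegral_prod_right'

/-- The mean of a signed observable function of the jumps, expressed by means of the filter. -/
lemma IsFilter.integral_jumpSize (hπ : X.IsFilter π)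
    {Φ : (Set.Icc t₀ M.T × Ω) × ℝ → ℝ}
    (hΦ : Measurable[@Prod.instMeasurableSpace _ _ X.FS.predictable _] Φ)
    (h0 : ∀ x, Φ (x, 0) = 0)
    (hfin : ∫⁻ x, ∑ i, ENNReal.ofReal (π x.1 x.2 i) * ∫⁻ z, ‖Φ (x, z)‖ₑ ∂(M.η x.1 i)
        ∂((timeMeasure t₀ M.T).prod P) ≠ ∞) :
    Integrable (fun y : (Set.Icc t₀ M.T × Ω) × M.Z => Φ (y.1, X.jumpSize y.1.2 (y.1.1, y.2)))
      (((timeMeasure t₀ M.T).prod P).prod M.ς) ∧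
    (∀ᵐ x ∂((timeMeasure t₀ M.T).prod P), ∀ i, π x.1 x.2 i ≠ 0 →
      Integrable (fun z => Φ (x, z)) (M.η x.1 i)) ∧
    Integrable (fun x => ∑ i, π x.1 x.2 i * ∫ z, Φ (x, z) ∂(M.η x.1 i))
      ((timeMeasure t₀ M.T).prod P) ∧
    ∫ y, Φ (y.1, X.jumpSize y.1.2 (y.1.1, y.2)) ∂(((timeMeasure t₀ M.T).prod P).prod M.ς) =
      ∫ x, ∑ i, π x.1 x.2 i * ∫ z, Φ (x, z) ∂(M.η x.1 i) ∂((timeMeasure t₀ M.T).prod P) := by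
  have hΦm : Measurable Φ := hΦ.mono (sup_le_sup
    (MeasurableSpace.comap_mono (predictable_le_prod X.FS)) le_rfl) le_rfl
  have hπm := measurable_uncurry_of_cadlag hπ.measurable hπ.cadlag
  have hπi : ∀ i, Measurable fun x : Set.Icc t₀ M.T × Ω => π x.1 x.2 i := fun i =>
    (measurable_pi_apply i).comp hπm
  have hπ0 : ∀ (x : Set.Icc t₀ M.T × Ω) i, 0 ≤ π x.1 x.2 i := fun x i =>
    (hπ.mem_simplex x.1 x.2).1 i
  have hsec : ∀ x, Measurable fun z => Φ (x, z) := fun x => hΦm.comp measurable_prodMk_left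
  have hmark : ∀ i, Measurable fun y : (Set.Icc t₀ M.T × Ω) × M.Z => (y.1, M.G y.1.1 i y.2) :=
    fun i => measurable_fst.prodMk (M.G_measurable.comp ((measurable_subtype_coe.comp
      (measurable_fst.comp measurable_fst)).prodMk (measurable_const.prodMk measurable_snd)))
  have hint : Integrable (fun y : (Set.Icc t₀ M.T × Ω) × M.Z =>
      Φ (y.1, X.jumpSize y.1.2 (y.1.1, y.2))) (((timeMeasure t₀ M.T).prod P).prod M.ς) := by
    refine ⟨(hΦm.comp measurable_jump_mark).aestronglyMeasurable, ?_⟩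
    rw [HasFiniteIntegral, hπ.lintegral_jumpSize (Ψ := fun y => ‖Φ y‖ₑ)
      (measurable_enorm.comp hΦ) (by simp [h0])]
    exact lt_top_iff_ne_top.2 hfin
  have hlm : ∀ (Ψ : (Set.Icc t₀ M.T × Ω) × ℝ → ℝ≥0∞), Measurable Ψ → (∀ x, Ψ (x, 0) = 0) →
      Measurable fun x : Set.Icc t₀ M.T × Ω =>
        ∑ i, ENNReal.ofReal (π x.1 x.2 i) * ∫⁻ z, Ψ (x, z) ∂(M.η x.1 i) := by
    intro Ψ hΨ hΨ0
    refine Finset.measurable_fun_sum _ fun i _ => (hπi i).ennreal_ofReal.mul ?_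
    have hη : ∀ x : Set.Icc t₀ M.T × Ω, ∫⁻ z, Ψ (x, z) ∂(M.η x.1 i) =
        ∫⁻ ζ, Ψ (x, M.G x.1 i ζ) ∂M.ς := fun x =>
      lintegral_η (f := fun z => Ψ (x, z)) _ i (hΨ.comp measurable_prodMk_left) (hΨ0 x)
    simp_rw [hη]
    exact (hΨ.comp (hmark i)).lintegral_prod_right'
  have hae : ∀ᵐ x ∂((timeMeasure t₀ M.T).prod P), ∀ i, π x.1 x.2 i ≠ 0 →
      Integrable (fun z => Φ (x, z)) (M.η x.1 i) := by
    filter_upwards [ae_lt_top (hlm (fun y => ‖Φ y‖ₑ) hΦm.enorm (by simp [h0])) hfin] with x hx i hi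
    refine ⟨(hsec x).aestronglyMeasurable, ?_⟩
    have h1 := ENNReal.sum_lt_top.1 hx i (Finset.mem_univ i)
    have hpos : ENNReal.ofReal (π x.1 x.2 i) ≠ 0 := by
      simpa using lt_of_le_of_ne (hπ0 x i) hi.symm
    rw [HasFiniteIntegral]
    by_contra hc
    rw [not_lt_top_iff.1 hc, ENNReal.mul_top hpos] at h1
    exact lt_irrefl _ h1
  refine ⟨hint, hae, ?_, ?_⟩
  · refine ⟨?_, ?_⟩
    · refine (Finset.measurable_fun_sum _ fun i _ => (hπi i).mul ?_).aestronglyMeasurable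
      have hη : ∀ x : Set.Icc t₀ M.T × Ω, ∫ z, Φ (x, z) ∂(M.η x.1 i) =
          ∫ ζ, Φ (x, M.G x.1 i ζ) ∂M.ς := fun x =>
        integral_η (f := fun z => Φ (x, z)) _ i (hsec x) (h0 x)
      simp_rw [hη]
      exact (hΦm.comp (hmark i)).stronglyMeasurable.integral_prod_right'.measurable
    · refine lt_of_le_of_lt (lintegral_mono fun x => ?_) (lt_top_iff_ne_top.2 hfin)
      refine (enorm_sum_le _ _).trans (Finset.sum_le_sum fun i _ => ?_)
      rw [enorm_mul, Real.enorm_of_nonneg (hπ0 x i)]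
      exact mul_le_mul_right (enorm_integral_le_lintegral_enorm _) _
  · have hpos := hπ.lintegral_jumpSize (Ψ := fun y => ENNReal.ofReal (Φ y))
      (ENNReal.measurable_ofReal.comp hΦ) (by simp [h0])
    have hneg := hπ.lintegral_jumpSize (Ψ := fun y => ENNReal.ofReal (-Φ y))
      (ENNReal.measurable_ofReal.comp (measurable_neg.comp hΦ)) (by simp [h0])
    have hmp := hlm (fun y => ENNReal.ofReal (Φ y)) hΦm.ennreal_ofReal (by simp [h0])
    have hmn := hlm (fun y => ENNReal.ofReal (-Φ y)) hΦm.neg.ennreal_ofReal (by simp [h0])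
    have hfp : ∫⁻ x, ∑ i, ENNReal.ofReal (π x.1 x.2 i) *
        ∫⁻ z, ENNReal.ofReal (Φ (x, z)) ∂(M.η x.1 i) ∂((timeMeasure t₀ M.T).prod P) ≠ ∞ := by
      rw [← hpos]
      exact hint.lintegral_lt_top.ne
    have hfn : ∫⁻ x, ∑ i, ENNReal.ofReal (π x.1 x.2 i) *
        ∫⁻ z, ENNReal.ofReal (-Φ (x, z)) ∂(M.η x.1 i) ∂((timeMeasure t₀ M.T).prod P) ≠ ∞ := by
      rw [← hneg]
      exact hint.neg.lintegral_lt_top.ne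
    rw [integral_eq_lintegral_pos_part_sub_lintegral_neg_part hint, hpos, hneg,
      ← integral_toReal hmp.aemeasurable (ae_lt_top hmp hfp),
      ← integral_toReal hmn.aemeasurable (ae_lt_top hmn hfn),
      ← integral_sub (integrable_toReal_of_lintegral_ne_top hmp.aemeasurable hfp)
        (integrable_toReal_of_lintegral_ne_top hmn.aemeasurable hfn)]
    refine integral_congr_ae ?_
    filter_upwards [hae, ae_lt_top hmp hfp, ae_lt_top hmn hfn] with x hx hp hn
    rw [ENNReal.toReal_sum fun i hi => (ENNReal.sum_lt_top.1 hp i hi).ne,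
      ENNReal.toReal_sum fun i hi => (ENNReal.sum_lt_top.1 hn i hi).ne, ← Finset.sum_sub_distrib]
    refine Finset.sum_congr rfl fun i _ => ?_
    rw [ENNReal.toReal_mul, ENNReal.toReal_mul, ENNReal.toReal_ofReal (hπ0 x i), ← mul_sub]
    -- The integral over marks may diverge for a state of zero weight, but then both sides vanish.
    -- For the other states the splitting into parts is legitimate.
    rcases eq_or_ne (π x.1 x.2 i) 0 with h | h
    · rw [h, zero_mul, zero_mul]
    · rw [integral_eq_lintegral_pos_part_sub_lintegral_neg_part (hx i h)]

end Model

end Market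

/-! ### Log-optimal rules -/

/-- From `1 - 1 / x ≤ log x ≤ x - 1` at `x = 1 + h z`: the lower bound is `h z / (1 + h z)` and the
upper one is `h z`. Integrability of the logarithm is thereby reduced to that of `z` and of the
marginal's integrand. -/
lemma abs_log_one_add_mul_le {h z : ℝ} (hz : 0 < 1 + h * z) :
    |Real.log (1 + h * z)| ≤ |h| * (|z| + |z / (1 + h * z)|) := by
  have h1 := Real.log_le_sub_one_of_pos hz
  have h2 := Real.one_sub_inv_le_log_of_pos hz
  have h3 : 1 - (1 + h * z)⁻¹ = h * (z / (1 + h * z)) := by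
    field_simp
    ring
  rw [h3] at h2
  have h4 : |h * z| = |h| * |z| := abs_mul _ _
  have h5 : |h * (z / (1 + h * z))| = |h| * |z / (1 + h * z)| := abs_mul _ _
  have h6 := le_abs_self (h * z)
  have h7 := neg_abs_le (h * (z / (1 + h * z)))
  have h8 : 0 ≤ |h| * |z| := by positivity
  have h9 : 0 ≤ |h| * |z / (1 + h * z)| := by positivity
  rw [abs_le, mul_add]
  constructor <;> linarith

/-- Concavity of the logarithm: the right side is the tangent at position `k`. -/
lemma log_one_add_mul_le {h k z : ℝ} (hz : 0 < 1 + h * z) (kz : 0 < 1 + k * z) :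
    Real.log (1 + h * z) ≤ Real.log (1 + k * z) + (h - k) * (z / (1 + k * z)) := by
  have h1 := Real.log_le_sub_one_of_pos (div_pos hz kz)
  rw [Real.log_div hz.ne' kz.ne'] at h1
  have h2 : (1 + h * z) / (1 + k * z) - 1 = (h - k) * (z / (1 + k * z)) := by
    rw [div_sub_one kz.ne', ← mul_div_assoc]
    congr 1
    ring
  linarith

namespace Market

variable {K : ℕ} {M : Market K} {t h : ℝ} {q : Fin K → ℝ}

/-- The first-order condition as a variational inequality. -/
lemma IsLogRule.mul_sub_nonpos (hr : M.IsLogRule t q h) {k : ℝ} (hk : k ∈ Set.Icc (-M.L) M.L) :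
    (k - h) * (M.marginal t q h - M.ρ) ≤ 0 := by
  rcases hr.2.2 with h1 | ⟨rfl, h1⟩ | ⟨rfl, h1⟩
  · rw [h1, sub_self, mul_zero]
  · exact mul_nonpos_of_nonpos_of_nonneg (by linarith [hk.2]) (by linarith)
  · exact mul_nonpos_of_nonneg_of_nonpos (by linarith [hk.1]) (by linarith)

/-- The marginal of a log-optimal rule converges absolutely, with an explicit bound. -/
lemma IsLogRule.sum_lintegral_le (hr : M.IsLogRule t q h) (hq : ∀ i, 0 ≤ q i)
    (hpos : ∀ i, M.η t i {z | 1 + h * z ≤ 0} = 0) :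
    ∑ i, ENNReal.ofReal (q i) * ∫⁻ z, ‖z / (1 + h * z)‖ₑ ∂(M.η t i) ≤
      2 * ∑ i, ENNReal.ofReal (q i) * ∫⁻ z, ‖z‖ₑ ∂(M.η t i) + ENNReal.ofReal M.ρ := by
  rcases eq_or_ne (∑ i, ENNReal.ofReal (q i) * ∫⁻ z, ‖z‖ₑ ∂(M.η t i)) ∞ with htop | htop
  · rw [htop]; simp
  have hρ := M.ρ_pos
  have hL := M.L_pos
  have hz : ∀ i, q i ≠ 0 → Integrable (fun z : ℝ => z) (M.η t i) := by
    intro i hi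
    refine ⟨aestronglyMeasurable_id, ?_⟩
    have h1 := ENNReal.sum_lt_top.1 (lt_top_iff_ne_top.2 htop) i (Finset.mem_univ i)
    have hp : ENNReal.ofReal (q i) ≠ 0 := by simpa using lt_of_le_of_ne (hq i) hi.symm
    rw [HasFiniteIntegral]
    by_contra hc
    rw [not_lt_top_iff.1 hc, ENNReal.mul_top hp] at h1
    exact lt_irrefl _ h1
  have hconv : ∀ f : ℝ → ℝ, (∀ i, q i ≠ 0 → Integrable f (M.η t i)) →
      ∑ i, ENNReal.ofReal (q i) * ∫⁻ z, ‖f z‖ₑ ∂(M.η t i) =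
        ENNReal.ofReal (∑ i, q i * ∫ z, |f z| ∂(M.η t i)) := by
    intro f hf
    rw [ENNReal.ofReal_sum_of_nonneg fun i _ =>
      mul_nonneg (hq i) (integral_nonneg fun z => abs_nonneg _)]
    refine Finset.sum_congr rfl fun i _ => ?_
    rcases eq_or_ne (q i) 0 with h0 | h0
    · simp [h0]
    · rw [ENNReal.ofReal_mul (hq i)]
      congr 1
      exact (ofReal_integral_norm_eq_lintegral_enorm (hf i h0)).symm
  have hsum0 : 0 ≤ ∑ i, q i * ∫ z, |z| ∂(M.η t i) :=
    Finset.sum_nonneg fun i _ => mul_nonneg (hq i) (integral_nonneg fun z => abs_nonneg _)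
  rw [hconv _ hr.2.1, hconv _ hz, ← ENNReal.ofReal_ofNat 2, ← ENNReal.ofReal_mul (by norm_num),
    ← ENNReal.ofReal_add (by positivity) hρ.le]
  refine ENNReal.ofReal_le_ofReal ?_
  have hae : ∀ i, ∀ᵐ z ∂(M.η t i), 0 < 1 + h * z := fun i => by
    rw [ae_iff]; simpa using hpos i
  -- With `x = z / (1 + h z)`, write `|x| = 2 x⁺ - x = 2 x⁻ + x`. If `h ≥ 0` then `x⁺ ≤ |z|`, giving
  -- `σ = -1`; if `h ≤ 0` then `x⁻ ≤ |z|`, giving `σ = 1`. The first-order condition supplies the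
  -- matching one-sided bound: the marginal is above `ρ` only at `L` and below it only at `-L`.
  have key : ∃ σ : ℝ, (∀ z, 0 < 1 + h * z → |z / (1 + h * z)| ≤ 2 * |z| + σ * (z / (1 + h * z))) ∧
      σ * M.marginal t q h ≤ M.ρ := by
    have hA : 0 ≤ h → ∀ z, 0 < 1 + h * z →
        |z / (1 + h * z)| ≤ 2 * |z| + -1 * (z / (1 + h * z)) := by
      intro hh z hz
      rcases le_total 0 z with h0 | h0
      · have h1 : z / (1 + h * z) ≤ z := div_le_self h0 (by nlinarith)
        rw [abs_of_nonneg (div_nonneg h0 hz.le), abs_of_nonneg h0]; linarith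
      · rw [abs_of_nonpos (div_nonpos_of_nonpos_of_nonneg h0 hz.le)]
        linarith [abs_nonneg z]
    have hB : h ≤ 0 → ∀ z, 0 < 1 + h * z →
        |z / (1 + h * z)| ≤ 2 * |z| + 1 * (z / (1 + h * z)) := by
      intro hh z hz
      rcases le_total 0 z with h0 | h0
      · rw [abs_of_nonneg (div_nonneg h0 hz.le)]
        linarith [abs_nonneg z]
      · have h1 : (-z) / (1 + h * z) ≤ -z := div_le_self (by linarith) (by nlinarith)
        rw [neg_div] at h1
        rw [abs_of_nonpos (div_nonpos_of_nonpos_of_nonneg h0 hz.le), abs_of_nonpos h0]; linarith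
    rcases hr.2.2 with h1 | ⟨h2, h1⟩ | ⟨h2, h1⟩
    · rcases le_total 0 h with hh | hh
      · exact ⟨-1, hA hh, by linarith⟩
      · exact ⟨1, hB hh, by linarith⟩
    · exact ⟨-1, hA (by linarith), by linarith⟩
    · exact ⟨1, hB (by linarith), by linarith⟩
  obtain ⟨σ, hσ, hσm⟩ := key
  have h1 : ∑ i, q i * ∫ z, |z / (1 + h * z)| ∂(M.η t i) ≤
      ∑ i, (2 * (q i * ∫ z, |z| ∂(M.η t i)) + σ * (q i * ∫ z, z / (1 + h * z) ∂(M.η t i))) := by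
    refine Finset.sum_le_sum fun i _ => ?_
    rcases eq_or_ne (q i) 0 with h0 | h0
    · simp [h0]
    · have h2 : ∫ z, |z / (1 + h * z)| ∂(M.η t i) ≤
          ∫ z, (2 * |z| + σ * (z / (1 + h * z))) ∂(M.η t i) := by
        refine integral_mono_ae (hr.2.1 i h0).abs
          (((hz i h0).abs.const_mul 2).add ((hr.2.1 i h0).const_mul σ)) ?_
        filter_upwards [hae i] with z hz using hσ z hz
      rw [integral_add ((hz i h0).abs.const_mul 2) ((hr.2.1 i h0).const_mul σ),
        integral_const_mul, integral_const_mul] at h2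
      have := mul_le_mul_of_nonneg_left h2 (hq i)
      linarith
  rw [Finset.sum_add_distrib, ← Finset.mul_sum, ← Finset.mul_sum] at h1
  have h2 : σ * ∑ i, q i * ∫ z, z / (1 + h * z) ∂(M.η t i) ≤ M.ρ := hσm
  linarith

end Market

/-! ### Extended expectations -/

section ExtExpectation

variable {Ω : Type*} [MeasurableSpace Ω] {P : Measure Ω}

/-- Neither measurability nor integrability enters, so the reward of an arbitrary strategy, possibly
`-∞`, can be compared with an integrable bound. -/
lemma extExpectation_mono {X Y : Ω → ℝ} (h : ∀ᵐ ω ∂P, X ω ≤ Y ω) :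
    extExpectation P X ≤ extExpectation P Y := by
  refine EReal.sub_le_sub ?_ ?_
  · exact EReal.coe_ennreal_le_coe_ennreal_iff.2
      (lintegral_mono_ae (h.mono fun ω hω => ENNReal.ofReal_le_ofReal hω))
  · exact EReal.coe_ennreal_le_coe_ennreal_iff.2
      (lintegral_mono_ae (h.mono fun ω hω => ENNReal.ofReal_le_ofReal (neg_le_neg hω)))

lemma extExpectation_congr {X Y : Ω → ℝ} (h : ∀ᵐ ω ∂P, X ω = Y ω) :
    extExpectation P X = extExpectation P Y :=
  le_antisymm (extExpectation_mono (h.mono fun _ hω => hω.le))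
    (extExpectation_mono (h.mono fun _ hω => hω.ge))

lemma extExpectation_of_integrable {X : Ω → ℝ} (h : Integrable X P) :
    extExpectation P X = ((∫ ω, X ω ∂P : ℝ) : EReal) := by
  have h1 := h.lintegral_lt_top.ne
  have h2 := h.neg.lintegral_lt_top.ne
  simp only [Pi.neg_apply] at h2
  rw [extExpectation, integral_eq_lintegral_pos_part_sub_lintegral_neg_part h, EReal.coe_sub]
  congr 1
  · conv_lhs => rw [← ENNReal.ofReal_toReal h1]
    rw [EReal.coe_ennreal_ofReal, max_eq_left ENNReal.toReal_nonneg]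
  · conv_lhs => rw [← ENNReal.ofReal_toReal h2]
    rw [EReal.coe_ennreal_ofReal, max_eq_left ENNReal.toReal_nonneg]

end ExtExpectation

namespace Market.Model

variable {K : ℕ} {M : Market K} {t₀ : ℝ} [Fact (t₀ ≤ M.T)] {p : Fin K → ℝ} {S₀ : ℝ}
  {Ω : Type*} [mΩ : MeasurableSpace Ω] {P : Measure Ω} [IsProbabilityMeasure P]
  {X : M.Model t₀ p S₀ P} {π : Set.Icc t₀ M.T → Ω → Fin K → ℝ} {hs : ℝ → (Fin K → ℝ) → ℝ}

/-- The jumps have a finite first moment. -/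
lemma IsFilter.lintegral_abs_ne_top (hπ : X.IsFilter π) :
    ∫⁻ x, ∑ i, ENNReal.ofReal (π x.1 x.2 i) * ∫⁻ z, ‖z‖ₑ ∂(M.η x.1 i)
      ∂((timeMeasure t₀ M.T).prod P) ≠ ∞ := by
  have hΨ : Measurable[@Prod.instMeasurableSpace _ _ X.FS.predictable _]
      fun y : (Set.Icc t₀ M.T × Ω) × ℝ => ‖y.2‖ₑ := by
    let : MeasurableSpace (Set.Icc t₀ M.T × Ω) := X.FS.predictable
    exact measurable_enorm.comp measurable_snd
  rw [← hπ.lintegral_jumpSize hΨ (by simp)]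
  have hg : Measurable fun y : (Set.Icc t₀ M.T × Ω) × M.Z => X.jumpSize y.1.2 (y.1.1, y.2) :=
    measurable_snd.comp measurable_jump_mark
  have hsq : ∫⁻ y : (Set.Icc t₀ M.T × Ω) × M.Z, ENNReal.ofReal (X.jumpSize y.1.2 (y.1.1, y.2) ^ 2)
      ∂(((timeMeasure t₀ M.T).prod P).prod M.ς) < ∞ := by
    have h1 := (hg.pow_const 2).ennreal_ofReal
    rw [lintegral_prod _ h1.aemeasurable, lintegral_prod_symm _ h1.lintegral_prod_right'.aemeasurable]
    exact X.G_sq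
  -- The bound `|z| ≤ 1 + z ^ 2` suffices, as the measure of time, chance and marks is finite.
  refine ne_of_lt (lt_of_le_of_lt (lintegral_mono (g := fun y => 1 +
    ENNReal.ofReal (X.jumpSize y.1.2 (y.1.1, y.2) ^ 2)) fun y => ?_) ?_)
  · simp only
    rw [Real.enorm_eq_ofReal_abs, ← ENNReal.ofReal_one, ← ENNReal.ofReal_add zero_le_one (by positivity)]
    refine ENNReal.ofReal_le_ofReal ?_
    rw [← sq_abs]
    nlinarith [sq_nonneg (|X.jumpSize y.1.2 (y.1.1, y.2)| - 1),
      abs_nonneg (X.jumpSize y.1.2 (y.1.1, y.2))]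
  · rw [lintegral_add_left measurable_const, lintegral_const, one_mul]
    exact ENNReal.add_lt_top.2 ⟨measure_lt_top _ _, hsq⟩

omit [IsProbabilityMeasure P] in
lemma leftLim_mem_simplex (hπ : X.IsFilter π) (s : Set.Icc t₀ M.T) (ω : Ω) :
    Function.leftLim (fun r => π r ω) s ∈ stdSimplex ℝ (Fin K) :=
  leftLim_mem_of_isClosed (hπ.cadlag ω) (isClosed_stdSimplex ℝ (Fin K))
    (fun r => hπ.mem_simplex r ω) s

omit [IsProbabilityMeasure P] in
/-- The feedback strategy of a log-optimal rule is admissible. -/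
lemma isAdmissible_feedback (hπ : X.IsFilter π) (hm : Measurable (Function.uncurry hs))
    (hr : ∀ t ∈ Set.Icc t₀ M.T, ∀ q ∈ stdSimplex ℝ (Fin K), M.IsLogRule t q (hs t q))
    (hpos : X.KeepsWealthPositive (X.feedback π hs)) : X.IsAdmissible (X.feedback π hs) where
  predictable := by
    have ht := measurable_predictable_time X.FS
    have hl := measurable_predictable_leftLim (fun s => (hπ.adapted s).measurable) hπ.cadlag
    let : MeasurableSpace (Set.Icc t₀ M.T × Ω) := X.FS.predictable
    exact (hm.comp (ht.prodMk hl)).stronglyMeasurable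
  bounded := Eventually.of_forall fun ω s => (hr s s.2 _ (leftLim_mem_simplex hπ s ω)).1
  positive := hpos

/-- The feedback uses `π_{s-}`, while the projection formulas carry the weights `π_s`. For almost
every `(s, ω)` they coincide, so the first-order condition holds with the weights that appear under
the integral. -/
lemma ae_isLogRule (hπ : X.IsFilter π)
    (hr : ∀ t ∈ Set.Icc t₀ M.T, ∀ q ∈ stdSimplex ℝ (Fin K), M.IsLogRule t q (hs t q)) :
    ∀ᵐ x ∂((timeMeasure t₀ M.T).prod P),
      M.IsLogRule x.1 (π x.1 x.2) (X.feedback π hs x.1 x.2) := by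
  filter_upwards [ae_leftLim_eq (P := P) hπ.measurable hπ.cadlag] with x hx
  have := hr x.1 x.1.2 _ (leftLim_mem_simplex hπ x.1 x.2)
  rwa [← hx]

omit [IsProbabilityMeasure P] in
lemma ae_η_eq_zero {h : Set.Icc t₀ M.T → Ω → ℝ} (hpos : X.KeepsWealthPositive h) :
    ∀ᵐ x ∂((timeMeasure t₀ M.T).prod P), ∀ i, M.η x.1 i {z | 1 + h x.1 x.2 * z ≤ 0} = 0 := by
  filter_upwards [Measure.quasiMeasurePreserving_snd.ae (μa := (timeMeasure t₀ M.T).prod P) hpos]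
    with x hx i
  exact measure_mono_null
    (fun z (hz : _ ≤ _) => (⟨x.1, hz⟩ : ∃ s, 1 + h s x.2 * z ≤ 0)) (hx x.1 i)

/-- Criterion for the integrability of functions of the jumps. -/
lemma lintegral_ne_top_of_bound (hπ : X.IsFilter π)
    (hr : ∀ t ∈ Set.Icc t₀ M.T, ∀ q ∈ stdSimplex ℝ (Fin K), M.IsLogRule t q (hs t q))
    (hpos : X.KeepsWealthPositive (X.feedback π hs))
    {Φ : (Set.Icc t₀ M.T × Ω) × ℝ → ℝ} {C : ℝ}
    (hΦ : ∀ᵐ x ∂((timeMeasure t₀ M.T).prod P), ∀ z, 0 < 1 + X.feedback π hs x.1 x.2 * z →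
      |Φ (x, z)| ≤ C * (|z| + |z / (1 + X.feedback π hs x.1 x.2 * z)|)) :
    ∫⁻ x, ∑ i, ENNReal.ofReal (π x.1 x.2 i) * ∫⁻ z, ‖Φ (x, z)‖ₑ ∂(M.η x.1 i)
        ∂((timeMeasure t₀ M.T).prod P) ≠ ∞ := by
  have h1 : ∀ᵐ x ∂((timeMeasure t₀ M.T).prod P),
      ∑ i, ENNReal.ofReal (π x.1 x.2 i) * ∫⁻ z, ‖Φ (x, z)‖ₑ ∂(M.η x.1 i) ≤
        ENNReal.ofReal C * (3 * ∑ i, ENNReal.ofReal (π x.1 x.2 i) * ∫⁻ z, ‖z‖ₑ ∂(M.η x.1 i) +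
          ENNReal.ofReal M.ρ) := by
    filter_upwards [hΦ, ae_isLogRule hπ hr, ae_η_eq_zero hpos] with x hx hrx hpx
    have hb := hrx.sum_lintegral_le (hπ.mem_simplex x.1 x.2).1 hpx
    have h2 : ∀ i, ∫⁻ z, ‖Φ (x, z)‖ₑ ∂(M.η x.1 i) ≤ ENNReal.ofReal C * (∫⁻ z, ‖z‖ₑ ∂(M.η x.1 i) +
        ∫⁻ z, ‖z / (1 + X.feedback π hs x.1 x.2 * z)‖ₑ ∂(M.η x.1 i)) := by
      intro i
      rw [← lintegral_add_left measurable_enorm, ← lintegral_const_mul _ (by fun_prop)]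
      have hae : ∀ᵐ z ∂(M.η x.1 i), 0 < 1 + X.feedback π hs x.1 x.2 * z := by
        rw [ae_iff]; simpa using hpx i
      refine lintegral_mono_ae ?_
      filter_upwards [hae] with z hz
      rw [Real.enorm_eq_ofReal_abs, Real.enorm_eq_ofReal_abs, Real.enorm_eq_ofReal_abs,
        ← ENNReal.ofReal_add (abs_nonneg _) (abs_nonneg _), ← ENNReal.ofReal_mul' (by positivity)]
      exact ENNReal.ofReal_le_ofReal (hx z hz)
    calc ∑ i, ENNReal.ofReal (π x.1 x.2 i) * ∫⁻ z, ‖Φ (x, z)‖ₑ ∂(M.η x.1 i)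
        ≤ ∑ i, ENNReal.ofReal (π x.1 x.2 i) * (ENNReal.ofReal C * (∫⁻ z, ‖z‖ₑ ∂(M.η x.1 i) +
        ∫⁻ z, ‖z / (1 + X.feedback π hs x.1 x.2 * z)‖ₑ ∂(M.η x.1 i))) :=
          Finset.sum_le_sum fun i _ => mul_le_mul_right (h2 i) _
      _ = ENNReal.ofReal C * (∑ i, ENNReal.ofReal (π x.1 x.2 i) * ∫⁻ z, ‖z‖ₑ ∂(M.η x.1 i) +
          ∑ i, ENNReal.ofReal (π x.1 x.2 i) *
            ∫⁻ z, ‖z / (1 + X.feedback π hs x.1 x.2 * z)‖ₑ ∂(M.η x.1 i)) := by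
        rw [← Finset.sum_add_distrib, Finset.mul_sum]
        exact Finset.sum_congr rfl fun i _ => by ring
      _ ≤ ENNReal.ofReal C * (∑ i, ENNReal.ofReal (π x.1 x.2 i) * ∫⁻ z, ‖z‖ₑ ∂(M.η x.1 i) +
          (2 * ∑ i, ENNReal.ofReal (π x.1 x.2 i) * ∫⁻ z, ‖z‖ₑ ∂(M.η x.1 i) +
            ENNReal.ofReal M.ρ)) := by gcongr
      _ = _ := by ring
  refine ne_of_lt ((lintegral_mono_ae h1).trans_lt ?_)
  rw [lintegral_const_mul' _ _ ENNReal.ofReal_ne_top, lintegral_add_right _ measurable_const,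
    lintegral_const_mul' _ _ (by norm_num), lintegral_const]
  refine ENNReal.mul_lt_top ENNReal.ofReal_lt_top (ENNReal.add_lt_top.2 ⟨?_, ?_⟩)
  · exact ENNReal.mul_lt_top (by norm_num) (lt_top_iff_ne_top.2 hπ.lintegral_abs_ne_top)
  · exact ENNReal.mul_lt_top ENNReal.ofReal_lt_top (measure_lt_top _ _)

end Market.Model

/-! ### Optimality -/

lemma integrable_sum_dirac {α : Type*} [MeasurableSpace α] [MeasurableSingletonClass α]
    (A : Finset α) (φ : α → ℝ) : Integrable φ (∑ x ∈ A, Measure.dirac x) :=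
  integrable_finsetSum_measure.2 fun x _ => integrable_dirac (by simp)

namespace Market.Model

variable {K : ℕ} {M : Market K} {t₀ : ℝ} [Fact (t₀ ≤ M.T)] {p : Fin K → ℝ} {S₀ : ℝ}
  {Ω : Type*} [mΩ : MeasurableSpace Ω] {P : Measure Ω} [IsProbabilityMeasure P]
  {X : M.Model t₀ p S₀ P} {π : Set.Icc t₀ M.T → Ω → Fin K → ℝ} {hs : ℝ → (Fin K → ℝ) → ℝ}

omit [Fact (t₀ ≤ M.T)] [IsProbabilityMeasure P] in
lemma ae_prod_of_ae_chance {Q : Set.Icc t₀ M.T × Ω → Prop}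
    (h : ∀ᵐ ω ∂P, ∀ s : Set.Icc t₀ M.T, Q (s, ω)) :
    ∀ᵐ x ∂((timeMeasure t₀ M.T).prod P), Q x := by
  filter_upwards [Measure.quasiMeasurePreserving_snd.ae (μa := (timeMeasure t₀ M.T).prod P) h]
    with x hx using hx x.1

omit [Fact (t₀ ≤ M.T)] in
/-- Bounded observable processes are integrable in time and chance. -/
lemma integrable_of_ae_bound {f : Set.Icc t₀ M.T → Ω → ℝ} (hf : Measurable (Function.uncurry f))
    {C : ℝ} (hC : ∀ᵐ ω ∂P, ∀ s, |f s ω| ≤ C) :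
    Integrable (fun x : Set.Icc t₀ M.T × Ω => f x.1 x.2) ((timeMeasure t₀ M.T).prod P) :=
  Integrable.of_bound hf.aestronglyMeasurable C (ae_prod_of_ae_chance hC)

omit [IsProbabilityMeasure P] in
/-- Observable integrands composed with the jump sizes are predictable. -/
lemma measurable_comp_jumpSize (X : M.Model t₀ p S₀ P) {Φ : (Set.Icc t₀ M.T × Ω) × ℝ → ℝ}
    (hΦ : Measurable[@Prod.instMeasurableSpace _ _ X.FS.predictable _] Φ) :
    Measurable[@Prod.instMeasurableSpace _ _ X.F.predictable _]
      fun y : (Set.Icc t₀ M.T × Ω) × M.Z => Φ (y.1, X.jumpSize y.1.2 (y.1.1, y.2)) := by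
  have h1 : Measurable[@Prod.instMeasurableSpace _ _ X.F.predictable _] Φ :=
    hΦ.mono (sup_le_sup (MeasurableSpace.comap_mono (predictable_mono X.FS_le)) le_rfl) le_rfl
  have h2 := X.measurable_jumpSize
  let : MeasurableSpace (Set.Icc t₀ M.T × Ω) := X.F.predictable
  exact h1.comp (measurable_fst.prodMk h2)

lemma integrable_drift {h : Set.Icc t₀ M.T → Ω → ℝ} (hh : X.IsAdmissible h) :
    Integrable (fun x : Set.Icc t₀ M.T × Ω => (1 - h x.1 x.2) * M.ρ)
      ((timeMeasure t₀ M.T).prod P) := by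
  have hhm := X.measurable_strategy hh.predictable
  refine integrable_of_ae_bound (f := fun s ω => (1 - h s ω) * M.ρ) (C := (1 + M.L) * M.ρ)
    ((measurable_const.sub hhm).mul measurable_const) ?_
  filter_upwards [hh.bounded] with ω hω s
  rw [abs_mul, abs_of_pos M.ρ_pos]
  refine mul_le_mul_of_nonneg_right (abs_le.2 ⟨?_, ?_⟩) M.ρ_pos.le
  · linarith [(hω s).2]
  · linarith [(hω s).1]

/-! ### Expected growth of a log-optimal rule and comparison with other strategies -/

section Rule

variable (hπ : X.IsFilter π) (hm : Measurable (Function.uncurry hs))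
  (hr : ∀ t ∈ Set.Icc t₀ M.T, ∀ q ∈ stdSimplex ℝ (Fin K), M.IsLogRule t q (hs t q))
  (hpos : X.KeepsWealthPositive (X.feedback π hs))

include hπ hm hr hpos

/-- The logarithmic jumps of the wealth of a log-optimal rule. -/
lemma integral_log_feedback :
    Integrable (fun ω => ∫ x, Real.log (1 + X.feedback π hs x.1 ω * X.jumpSize ω x) ∂(X.N ω)) P ∧
    (∀ᵐ x ∂((timeMeasure t₀ M.T).prod P), ∀ i, π x.1 x.2 i ≠ 0 →
      Integrable (fun z => Real.log (1 + X.feedback π hs x.1 x.2 * z)) (M.η x.1 i)) ∧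
    Integrable (fun x : Set.Icc t₀ M.T × Ω => ∑ i, π x.1 x.2 i *
      ∫ z, Real.log (1 + X.feedback π hs x.1 x.2 * z) ∂(M.η x.1 i))
      ((timeMeasure t₀ M.T).prod P) ∧
    ∫ ω, ∫ x, Real.log (1 + X.feedback π hs x.1 ω * X.jumpSize ω x) ∂(X.N ω) ∂P =
      ∫ x, ∑ i, π x.1 x.2 i * ∫ z, Real.log (1 + X.feedback π hs x.1 x.2 * z) ∂(M.η x.1 i)
        ∂((timeMeasure t₀ M.T).prod P) := by
  have hadm := isAdmissible_feedback hπ hm hr hpos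
  have hk := hadm.predictable.measurable
  let Φ : (Set.Icc t₀ M.T × Ω) × ℝ → ℝ := fun y =>
    Real.log (1 + X.feedback π hs y.1.1 y.1.2 * y.2)
  have hΦ : Measurable[@Prod.instMeasurableSpace _ _ X.FS.predictable _] Φ := by
    let : MeasurableSpace (Set.Icc t₀ M.T × Ω) := X.FS.predictable
    exact Real.measurable_log.comp
      (measurable_const.add ((hk.comp measurable_fst).mul measurable_snd))
  have hfin := lintegral_ne_top_of_bound hπ hr hpos (Φ := Φ) (C := M.L) (by
    filter_upwards [ae_isLogRule hπ hr] with x hx z hz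
    refine (abs_log_one_add_mul_le hz).trans ?_
    exact mul_le_mul_of_nonneg_right (abs_le.2 hx.1) (by positivity))
  obtain ⟨h1, h2, h3, h4⟩ := hπ.integral_jumpSize hΦ (by simp [Φ]) hfin
  obtain ⟨h5, h6⟩ := X.poisson.integral_compensator (measurable_comp_jumpSize X hΦ) h1
  exact ⟨h5, h2, h3, h6.trans h4⟩

/-- The tangent of the logarithmic jumps of the wealth at a log-optimal rule. -/
lemma integral_tangent {h : Set.Icc t₀ M.T → Ω → ℝ} (hh : X.IsAdmissible h) :
    Integrable (fun ω => ∫ x, (h x.1 ω - X.feedback π hs x.1 ω) *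
      (X.jumpSize ω x / (1 + X.feedback π hs x.1 ω * X.jumpSize ω x)) ∂(X.N ω)) P ∧
    Integrable (fun x : Set.Icc t₀ M.T × Ω => (h x.1 x.2 - X.feedback π hs x.1 x.2) *
      M.marginal x.1 (π x.1 x.2) (X.feedback π hs x.1 x.2)) ((timeMeasure t₀ M.T).prod P) ∧
    ∫ ω, ∫ x, (h x.1 ω - X.feedback π hs x.1 ω) *
      (X.jumpSize ω x / (1 + X.feedback π hs x.1 ω * X.jumpSize ω x)) ∂(X.N ω) ∂P =
      ∫ x, (h x.1 x.2 - X.feedback π hs x.1 x.2) *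
        M.marginal x.1 (π x.1 x.2) (X.feedback π hs x.1 x.2) ∂((timeMeasure t₀ M.T).prod P) := by
  have hadm := isAdmissible_feedback hπ hm hr hpos
  have hk := hadm.predictable.measurable
  have hhm := hh.predictable.measurable
  let Φ : (Set.Icc t₀ M.T × Ω) × ℝ → ℝ := fun y => (h y.1.1 y.1.2 - X.feedback π hs y.1.1 y.1.2) *
    (y.2 / (1 + X.feedback π hs y.1.1 y.1.2 * y.2))
  have hΦ : Measurable[@Prod.instMeasurableSpace _ _ X.FS.predictable _] Φ := by
    let : MeasurableSpace (Set.Icc t₀ M.T × Ω) := X.FS.predictable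
    exact ((hhm.comp measurable_fst).sub (hk.comp measurable_fst)).mul
      (measurable_snd.div (measurable_const.add ((hk.comp measurable_fst).mul measurable_snd)))
  -- `2 * M.L` bounds the difference of two positions in `[-L, L]`.
  have hfin := lintegral_ne_top_of_bound hπ hr hpos (Φ := Φ) (C := 2 * M.L) (by
    filter_upwards [ae_isLogRule hπ hr, ae_prod_of_ae_chance
      (Q := fun x => h x.1 x.2 ∈ Set.Icc (-M.L) M.L) hh.bounded] with x hx hb z hz
    simp only [Φ]
    rw [abs_mul]
    refine mul_le_mul (abs_le.2 ⟨?_, ?_⟩) (by linarith [abs_nonneg z]) (abs_nonneg _)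
      (by linarith [M.L_pos])
    · linarith [hx.1.2, hb.1]
    · linarith [hx.1.1, hb.2])
  obtain ⟨h1, -, h3, h4⟩ := hπ.integral_jumpSize hΦ (by simp [Φ]) hfin
  obtain ⟨h5, h6⟩ := X.poisson.integral_compensator (measurable_comp_jumpSize X hΦ) h1
  have hmarg : (fun x : Set.Icc t₀ M.T × Ω =>
      ∑ i, π x.1 x.2 i * ∫ z, Φ (x, z) ∂(M.η x.1 i)) =
      fun x => (h x.1 x.2 - X.feedback π hs x.1 x.2) *
        M.marginal x.1 (π x.1 x.2) (X.feedback π hs x.1 x.2) := by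
    funext x
    rw [marginal, Finset.mul_sum]
    refine Finset.sum_congr rfl fun i _ => ?_
    simp only [Φ]
    rw [integral_const_mul]
    ring
  rw [hmarg] at h3 h4
  exact ⟨h5, h3, h6.trans h4⟩

lemma integrable_growth :
    Integrable (fun x : Set.Icc t₀ M.T × Ω => X.growth π (X.feedback π hs) x.1 x.2)
      ((timeMeasure t₀ M.T).prod P) :=
  (integrable_drift (isAdmissible_feedback hπ hm hr hpos)).add
    (integral_log_feedback hπ hm hr hpos).2.2.1

/-- Expected logarithm of the terminal wealth of a log-optimal rule. -/
lemma integral_log_wealth_feedback (w : ℝ) :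
    Integrable (fun ω => Real.log w + ∫ s, (1 - X.feedback π hs s ω) * M.ρ ∂(timeMeasure t₀ M.T)
      + ∫ x, Real.log (1 + X.feedback π hs x.1 ω * X.jumpSize ω x) ∂(X.N ω)) P ∧
    ∫ ω, (Real.log w + ∫ s, (1 - X.feedback π hs s ω) * M.ρ ∂(timeMeasure t₀ M.T)
      + ∫ x, Real.log (1 + X.feedback π hs x.1 ω * X.jumpSize ω x) ∂(X.N ω)) ∂P =
    Real.log w
      + ∫ ω, ∫ s, X.growth π (X.feedback π hs) s ω ∂(timeMeasure t₀ M.T) ∂P := by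
  have hd := integrable_drift (isAdmissible_feedback hπ hm hr hpos)
  have hg := integrable_growth hπ hm hr hpos
  obtain ⟨h1, -, h3, h4⟩ := integral_log_feedback hπ hm hr hpos
  have hc : Integrable (fun _ : Ω => Real.log w) P := integrable_const _
  have hd' : Integrable (fun ω => ∫ s, (1 - X.feedback π hs s ω) * M.ρ ∂(timeMeasure t₀ M.T)) P :=
    hd.integral_prod_right
  have hcd : Integrable (fun ω => Real.log w +
      ∫ s, (1 - X.feedback π hs s ω) * M.ρ ∂(timeMeasure t₀ M.T)) P := hc.add hd'
  refine ⟨hcd.add h1, ?_⟩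
  rw [integral_add hcd h1, integral_add hc hd', integral_const, h4,
    ← integral_prod_symm _ hd, ← integral_prod_symm _ hg, add_assoc, ← integral_add hd h3]
  simp only [probReal_univ, one_smul]
  rfl

/-- A log-optimal rule dominates every admissible strategy. -/
lemma reward_le {w : ℝ} (hw : 0 < w) {h W : Set.Icc t₀ M.T → Ω → ℝ} (hh : X.IsAdmissible h)
    (hW : X.IsWealth w h W) :
    X.reward W ≤ ((Real.log w
      + ∫ ω, ∫ s, X.growth π (X.feedback π hs) s ω ∂(timeMeasure t₀ M.T) ∂P : ℝ) : EReal) := by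
  set k := X.feedback π hs with hkdef
  have hadm : X.IsAdmissible k := isAdmissible_feedback hπ hm hr hpos
  obtain ⟨hB, hBint⟩ := integral_log_wealth_feedback hπ hm hr hpos w
  obtain ⟨h1, h2, h3⟩ := integral_tangent hπ hm hr hpos hh
  simp only [← hkdef] at hB hBint h1 h2 h3
  have hdh := integrable_drift hh
  have hdk := integrable_drift hadm
  have hd : Integrable (fun x : Set.Icc t₀ M.T × Ω =>
      (1 - h x.1 x.2) * M.ρ - (1 - k x.1 x.2) * M.ρ) ((timeMeasure t₀ M.T).prod P) := hdh.sub hdk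
  have hd' : Integrable (fun ω => ∫ s, ((1 - h s ω) * M.ρ - (1 - k s ω) * M.ρ)
      ∂(timeMeasure t₀ M.T)) P := hd.integral_prod_right
  have hsec : ∀ {g : Set.Icc t₀ M.T → Ω → ℝ}, X.IsAdmissible g →
      ∀ᵐ ω ∂P, Integrable (fun s => (1 - g s ω) * M.ρ) (timeMeasure t₀ M.T) := fun hg =>
    (integrable_drift hg).prod_left_ae
  have hle : ∀ᵐ ω ∂P, Real.log (W ⊤ ω) ≤
      (Real.log w + ∫ s, (1 - k s ω) * M.ρ ∂(timeMeasure t₀ M.T)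
      + ∫ x, Real.log (1 + k x.1 ω * X.jumpSize ω x) ∂(X.N ω)) +
      (∫ s, ((1 - h s ω) * M.ρ - (1 - k s ω) * M.ρ) ∂(timeMeasure t₀ M.T) +
        ∫ x, (h x.1 ω - k x.1 ω) *
          (X.jumpSize ω x / (1 + k x.1 ω * X.jumpSize ω x)) ∂(X.N ω)) := by
    filter_upwards [X.ae_log_wealth hw hh hW, X.poisson.ae_exists_finset,
      X.ae_one_add_mul_jumpSize_pos hh.predictable hh.positive,
      X.ae_one_add_mul_jumpSize_pos hadm.predictable hadm.positive, hsec hh, hsec hadm]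
      with ω hω hfin hph hpk ih ik
    obtain ⟨A, -, -, hA⟩ := hfin
    -- A finite sum of point masses integrates every function, so the pathwise comparison needs no
    -- moment condition on `h`.
    have hint : ∀ φ : Set.Icc t₀ M.T × M.Z → ℝ, Integrable φ (X.N ω) := fun φ => by
      rw [hA]; exact integrable_sum_dirac A φ
    have hjump : ∫ x, Real.log (1 + h x.1 ω * X.jumpSize ω x) ∂(X.N ω) ≤
        ∫ x, (Real.log (1 + k x.1 ω * X.jumpSize ω x) + (h x.1 ω - k x.1 ω) *
          (X.jumpSize ω x / (1 + k x.1 ω * X.jumpSize ω x))) ∂(X.N ω) := by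
      refine integral_mono_ae (hint _) (hint _) ?_
      filter_upwards [measure_eq_zero_iff_ae_notMem.1 hph, measure_eq_zero_iff_ae_notMem.1 hpk]
        with x hxh hxk
      exact log_one_add_mul_le (not_le.1 hxh) (not_le.1 hxk)
    rw [integral_add (hint _) (hint _)] at hjump
    rw [hω, integral_sub ih ik]
    linarith
  have hE : ∫ ω, (∫ s, ((1 - h s ω) * M.ρ - (1 - k s ω) * M.ρ) ∂(timeMeasure t₀ M.T) +
        ∫ x, (h x.1 ω - k x.1 ω) *
          (X.jumpSize ω x / (1 + k x.1 ω * X.jumpSize ω x)) ∂(X.N ω)) ∂P ≤ 0 := by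
    have h5 : ∫ ω, ∫ s, ((1 - h s ω) * M.ρ - (1 - k s ω) * M.ρ) ∂(timeMeasure t₀ M.T) ∂P =
        ∫ x : Set.Icc t₀ M.T × Ω, ((1 - h x.1 x.2) * M.ρ - (1 - k x.1 x.2) * M.ρ)
          ∂((timeMeasure t₀ M.T).prod P) := (integral_prod_symm _ hd).symm
    rw [integral_add hd' h1, h3, h5, ← integral_add hd h2]
    -- Drift and tangent combine to `(h - k) (marginal - ρ)`, which is nonpositive by the
    -- first-order condition.
    refine integral_nonpos_of_ae ?_
    filter_upwards [ae_isLogRule hπ hr, ae_prod_of_ae_chance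
      (Q := fun x => h x.1 x.2 ∈ Set.Icc (-M.L) M.L) hh.bounded] with x hx hb
    have := hx.mul_sub_nonpos hb
    simp only [Pi.zero_apply]
    rw [← hkdef] at this
    linarith
  have hD : Integrable (fun ω => ∫ s, ((1 - h s ω) * M.ρ - (1 - k s ω) * M.ρ)
      ∂(timeMeasure t₀ M.T) + ∫ x, (h x.1 ω - k x.1 ω) *
        (X.jumpSize ω x / (1 + k x.1 ω * X.jumpSize ω x)) ∂(X.N ω)) P := hd'.add h1
  have hBD := hB.add hD
  refine (extExpectation_mono hle).trans ?_
  refine (extExpectation_of_integrable hBD).trans_le ?_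
  rw [EReal.coe_le_coe_iff, integral_add' hB hD, hBint]
  exact add_le_of_nonpos_right hE

/-- The reward of a log-optimal rule. -/
lemma reward_feedback {w : ℝ} (hw : 0 < w) {W : Set.Icc t₀ M.T → Ω → ℝ}
    (hW : X.IsWealth w (X.feedback π hs) W) :
    X.reward W = ((Real.log w
      + ∫ ω, ∫ s, X.growth π (X.feedback π hs) s ω ∂(timeMeasure t₀ M.T) ∂P : ℝ) : EReal) := by
  obtain ⟨hB, hBint⟩ := integral_log_wealth_feedback hπ hm hr hpos w
  rw [reward, extExpectation_congr (X.ae_log_wealth hw (isAdmissible_feedback hπ hm hr hpos) hW),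
    extExpectation_of_integrable hB, hBint]

lemma value_eq {w : ℝ} (hw : 0 < w) :
    X.value w = ((Real.log w
      + ∫ ω, ∫ s, X.growth π (X.feedback π hs) s ω ∂(timeMeasure t₀ M.T) ∂P : ℝ) : EReal) := by
  have hadm := isAdmissible_feedback hπ hm hr hpos
  refine le_antisymm ?_ ?_
  · exact iSup₂_le fun h hh => iSup₂_le fun W hW => reward_le hπ hm hr hpos hw hh hW
  · obtain ⟨W, hW⟩ := X.exists_isWealth w hadm
    rw [← reward_feedback hπ hm hr hpos hw hW]
    exact le_iSup₂_of_le _ hadm (le_iSup₂_of_le W hW le_rfl)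

end Rule

end Market.Model

/-! ### Existence of a log-optimal rule -/

lemma measurable_div_one_add_mul (h : ℝ) : Measurable fun z : ℝ => z / (1 + h * z) := by
  fun_prop

/-- An affine function of `h` that is positive at both ends of `[-L, L]` is positive in between. -/
lemma one_add_mul_pos_of_abs_le {L h z : ℝ} (h1 : 0 < 1 + L * z) (h2 : 0 < 1 + -L * z)
    (hh : h ∈ Set.Icc (-L) L) : 0 < 1 + h * z := by
  rcases le_total 0 z with h0 | h0
  · nlinarith [hh.1]
  · nlinarith [hh.2]

/-- Positivity at both ends gives `L |z| ≤ 1`, so `1 + h z ≥ 1 - |h| |z| ≥ (L - |h|) |z|`. At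
interior positions the integrand is bounded uniformly in `z`. -/
lemma abs_div_one_add_mul_le {L h z : ℝ} (h1 : 0 < 1 + L * z) (h2 : 0 < 1 + -L * z)
    (hh : h ∈ Set.Ioo (-L) L) : |z / (1 + h * z)| ≤ 1 / (L - |h|) := by
  have hL : 0 < L - |h| := by linarith [abs_lt.2 hh]
  have hz := one_add_mul_pos_of_abs_le h1 h2 ⟨hh.1.le, hh.2.le⟩
  rw [abs_div, abs_of_pos hz, div_le_div_iff₀ hz hL, one_mul]
  have h3 : -(|h| * |z|) ≤ h * z := by rw [← abs_mul]; exact neg_abs_le _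
  have h4 : L * |z| ≤ 1 := by
    rcases abs_cases z with ⟨h, -⟩ | ⟨h, -⟩ <;> rw [h] <;> linarith
  nlinarith

lemma div_one_add_mul_le_div {h k z : ℝ} (hk : h ≤ k) (h1 : 0 < 1 + h * z) (h2 : 0 < 1 + k * z) :
    z / (1 + k * z) ≤ z / (1 + h * z) := by
  rw [div_le_div_iff₀ h2 h1]
  nlinarith [mul_nonneg (sub_nonneg.2 hk) (sq_nonneg z)]

section Measure

variable {ν : Measure ℝ} [IsFiniteMeasure ν] {L : ℝ}

lemma integrable_div_one_add_mul (h1 : ∀ᵐ z ∂ν, 0 < 1 + L * z) (h2 : ∀ᵐ z ∂ν, 0 < 1 + -L * z)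
    {h : ℝ} (hh : h ∈ Set.Ioo (-L) L) : Integrable (fun z => z / (1 + h * z)) ν := by
  refine Integrable.of_bound (measurable_div_one_add_mul h).aestronglyMeasurable (1 / (L - |h|)) ?_
  filter_upwards [h1, h2] with z hz1 hz2 using abs_div_one_add_mul_le hz1 hz2 hh

lemma antitoneOn_integral_div_one_add_mul (h1 : ∀ᵐ z ∂ν, 0 < 1 + L * z)
    (h2 : ∀ᵐ z ∂ν, 0 < 1 + -L * z) :
    AntitoneOn (fun h => ∫ z, z / (1 + h * z) ∂ν) (Set.Ioo (-L) L) := by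
  intro h hh k hk hle
  refine integral_mono_ae (integrable_div_one_add_mul h1 h2 hk)
    (integrable_div_one_add_mul h1 h2 hh) ?_
  filter_upwards [h1, h2] with z hz1 hz2
  exact div_one_add_mul_le_div hle (one_add_mul_pos_of_abs_le hz1 hz2 ⟨hh.1.le, hh.2.le⟩)
    (one_add_mul_pos_of_abs_le hz1 hz2 ⟨hk.1.le, hk.2.le⟩)

lemma continuousAt_integral_div_one_add_mul (h1 : ∀ᵐ z ∂ν, 0 < 1 + L * z)
    (h2 : ∀ᵐ z ∂ν, 0 < 1 + -L * z) {h : ℝ} (hh : h ∈ Set.Ioo (-L) L) :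
    ContinuousAt (fun h => ∫ z, z / (1 + h * z) ∂ν) h := by
  obtain ⟨c, hc1, hc2⟩ := exists_between (abs_lt.2 hh)
  have hnear : ∀ᶠ k in 𝓝 h, |k| < c := continuousAt_id.abs.eventually_lt_const hc1
  refine continuousAt_of_dominated (bound := fun _ => 1 / (L - c))
    (Eventually.of_forall fun k => (measurable_div_one_add_mul k).aestronglyMeasurable) ?_
    (integrable_const _) ?_
  · filter_upwards [hnear] with k hk
    filter_upwards [h1, h2] with z hz1 hz2
    refine (abs_div_one_add_mul_le hz1 hz2 (abs_lt.1 (hk.trans hc2))).trans ?_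
    exact one_div_le_one_div_of_le (by linarith) (by linarith)
  · filter_upwards [h1, h2] with z hz1 hz2
    have := one_add_mul_pos_of_abs_le hz1 hz2 ⟨hh.1.le, hh.2.le⟩
    exact continuousAt_const.div (by fun_prop) this.ne'

omit [IsFiniteMeasure ν] in
/-- Lower bounds along a segment give integrability at its end point. -/
lemma integrable_div_one_add_mul_of_le {k C : ℝ} {a : ℕ → ℝ} (ha : ∀ n, a n ∈ Set.Ico 0 1)
    (hlim : Tendsto a atTop (𝓝 1)) (hk : ∀ᵐ z ∂ν, 0 < 1 + k * z) (hk0 : k ≠ 0)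
    (hz : Integrable (fun z => z) ν) (hint : ∀ n, Integrable (fun z => z / (1 + a n * k * z)) ν)
    (hC : ∀ n, k * (∫ z, z ∂ν - ∫ z, z / (1 + a n * k * z) ∂ν) ≤ C) :
    Integrable (fun z => z / (1 + k * z)) ν := by
  have hkn : ∀ᵐ z ∂ν, ∀ n, 0 < 1 + a n * k * z := by
    filter_upwards [hk] with z hz n
    nlinarith [(ha n).1, (ha n).2]
  -- The difference equals `a n * (k * z) ^ 2 / (1 + a n * k * z)`. Being nonnegative, its integral
  -- is its norm, so `hC` is an `L¹` bound uniform in `n`, as Fatou's lemma requires.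
  have hnonneg : ∀ n, ∀ᵐ z ∂ν, 0 ≤ k * (z - z / (1 + a n * k * z)) := by
    intro n
    filter_upwards [hkn] with z hz
    have h3 : k * (z - z / (1 + a n * k * z)) = a n * (k * z) ^ 2 / (1 + a n * k * z) := by
      rw [eq_div_iff (hz n).ne', mul_assoc, sub_mul, div_mul_cancel₀ _ (hz n).ne']
      ring
    rw [h3]
    exact div_nonneg (mul_nonneg (ha n).1 (sq_nonneg _)) (hz n).le
  have hle : ∀ n, ∫⁻ z, ‖k * (z - z / (1 + a n * k * z))‖ₑ ∂ν ≤ ENNReal.ofReal C := by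
    intro n
    have hi : Integrable (fun z => k * (z - z / (1 + a n * k * z))) ν :=
      (hz.sub (hint n)).const_mul k
    rw [← ofReal_integral_norm_eq_lintegral_enorm hi]
    refine ENNReal.ofReal_le_ofReal (le_trans (le_of_eq ?_) (hC n))
    rw [← integral_sub hz (hint n), ← integral_const_mul]
    refine integral_congr_ae ?_
    filter_upwards [hnonneg n] with z hz using Real.norm_of_nonneg hz
  have hlimz : ∀ᵐ z ∂ν, Tendsto (fun n => k * (z - z / (1 + a n * k * z))) atTop
      (𝓝 (k * (z - z / (1 + k * z)))) := by
    filter_upwards [hk] with z hz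
    have h4 : Tendsto (fun n => 1 + a n * k * z) atTop (𝓝 (1 + 1 * k * z)) :=
      ((hlim.mul_const k).mul_const z).const_add 1
    rw [one_mul] at h4
    exact ((tendsto_const_nhds.div h4 hz.ne').const_sub z).const_mul k
  have hfatou : Integrable (fun z => k * (z - z / (1 + k * z))) ν := by
    refine ⟨by fun_prop, ?_⟩
    have h5 : ∫⁻ z, ‖k * (z - z / (1 + k * z))‖ₑ ∂ν ≤
        liminf (fun n => ∫⁻ z, ‖k * (z - z / (1 + a n * k * z))‖ₑ ∂ν) atTop :=
      (lintegral_mono_ae (hlimz.mono fun z hz => hz.enorm.liminf_eq.ge)).trans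
        (lintegral_liminf_le fun n => by fun_prop)
    exact (h5.trans (liminf_le_of_le (by isBoundedDefault)
      fun b hb => hb.exists.elim fun n hn => hn.trans (hle n))).trans_lt ENNReal.ofReal_lt_top
  have h6 := hz.sub (hfatou.const_mul k⁻¹)
  refine h6.congr (Eventually.of_forall fun z => ?_)
  simp only [Pi.sub_apply]
  rw [inv_mul_cancel_left₀ hk0, sub_sub_cancel]

omit [IsFiniteMeasure ν] in
-- Dominated convergence along the ray to `k`: where `k z ≥ 0` the denominators are at least `1`,
-- and where `k z ≤ 0` they are at least `1 + k z`.
lemma tendsto_integral_div_one_add_mul {k : ℝ} {a : ℕ → ℝ} (ha : ∀ n, a n ∈ Set.Ico 0 1)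
    (hlim : Tendsto a atTop (𝓝 1)) (hk : ∀ᵐ z ∂ν, 0 < 1 + k * z)
    (hz : Integrable (fun z => z) ν) (hint : Integrable (fun z => z / (1 + k * z)) ν) :
    Tendsto (fun n => ∫ z, z / (1 + a n * k * z) ∂ν) atTop (𝓝 (∫ z, z / (1 + k * z) ∂ν)) := by
  refine tendsto_integral_of_dominated_convergence (fun z => |z| + |z / (1 + k * z)|)
    (fun n => (measurable_div_one_add_mul _).aestronglyMeasurable) (hz.abs.add hint.abs) ?_ ?_
  · intro n
    filter_upwards [hk] with z hz
    have hn : 0 < 1 + a n * k * z := by nlinarith [(ha n).1, (ha n).2]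
    rw [Real.norm_eq_abs, abs_div, abs_div, abs_of_pos hn, abs_of_pos hz]
    rcases le_total 0 (k * z) with h0 | h0
    · have := div_le_self (abs_nonneg z) (b := 1 + a n * k * z) (by nlinarith [(ha n).1])
      have := div_nonneg (abs_nonneg z) hz.le
      linarith
    · have := div_le_div_of_nonneg_left (abs_nonneg z) hz
        (show 1 + k * z ≤ 1 + a n * k * z by nlinarith [(ha n).2])
      linarith [abs_nonneg z]
  · filter_upwards [hk] with z hz
    have h4 : Tendsto (fun n => 1 + a n * k * z) atTop (𝓝 (1 + 1 * k * z)) :=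
      ((hlim.mul_const k).mul_const z).const_add 1
    rw [one_mul] at h4
    exact tendsto_const_nhds.div h4 hz.ne'

end Measure

namespace Market

variable {K : ℕ} {M : Market K} {t : ℝ} {q : Fin K → ℝ}

instance (t : ℝ) (i : Fin K) : IsFiniteMeasure (M.η t i) := by
  unfold η; infer_instance

lemma measurable_marginal (M : Market K) (h : ℝ) :
    Measurable fun x : ℝ × (Fin K → ℝ) => M.marginal x.1 x.2 h := by
  unfold marginal
  refine Finset.measurable_fun_sum _ fun j _ => ?_
  refine ((measurable_pi_apply j).comp measurable_snd).mul ?_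
  have h1 : (fun x : ℝ × (Fin K → ℝ) => ∫ z, z / (1 + h * z) ∂(M.η x.1 j)) =
      fun x => ∫ ζ, M.G x.1 j ζ / (1 + h * M.G x.1 j ζ) ∂M.ς := by
    funext x
    exact integral_η x.1 j (measurable_div_one_add_mul h) (by simp)
  rw [h1]
  have h2 : Measurable fun y : (ℝ × (Fin K → ℝ)) × M.Z => M.G y.1.1 j y.2 :=
    M.G_measurable.comp
      ((measurable_fst.comp measurable_fst).prodMk (measurable_const.prodMk measurable_snd))
  exact (((measurable_div_one_add_mul h).comp h2).stronglyMeasurable.integral_prod_right'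
    (ν := M.ς)).measurable

/-- The largest position at which the marginal still exceeds `ρ`. -/
def rule (M : Market K) (t : ℝ) (q : Fin K → ℝ) : ℝ :=
  ⨆ r : ℚ, Set.indicator {x : ℝ × (Fin K → ℝ) | (r : ℝ) ∈ Set.Ioo (-M.L) M.L ∧
    M.ρ < M.marginal x.1 x.2 r} (fun _ => r + M.L) (t, q) - M.L

/-- A countable supremum of indicators is Borel in `(t, q)`, which is why `rule` uses rational
positions. Adding `M.L` inside the indicator and subtracting it outside gives the value `-M.L` when
no position qualifies. -/
lemma measurable_rule (M : Market K) : Measurable (Function.uncurry M.rule) := by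
  refine Measurable.iSup fun r => Measurable.sub_const ?_ _
  refine measurable_const.indicator ?_
  exact (MeasurableSet.const _).inter (measurableSet_lt measurable_const (M.measurable_marginal r))

lemma bddAbove_rule (M : Market K) (t : ℝ) (q : Fin K → ℝ) :
    BddAbove (Set.range fun r : ℚ =>
      Set.indicator {x : ℝ × (Fin K → ℝ) | (r : ℝ) ∈ Set.Ioo (-M.L) M.L ∧
        M.ρ < M.marginal x.1 x.2 r} (fun _ => r + M.L) (t, q) - M.L) := by
  refine ⟨M.L, ?_⟩
  rintro _ ⟨r, rfl⟩
  simp only [Set.indicator_apply, Set.mem_ofPred_eq]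
  split_ifs with h
  · linarith [h.1.2]
  · linarith [M.L_pos]

lemma rule_mem (M : Market K) (t : ℝ) (q : Fin K → ℝ) : M.rule t q ∈ Set.Icc (-M.L) M.L := by
  constructor
  · refine le_ciSup_of_le (M.bddAbove_rule t q) 0 ?_
    simp only [Set.indicator_apply, Set.mem_ofPred_eq]
    split_ifs <;> simp [M.L_pos.le]
  · refine ciSup_le fun r => ?_
    simp only [Set.indicator_apply, Set.mem_ofPred_eq]
    split_ifs with h
    · linarith [h.1.2]
    · linarith [M.L_pos]

/-! ### The first-order condition for `rule` -/

section Positive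

variable (hη : ∀ i, ∀ h ∈ Set.Icc (-M.L) M.L, M.η t i {z | 1 + h * z ≤ 0} = 0)

include hη

lemma ae_one_add_mul_pos {h : ℝ} (hh : h ∈ Set.Icc (-M.L) M.L) (i : Fin K) :
    ∀ᵐ z ∂(M.η t i), 0 < 1 + h * z := by
  rw [ae_iff]; simpa using hη i h hh

lemma ae_one_add_L_mul_pos (i : Fin K) : ∀ᵐ z ∂(M.η t i), 0 < 1 + M.L * z :=
  ae_one_add_mul_pos hη ⟨by linarith [M.L_pos], le_rfl⟩ i

lemma ae_one_sub_L_mul_pos (i : Fin K) : ∀ᵐ z ∂(M.η t i), 0 < 1 + -M.L * z :=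
  ae_one_add_mul_pos hη ⟨le_rfl, by linarith [M.L_pos]⟩ i

lemma integrable_marginal {h : ℝ} (hh : h ∈ Set.Ioo (-M.L) M.L) (i : Fin K) :
    Integrable (fun z => z / (1 + h * z)) (M.η t i) :=
  integrable_div_one_add_mul (ae_one_add_L_mul_pos hη i) (ae_one_sub_L_mul_pos hη i) hh

lemma antitoneOn_marginal (hq : ∀ i, 0 ≤ q i) :
    AntitoneOn (M.marginal t q) (Set.Ioo (-M.L) M.L) := fun _ hh _ hk hle =>
  Finset.sum_le_sum fun i _ => mul_le_mul_of_nonneg_left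
    (antitoneOn_integral_div_one_add_mul (ae_one_add_L_mul_pos hη i)
      (ae_one_sub_L_mul_pos hη i) hh hk hle) (hq i)

lemma continuousAt_marginal {h : ℝ} (hh : h ∈ Set.Ioo (-M.L) M.L) :
    ContinuousAt (M.marginal t q) h :=
  tendsto_finsetSum _ fun i _ => (continuousAt_integral_div_one_add_mul
    (ae_one_add_L_mul_pos hη i) (ae_one_sub_L_mul_pos hη i) hh).const_mul (q i)

/-- Passage to an end point of the interval of positions. -/
lemma mul_le_mul_marginal_of_forall (hq : ∀ i, 0 ≤ q i) {k : ℝ} (hk : |k| = M.L)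
    (hm : ∀ h ∈ Set.Ioo (-M.L) M.L, k * M.ρ ≤ k * M.marginal t q h) :
    (∀ i, q i ≠ 0 → Integrable (fun z => z / (1 + k * z)) (M.η t i)) ∧
      k * M.ρ ≤ k * M.marginal t q k := by
  have hL := M.L_pos
  have hk0 : k ≠ 0 := fun h => by rw [h, abs_zero] at hk; linarith
  have hkpos : ∀ i, ∀ᵐ z ∂(M.η t i), 0 < 1 + k * z :=
    ae_one_add_mul_pos hη (abs_le.1 hk.le)
  -- The endpoint `k = ±L` is approached from inside along `a n * k`. The factor `k` in the
  -- hypothesis carries the sign, so both endpoints are treated at once.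
  let a : ℕ → ℝ := fun n => 1 - 1 / ((n : ℝ) + 1)
  have ha : ∀ n, a n ∈ Set.Ico 0 1 := by
    intro n
    have h1 : (0 : ℝ) < 1 / ((n : ℝ) + 1) := by positivity
    have h2 : 1 / ((n : ℝ) + 1) ≤ 1 := by
      rw [div_le_one (by positivity)]; linarith [Nat.cast_nonneg (α := ℝ) n]
    exact ⟨by simp only [a]; linarith, by simp only [a]; linarith⟩
  have hlim : Tendsto a atTop (𝓝 1) := by
    have h1 := (tendsto_one_div_add_atTop_nhds_zero_nat (𝕜 := ℝ)).const_sub 1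
    rwa [sub_zero] at h1
  have hmem : ∀ n, a n * k ∈ Set.Ioo (-M.L) M.L := fun n => by
    rw [Set.mem_Ioo, ← abs_lt, abs_mul, hk, abs_of_nonneg (ha n).1]
    nlinarith [(ha n).2]
  have hma : ∀ n, k * M.ρ ≤ k * M.marginal t q (a n * k) := fun n =>
    hm _ (hmem n)
  have hz : ∀ i, Integrable (fun z => z) (M.η t i) := fun i => by
    simpa using integrable_marginal hη (h := 0) ⟨by linarith, hL⟩ i
  have hnonneg : ∀ n i, 0 ≤ k * (∫ z, z ∂(M.η t i) - ∫ z, z / (1 + a n * k * z) ∂(M.η t i)) := by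
    intro n i
    rw [← integral_sub (hz i) (integrable_marginal hη (hmem n) i), ← integral_const_mul]
    refine integral_nonneg_of_ae ?_
    filter_upwards [ae_one_add_mul_pos hη ⟨(hmem n).1.le, (hmem n).2.le⟩ i] with z hz
    have h3 : k * (z - z / (1 + a n * k * z)) = a n * (k * z) ^ 2 / (1 + a n * k * z) := by
      rw [eq_div_iff hz.ne', mul_assoc, sub_mul, div_mul_cancel₀ _ hz.ne']
      ring
    simp only [Pi.zero_apply]
    rw [h3]
    exact div_nonneg (mul_nonneg (ha n).1 (sq_nonneg _)) hz.le
  have hint : ∀ i, q i ≠ 0 → Integrable (fun z => z / (1 + k * z)) (M.η t i) := by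
    intro i hi
    have hqi : 0 < q i := lt_of_le_of_ne (hq i) hi.symm
    refine integrable_div_one_add_mul_of_le (C := k * (∑ j, q j * ∫ z, z ∂(M.η t j) - M.ρ) / q i)
      ha hlim (hkpos i) hk0 (hz i) (fun n => integrable_marginal hη (hmem n) i) fun n => ?_
    rw [le_div_iff₀ hqi]
    -- Only the sum over states is controlled by the hypothesis. All its terms are nonnegative, so
    -- each one is bounded by the sum, and dividing by `q i > 0` gives a bound independent of `n`.
    have h4 : (k * (∫ z, z ∂(M.η t i) - ∫ z, z / (1 + a n * k * z) ∂(M.η t i))) * q i ≤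
        ∑ j, (k * (∫ z, z ∂(M.η t j) - ∫ z, z / (1 + a n * k * z) ∂(M.η t j))) * q j :=
      Finset.single_le_sum (f := fun j =>
        (k * (∫ z, z ∂(M.η t j) - ∫ z, z / (1 + a n * k * z) ∂(M.η t j))) * q j)
        (fun j _ => mul_nonneg (hnonneg n j) (hq j)) (Finset.mem_univ i)
    have h5 : ∑ j, (k * (∫ z, z ∂(M.η t j) - ∫ z, z / (1 + a n * k * z) ∂(M.η t j))) * q j =
        k * (∑ j, q j * ∫ z, z ∂(M.η t j)) - k * M.marginal t q (a n * k) := by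
      rw [marginal, Finset.mul_sum, Finset.mul_sum, ← Finset.sum_sub_distrib]
      exact Finset.sum_congr rfl fun j _ => by ring
    have := hma n
    rw [h5] at h4
    linarith
  refine ⟨hint, ?_⟩
  have hmlim : Tendsto (fun n => M.marginal t q (a n * k)) atTop (𝓝 (M.marginal t q k)) := by
    refine tendsto_finsetSum _ fun i _ => ?_
    rcases eq_or_ne (q i) 0 with h0 | h0
    · simp [h0]
    · exact (tendsto_integral_div_one_add_mul ha hlim (hkpos i) (hz i) (hint i h0)).const_mul _
  exact ge_of_tendsto' (hmlim.const_mul k) hma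

/-- Some rational beyond `h` has marginal above `ρ`, and the marginal decreases. A term of the
supremum equal to its default `-L` cannot exceed `h`. -/
lemma lt_marginal_of_lt_rule (hq : ∀ i, 0 ≤ q i) {h : ℝ} (hh : h ∈ Set.Ioo (-M.L) M.L)
    (hlt : h < M.rule t q) : M.ρ < M.marginal t q h := by
  obtain ⟨r, hr⟩ := exists_lt_of_lt_ciSup hlt
  simp only [Set.indicator_apply, Set.mem_ofPred_eq] at hr
  split_ifs at hr with h1
  · exact h1.2.trans_le (antitoneOn_marginal hη hq hh h1.1 (by linarith))
  · linarith [hh.1]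

lemma marginal_le_of_rule_lt (hq : ∀ i, 0 ≤ q i) {h : ℝ} (hh : h ∈ Set.Ioo (-M.L) M.L)
    (hlt : M.rule t q < h) : M.marginal t q h ≤ M.ρ := by
  by_contra! hc
  obtain ⟨r, hr1, hr2⟩ := exists_rat_btwn hlt
  have hr : (r : ℝ) ∈ Set.Ioo (-M.L) M.L :=
    ⟨(M.rule_mem t q).1.trans_lt hr1, hr2.trans hh.2⟩
  have h1 := le_ciSup (M.bddAbove_rule t q) r
  rw [Set.indicator_of_mem
    (show (t, q) ∈ {x : ℝ × (Fin K → ℝ) | (r : ℝ) ∈ Set.Ioo (-M.L) M.L ∧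
      M.ρ < M.marginal x.1 x.2 r} from
      ⟨hr, hc.trans_le (antitoneOn_marginal hη hq hr hh hr2.le)⟩)] at h1
  have h2 : (r : ℝ) + M.L - M.L ≤ M.rule t q := h1
  linarith

/-- The marginal exceeds `ρ` to the left of `rule` and is at most `ρ` to its right. At an interior
value continuity forces equality; at `±L` only one side is available, and its limit gives equality
or the corresponding endpoint inequality. -/
lemma isLogRule_rule (hq : ∀ i, 0 ≤ q i) : M.IsLogRule t q (M.rule t q) := by
  have hL := M.L_pos
  have hmem := M.rule_mem t q
  refine ⟨hmem, ?_⟩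
  rcases hmem.2.eq_or_lt with h1 | h1
  · obtain ⟨h2, h3⟩ := mul_le_mul_marginal_of_forall hη hq (k := M.L) (abs_of_pos hL)
      fun h hh => mul_le_mul_of_nonneg_left
        (lt_marginal_of_lt_rule hη hq hh (by rw [h1]; exact hh.2)).le hL.le
    rw [h1]
    refine ⟨h2, ?_⟩
    rcases (le_of_mul_le_mul_left h3 hL).eq_or_lt with h4 | h4
    · exact Or.inl h4.symm
    · exact Or.inr (Or.inl ⟨rfl, h4⟩)
  rcases hmem.1.eq_or_lt with h5 | h5
  · obtain ⟨h2, h3⟩ := mul_le_mul_marginal_of_forall hη hq (k := -M.L)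
      (by rw [abs_neg, abs_of_pos hL])
      fun h hh => mul_le_mul_of_nonpos_left
        (marginal_le_of_rule_lt hη hq hh (by rw [← h5]; exact hh.1)) (by linarith)
    rw [← h5]
    refine ⟨h2, ?_⟩
    rcases (show M.marginal t q (-M.L) ≤ M.ρ by nlinarith).eq_or_lt with h4 | h4
    · exact Or.inl h4
    · exact Or.inr (Or.inr ⟨rfl, h4⟩)
  have hI : M.rule t q ∈ Set.Ioo (-M.L) M.L := ⟨h5, h1⟩
  have hcont := continuousAt_marginal (q := q) hη hI
  have hnhds : ∀ᶠ h in 𝓝 (M.rule t q), h ∈ Set.Ioo (-M.L) M.L := Ioo_mem_nhds h5 h1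
  refine ⟨fun i _ => integrable_marginal hη hI i, Or.inl (le_antisymm ?_ ?_)⟩
  · refine le_of_tendsto (hcont.tendsto.mono_left (nhdsWithin_le_nhds (s := Set.Ioi (M.rule t q)))) ?_
    filter_upwards [self_mem_nhdsWithin, nhdsWithin_le_nhds hnhds] with h hh1 hh2
    exact marginal_le_of_rule_lt hη hq hh2 hh1
  · refine ge_of_tendsto (hcont.tendsto.mono_left (nhdsWithin_le_nhds (s := Set.Iio (M.rule t q)))) ?_
    filter_upwards [self_mem_nhdsWithin, nhdsWithin_le_nhds hnhds] with h hh1 hh2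
    exact (lt_marginal_of_lt_rule hη hq hh2 hh1).le

end Positive

/-- The set `Θ` is an uncountable union over times, but it lies in the union of the two null sets
for the positions `L` and `-L`. -/
lemma Model.keepsWealthPositive_of_mem_Icc {t₀ : ℝ} [Fact (t₀ ≤ M.T)] {p : Fin K → ℝ} {S₀ : ℝ}
    {Ω : Type*} [MeasurableSpace Ω] {P : Measure Ω} (X : M.Model t₀ p S₀ P)
    (hη : ∀ t ∈ Set.Icc t₀ M.T, ∀ i, ∀ h ∈ Set.Icc (-M.L) M.L, M.η t i {z | 1 + h * z ≤ 0} = 0)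
    {h : Set.Icc t₀ M.T → Ω → ℝ} (hh : ∀ s ω, h s ω ∈ Set.Icc (-M.L) M.L) :
    X.KeepsWealthPositive h := by
  refine Eventually.of_forall fun ω t i => ?_
  refine measure_eq_zero_iff_ae_notMem.2 ?_
  filter_upwards [ae_one_add_L_mul_pos (hη t t.2) i, ae_one_sub_L_mul_pos (hη t t.2) i]
    with z h1 h2
  rintro ⟨s, hs⟩
  exact absurd (one_add_mul_pos_of_abs_le h1 h2 (hh s ω)) (not_lt.2 hs)

end Market

end LogUtility

end

theorem proposition4p8 {K : ℕ} (M : LogUtility.Market K)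
    {t₀ : ℝ} (ht₀ : 0 ≤ t₀) [Fact (t₀ ≤ M.T)]
    {p : Fin K → ℝ} (hp : p ∈ stdSimplex ℝ (Fin K)) {S₀ : ℝ} (hS₀ : 0 < S₀)
    {Ω : Type*} [MeasurableSpace Ω] (P : Measure Ω) [IsProbabilityMeasure P]
    (X : M.Model t₀ p S₀ P)
    (π : Set.Icc t₀ M.T → Ω → Fin K → ℝ) (hπ : X.IsFilter π)
    {w : ℝ} (hw : 0 < w) :
    -- if every position in `[-L, L]` keeps wealth positive, a rule as in the statement exists
    ((∀ t ∈ Set.Icc t₀ M.T, ∀ i, ∀ h ∈ Set.Icc (-M.L) M.L, M.η t i {z | 1 + h * z ≤ 0} = 0) →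
      ∃ hs : ℝ → (Fin K → ℝ) → ℝ, Measurable (Function.uncurry hs) ∧
        (∀ t ∈ Set.Icc t₀ M.T, ∀ q ∈ stdSimplex ℝ (Fin K), M.IsLogRule t q (hs t q)) ∧
        X.KeepsWealthPositive (X.feedback π hs)) ∧
    -- every such rule is optimal and represents the value function
    (∀ hs : ℝ → (Fin K → ℝ) → ℝ, Measurable (Function.uncurry hs) →
      (∀ t ∈ Set.Icc t₀ M.T, ∀ q ∈ stdSimplex ℝ (Fin K), M.IsLogRule t q (hs t q)) →
      X.KeepsWealthPositive (X.feedback π hs) →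
      X.IsAdmissible (X.feedback π hs) ∧
      (∃ W, X.IsWealth w (X.feedback π hs) W) ∧
      (∀ W, X.IsWealth w (X.feedback π hs) W → X.reward W = X.value w) ∧
      (∀ᵐ x ∂((LogUtility.timeMeasure t₀ M.T).prod P), ∀ i, π x.1 x.2 i ≠ 0 →
        Integrable (fun z => Real.log (1 + X.feedback π hs x.1 x.2 * z)) (M.η x.1 i)) ∧
      Integrable (fun x : Set.Icc t₀ M.T × Ω => X.growth π (X.feedback π hs) x.1 x.2)
        ((LogUtility.timeMeasure t₀ M.T).prod P) ∧
      X.value w = ((Real.log w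
        + ∫ ω, ∫ s, X.growth π (X.feedback π hs) s ω ∂(LogUtility.timeMeasure t₀ M.T) ∂P : ℝ) : EReal)) := by
  refine ⟨fun hη => ⟨M.rule, M.measurable_rule,
    fun t ht q hq => LogUtility.Market.isLogRule_rule (hη t ht) hq.1,
    X.keepsWealthPositive_of_mem_Icc hη fun s ω => M.rule_mem _ _⟩, fun hs hm hr hpos => ?_⟩
  have hadm := LogUtility.Market.Model.isAdmissible_feedback hπ hm hr hpos
  have hvalue := LogUtility.Market.Model.value_eq hπ hm hr hpos hw
  refine ⟨hadm, X.exists_isWealth w hadm, fun W hW => ?_,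
    (LogUtility.Market.Model.integral_log_feedback hπ hm hr hpos).2.1,
    LogUtility.Market.Model.integrable_growth hπ hm hr hpos, hvalue⟩
  rw [hvalue, LogUtility.Market.Model.reward_feedback hπ hm hr hpos hw hW]
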